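/- Let $n,m\ge 0$ and let $\mathbb G=F_n\times\mathbb Z^m$, where $F_n$ is the free group on $x_1,\dots,x_n$. Elements of $\mathbb G$ are written $u\,t^{a}$ with free part $u\in F_n$ and $a\in\mathbb Z^m$, and are given to algorithms as pairs (word in $x_1^{\pm1},\dots,x_n^{\pm1}$, integer vector); finitely generated subgroups are given by finite lists of generators. For a subgroup $\mathcal H\le\mathbb G$, $g\in\mathbb G$ and $k\ge1$: $g$ is a $k$-root of $\mathcal H$ if $g^k\in\mathcal H$, and $\sqrt[k]{\mathcal H}$ is the set of $k$-roots of $\mathcal H$ in $\mathbb G$; the order of $g$ in $\mathcal H$ is the least $j\ge1$ with $g^j\in\mathcal H$ (and $0$ if there is none), and $\mathcal O_k(\mathcal H)$ is the set of elements of $\mathbb G$ of order $k$ in $\mathcal H$. For $X\subseteq\mathbb G$ put $X^{\mathcal H}=\{h^{-1}xh : x\in X,\ h\in\mathcal H\}$. There are algorithms which, on input a finite list of generators of a subgroup $\mathcal H\le\mathbb G$ and an integer $k\ge1$, do the following. (1) Compute a finite set $S$ of $k$-roots $w\,t^{a_w}$ of $\mathcal H$, with pairwise distinct free parts $w$, and,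 for each of them, a finite set of generators of a subgroup $\mathcal H_w\le\mathbb G$, such that the cosets $\mathcal H_w\,w\,t^{a_w}$ are pairwise disjoint and $$\sqrt[k]{\mathcal H}=\Big(\bigsqcup_{w t^{a_w}\in S}\mathcal H_w\,w\,t^{a_w}\Big)^{\mathcal H}.$$ (2) Decide, for a further input $g\in\mathbb G$, whether $g\in\mathcal O_k(\mathcal H)$; decide whether $\mathcal O_k(\mathcal H)\ne\varnothing$; and compute a finite set $S'$ of elements of order $k$ in $\mathcal H$ and, for each $g\in S'$, a finite set of generators of a subgroup $\mathcal H'_g\le\mathbb G$, such that the cosets $\mathcal H'_g\,g$ are pairwise disjoint and $$\mathcal O_k(\mathcal H)=\Big(\bigsqcup_{g\in S'}\mathcal H'_g\,g\Big)^{\mathcal H}$$ (with $S'=\varnothing$ when $\mathcal O_k(\mathcal H)=\varnothing$). -/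

import Mathlib

namespace FreeTimesAbelian

section Relative

variable {G : Type*} [Group G]

/-- The set of `k`-roots of a subset `S` of a group. -/
def kRoots (k : ℕ) (S : Set G) : Set G := {g | g ^ k ∈ S}

/-- The relative order of `g` in `S`: the least `k ≥ 1` with `g ^ k ∈ S`, and `0` if there is
none (`sInf ∅ = 0` in `ℕ`). -/
noncomputable def relOrder (S : Set G) (g : G) : ℕ := sInf {k : ℕ | 1 ≤ k ∧ g ^ k ∈ S}

/-- The set of elements of the group having order `k` in `S`. -/
def ofOrder (k : ℕ) (S : Set G) : Set G := {g | relOrder S g = k}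

/-- `X ^ H`: the set of conjugates `h⁻¹ * x * h` with `x ∈ X` and `h ∈ H`. -/
def conjBy (X : Set G) (H : Subgroup G) : Set G := {y | ∃ h ∈ H, ∃ x ∈ X, y = h⁻¹ * x * h}

/-- The right coset `K g`. -/
def rightCoset (K : Subgroup G) (g : G) : Set G := {y | ∃ x ∈ K, y = x * g}

end Relative

/-- The group `F_n × ℤ^m`. -/
abbrev FTA (n m : ℕ) : Type := FreeGroup (Fin n) × Multiplicative (Fin m → ℤ)

/-- Codes for elements of `F_n × ℤ^m`: a (not necessarily reduced) word in the letters
`x₁^{±1}, …, x_n^{±1}` together with an integer vector. -/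
abbrev Code (n m : ℕ) : Type := List (Fin n × Bool) × (Fin m → ℤ)

/-- The element `u t^a` of `F_n × ℤ^m` given by a code. -/
def Code.elt {n m : ℕ} (x : Code n m) : FTA n m :=
  (FreeGroup.mk x.1, Multiplicative.ofAdd x.2)

/-- The subgroup of `F_n × ℤ^m` generated by a finite list of (coded) elements. -/
def subgroupOf {n m : ℕ} (L : List (Code n m)) : Subgroup (FTA n m) :=
  Subgroup.closure {g | ∃ x ∈ L, Code.elt x = g}

/-- Codes for cosets `K g` of finitely generated subgroups: a list of generators of `K`
and a representative `g`. -/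
abbrev CosetCode (n m : ℕ) : Type := List (Code n m) × Code n m

/-- The representative of a coded coset. -/
def CosetCode.rep {n m : ℕ} (c : CosetCode n m) : FTA n m := Code.elt c.2

/-- The coded coset, as a set. -/
def CosetCode.coset {n m : ℕ} (c : CosetCode n m) : Set (FTA n m) :=
  rightCoset (subgroupOf c.1) (CosetCode.rep c)

/-- `X = (⨆_{c ∈ D} coset c) ^ H`, the union over the list `D` being disjoint and all the
representatives of the cosets lying in `X`. -/
structure IsCosetDecomposition {n m : ℕ} (H : Subgroup (FTA n m)) (X : Set (FTA n m))
    (D : List (CosetCode n m)) : Prop where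
  rep_mem : ∀ c ∈ D, CosetCode.rep c ∈ X
  disjoint : D.Pairwise fun c c' => Disjoint (CosetCode.coset c) (CosetCode.coset c')
  eq : X = conjBy {g | ∃ c ∈ D, g ∈ CosetCode.coset c} H

end FreeTimesAbelian

-- Let `H` be the given subgroup, `Q` the group of all `u t^a` with `u t^{ka} ∈ H`, and `P` the
-- group of free parts of `Q`. Since `(u t^a)^k = u^k t^{ka}`, the element `u t^a` is a `k`-root of
-- `H` iff `u^k t^a ∈ Q`. Hence the free parts of the `k`-roots of `H` are exactly the `k`-roots of
-- `P` in the free group.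
--
-- Roots of `P`. A root `v` is recorded by the vertices `P v^i`, `i ≤ k`, of the Schreier graph of
-- `P`. Up to conjugation by `P` only finitely many tuples occur: if `v = r c r⁻¹` with `c`
-- cyclically reduced, then `r c^k r⁻¹` is the reduced form of `v^k`, its path stays in the finite
-- core of the graph, and `r`, `c` may be replaced by short words with the same effect on the
-- vertices (`exists_short_rootEquiv`). The elements with the same tuple as `u` form the coset of
-- `u` under `rootStab P u k`, the stabilizer of a tuple of vertices, which has generators of
-- bounded length (`rootStab_le_closure`).
--
-- Lifting to the product. As `ℤ^m` is central, `H ℤ^m / H` is abelian. So `x ↦ (x g)^j g^{-j}`, the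
-- product of the `g^i x g^{-i}` for `i < j`, is a homomorphism modulo `H` on the elements with free
-- part in `rootStab` (`exists_delta`). Its kernel for `j = k` is the group `K` such that `K g`
-- consists of the `k`-roots over the coset. For `j < k` with `g^j ∈ H ℤ^m` its image on `K` has
-- exponent dividing `k`, hence is finite; so whether `x g` has order `k` depends only on `x` modulo
-- a subgroup of finite index in `K`.
--
-- Algorithms. Each decomposition is found by unbounded search for a finite certificate
-- (`SemiDec.exists_computable`). It suffices that the certificates are semidecidable, sound, and
-- always exist. Positive clauses come from enumerating products of generators. Negative ones need a
-- certificate of non-membership (`notMem_subgroupOf_iff`): a weighted Schreier automaton settles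
-- the free part, and a character `ℤ^m → ℤ/q` the vector part.

attribute [fun_prop] Primrec

namespace FreeTimesAbelian

/-! ### Semidecidable predicates and uniformization -/

section Semidecidable

variable {α β γ : Type*} [Primcodable α] [Primcodable β] [Primcodable γ]

@[fun_prop]
theorem primrec_id : Primrec (fun a : α => a) := Primrec.id

@[fun_prop]
theorem primrec_const (b : β) : Primrec (fun _ : α => b) := Primrec.const b

@[fun_prop]
theorem primrec_comp {f : β → γ} {g : α → β} (hf : Primrec f) (hg : Primrec g) :
    Primrec fun a => f (g a) := hf.comp hg

@[fun_prop]
theorem primrec_pair {f : α → β} {g : α → γ} (hf : Primrec f) (hg : Primrec g) :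
    Primrec fun a => (f a, g a) := hf.pair hg

@[fun_prop]
theorem primrec_fst {f : α → β × γ} (hf : Primrec f) : Primrec fun a => (f a).1 :=
  Primrec.fst.comp hf

@[fun_prop]
theorem primrec_snd {f : α → β × γ} (hf : Primrec f) : Primrec fun a => (f a).2 :=
  Primrec.snd.comp hf

/-- Semidecidable predicates, in the normal form `∃ n, q a n` with `q` primitive recursive. -/
def SemiDec (p : α → Prop) : Prop :=
  ∃ q : α → ℕ → Prop, PrimrecRel q ∧ ∀ a, p a ↔ ∃ n, q a n

namespace SemiDec

theorem of_iff {p q : α → Prop} (hp : SemiDec p) (h : ∀ a, q a ↔ p a) : SemiDec q := by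
  obtain ⟨r, hr, H⟩ := hp
  exact ⟨r, hr, fun a => (h a).trans (H a)⟩

theorem of_primrec {p : α → Prop} (hp : PrimrecPred p) : SemiDec p :=
  ⟨fun a _ => p a, hp.comp (f := fun x : α × ℕ => x.1) Primrec.fst, fun a => by simp⟩

theorem comp {p : β → Prop} (hp : SemiDec p) {f : α → β} (hf : Primrec f) :
    SemiDec fun a => p (f a) := by
  obtain ⟨r, hr, H⟩ := hp
  exact ⟨fun a n => r (f a) n, PrimrecRel.comp (R := r) hr (hf.comp Primrec.fst) Primrec.snd,
    fun a => H (f a)⟩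

theorem and {p q : α → Prop} (hp : SemiDec p) (hq : SemiDec q) : SemiDec fun a => p a ∧ q a := by
  obtain ⟨r, hr, H⟩ := hp
  obtain ⟨s, hs, I⟩ := hq
  refine ⟨fun a n => r a n.unpair.1 ∧ s a n.unpair.2, ?_, fun a => ?_⟩
  · exact PrimrecPred.and
      (PrimrecRel.comp (R := r) hr Primrec.fst (Primrec.fst.comp (Primrec.unpair.comp Primrec.snd)))
      (PrimrecRel.comp (R := s) hs Primrec.fst (Primrec.snd.comp (Primrec.unpair.comp Primrec.snd)))
  · beta_reduce
    rw [H, I]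
    constructor
    · rintro ⟨⟨i, hi⟩, j, hj⟩
      exact ⟨Nat.pair i j, by simpa using ⟨hi, hj⟩⟩
    · rintro ⟨i, hi, hj⟩
      exact ⟨⟨_, hi⟩, _, hj⟩

theorem or {p q : α → Prop} (hp : SemiDec p) (hq : SemiDec q) : SemiDec fun a => p a ∨ q a := by
  obtain ⟨r, hr, H⟩ := hp
  obtain ⟨s, hs, I⟩ := hq
  refine ⟨fun a n => r a n ∨ s a n, PrimrecPred.or hr hs, fun a => ?_⟩
  beta_reduce
  rw [H, I, exists_or]

theorem ex {p : α → β → Prop} (hp : SemiDec fun x : α × β => p x.1 x.2) :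
    SemiDec fun a => ∃ b, p a b := by
  classical
  obtain ⟨r, hr, H⟩ := hp
  -- Dovetailing: `n` codes a candidate `b` together with a witness for it. Numbers that decode to
  -- nothing give the empty list.
  refine ⟨fun a n => ∃ b ∈ (Encodable.decode (α := β) n.unpair.1).toList, r (a, b) n.unpair.2, ?_,
    fun a => ?_⟩
  · have h1 : PrimrecRel fun (b : β) (y : α × ℕ) => r (y.1, b) y.2.unpair.2 :=
      PrimrecRel.comp (R := r) hr
        (Primrec.pair (Primrec.fst.comp Primrec.snd) Primrec.fst)
        (Primrec.snd.comp (Primrec.unpair.comp (Primrec.snd.comp Primrec.snd)))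
    exact PrimrecRel.comp h1.exists_mem_list
      (Primrec.optionToList.comp (Primrec.decode.comp
        (Primrec.fst.comp (Primrec.unpair.comp Primrec.snd)))) Primrec.id
  · constructor
    · rintro ⟨b, hb⟩
      obtain ⟨j, hj⟩ := (H (a, b)).1 hb
      exact ⟨Nat.pair (Encodable.encode b) j, b, by simp, by simpa using hj⟩
    · rintro ⟨n, b, -, hb⟩
      exact ⟨b, (H (a, b)).2 ⟨_, hb⟩⟩

theorem all {p : α → β → Prop} (hp : SemiDec fun x : α × β => p x.1 x.2) {l : α → List β}
    (hl : Primrec l) : SemiDec fun a => ∀ b ∈ l a, p a b := by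
  classical
  obtain ⟨r, hr, H⟩ := hp
  -- A single `N` bounds the witnesses of all the members of the finite list, so the inner search
  -- stays primitive recursive.
  refine ⟨fun a N => ∀ b ∈ l a, ∃ i < N, r (a, b) i, ?_, fun a => ?_⟩
  · have h0 : PrimrecRel fun (i : ℕ) (y : β × (α × ℕ)) => r (y.2.1, y.1) i :=
      PrimrecRel.comp (R := r) hr (Primrec.pair (Primrec.fst.comp (Primrec.snd.comp Primrec.snd))
        (Primrec.fst.comp Primrec.snd)) Primrec.fst
    have h1 : PrimrecRel fun (b : β) (y : α × ℕ) => ∃ i < y.2, r (y.1, b) i :=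
      PrimrecPred.of_eq (PrimrecRel.comp h0.exists_mem_list
        (f := fun y : β × (α × ℕ) => List.range y.2.2) (g := id)
        (Primrec.list_range.comp (Primrec.snd.comp Primrec.snd)) Primrec.id) fun y => by simp
    exact PrimrecRel.comp h1.forall_mem_list (hl.comp Primrec.fst) Primrec.id
  · constructor
    · intro h
      have key : ∀ L : List β, (∀ b ∈ L, p a b) → ∃ N, ∀ b ∈ L, ∃ i < N, r (a, b) i := by
        intro L
        induction L with
        | nil => simp
        | cons b L ih =>
          intro hL
          obtain ⟨N, hN⟩ := ih fun c hc => hL c (List.mem_cons_of_mem _ hc)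
          obtain ⟨i, hi⟩ := (H (a, b)).1 (hL b List.mem_cons_self)
          refine ⟨max N (i + 1), fun c hc => ?_⟩
          rcases List.mem_cons.1 hc with rfl | hc
          · exact ⟨i, by omega, hi⟩
          · obtain ⟨j, hj, hr⟩ := hN c hc
            exact ⟨j, by omega, hr⟩
      exact key _ h
    · rintro ⟨N, hN⟩ b hb
      obtain ⟨i, -, hi⟩ := hN b hb
      exact (H (a, b)).2 ⟨i, hi⟩

theorem exMem {p : α → β → Prop} (hp : SemiDec fun x : α × β => p x.1 x.2) {l : α → List β}
    (hl : Primrec l) : SemiDec fun a => ∃ b ∈ l a, p a b := by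
  classical
  refine SemiDec.ex (SemiDec.and (of_primrec ?_) hp)
  have h : PrimrecRel fun (b : β) (c : β) => b = c := Primrec.eq
  refine (PrimrecRel.comp h.exists_mem_list (hl.comp Primrec.fst) Primrec.snd).of_eq fun x => ?_
  simp

theorem allLt {p : α → ℕ → Prop} (hp : SemiDec fun x : α × ℕ => p x.1 x.2) {f : α → ℕ}
    (hf : Primrec f) : SemiDec fun a => ∀ i < f a, p a i :=
  (all hp (Primrec.list_range.comp hf)).of_iff fun a => by simp

theorem exLt {p : α → ℕ → Prop} (hp : SemiDec fun x : α × ℕ => p x.1 x.2) {f : α → ℕ}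
    (hf : Primrec f) : SemiDec fun a => ∃ i < f a, p a i :=
  (exMem hp (Primrec.list_range.comp hf)).of_iff fun a => by simp

theorem pairwise {p : α → β → β → Prop} (hp : SemiDec fun x : (α × β) × β => p x.1.1 x.1.2 x.2)
    {l : α → List β} (hl : Primrec l) : SemiDec fun a => (l a).Pairwise (p a) := by
  have h2 : SemiDec fun a => ∀ i < (l a).length, ∀ j < i, ∃ y : β × β,
      (l a)[j]? = some y.1 ∧ (l a)[i]? = some y.2 ∧ p a y.1 y.2 := by
    refine allLt ?_ (Primrec.list_length.comp hl)
    refine allLt ?_ (by fun_prop)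
    refine ex ?_
    refine and (of_primrec ?_) (and (of_primrec ?_) ?_)
    · exact Primrec.eq.comp (Primrec.list_getElem?.comp (by fun_prop) (by fun_prop))
        (Primrec.option_some.comp (by fun_prop))
    · exact Primrec.eq.comp (Primrec.list_getElem?.comp (by fun_prop) (by fun_prop))
        (Primrec.option_some.comp (by fun_prop))
    · exact hp.comp (f := fun z : ((α × ℕ) × ℕ) × (β × β) => ((z.1.1.1, z.2.1), z.2.2))
        (by fun_prop)
  refine h2.of_iff fun a => ?_
  rw [List.pairwise_iff_getElem]
  constructor
  · intro h i hi j hj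
    exact ⟨((l a)[j], (l a)[i]), by simp [hj.trans hi], by simp [hi], h j i (hj.trans hi) hi hj⟩
  · intro h i j hi hj hij
    obtain ⟨⟨b, c⟩, hb, hc, hp⟩ := h j hj i hij
    simp only [List.getElem?_eq_getElem, hi, hj, Option.some.injEq] at hb hc
    rw [hb, hc]
    exact hp

/-- Uniformization: a total semidecidable relation contains the graph of a computable function. -/
theorem exists_computable {p : α → β → Prop} (hp : SemiDec fun x : α × β => p x.1 x.2)
    (h : ∀ a, ∃ b, p a b) : ∃ f : α → β, Computable f ∧ ∀ a, p a (f a) := by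
  classical
  obtain ⟨r, hr, H⟩ := hp
  -- Search over all pairs of a candidate and a witness; the output is the candidate of the first
  -- pair that passes.
  let g : α → ℕ → Option β := fun a n =>
    (Encodable.decode (α := β) n.unpair.1).bind fun b => if r (a, b) n.unpair.2 then some b else none
  have hg : Primrec₂ g := by
    refine Primrec.option_bind (Primrec.decode.comp (Primrec.fst.comp
      (Primrec.unpair.comp Primrec.snd))) ?_
    refine Primrec.ite ?_ (Primrec.option_some.comp Primrec.snd) (Primrec.const none)
    exact PrimrecRel.comp (R := r) hr
      (Primrec.pair (Primrec.fst.comp Primrec.fst) Primrec.snd)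
      (Primrec.snd.comp (Primrec.unpair.comp (Primrec.snd.comp Primrec.fst)))
  have hdom : ∀ a, (Nat.rfindOpt (g a)).Dom := by
    intro a
    obtain ⟨b, hb⟩ := h a
    obtain ⟨i, hi⟩ := (H (a, b)).1 hb
    refine Nat.rfindOpt_dom.2 ⟨Nat.pair (Encodable.encode b) i, b, ?_⟩
    simp [g, hi]
  have hpart : Partrec fun a => Nat.rfindOpt (g a) := Partrec.rfindOpt hg.to_comp
  refine ⟨fun a => (Nat.rfindOpt (g a)).get (hdom a), ?_, fun a => ?_⟩
  · refine Partrec.of_eq hpart fun a => ?_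
    exact (Part.some_get (hdom a)).symm
  · obtain ⟨n, hn⟩ := Nat.rfindOpt_spec (Part.get_mem (hdom a))
    simp only [g, Option.mem_def, Option.bind_eq_some_iff] at hn
    obtain ⟨b, -, hb⟩ := hn
    split_ifs at hb with hif
    · have hpb : p a b := (H (a, b)).2 ⟨_, hif⟩
      rw [Option.some.inj hb] at hpb
      exact hpb

/-- A predicate is decidable as soon as it and its negation are semidecidable. -/
theorem exists_decision {p : α → Prop} (hp : SemiDec p) (hn : SemiDec fun a => ¬ p a) :
    ∃ f : α → Bool, Computable f ∧ ∀ a, f a = true ↔ p a := by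
  -- The relation between an input and its truth value is semidecidable and total, so uniformization
  -- yields the decision procedure.
  have h : SemiDec fun x : α × Bool => (x.2 = true ∧ p x.1) ∨ (x.2 = false ∧ ¬ p x.1) :=
    or (and (of_primrec (Primrec.eq.comp Primrec.snd (Primrec.const true))) (hp.comp Primrec.fst))
      (and (of_primrec (Primrec.eq.comp Primrec.snd (Primrec.const false))) (hn.comp Primrec.fst))
  obtain ⟨f, hf, H⟩ := exists_computable
    (p := fun a b => (b = true ∧ p a) ∨ (b = false ∧ ¬ p a)) h fun a => by
    by_cases ha : p a
    · exact ⟨true, Or.inl ⟨rfl, ha⟩⟩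
    · exact ⟨false, Or.inr ⟨rfl, ha⟩⟩
  refine ⟨f, hf, fun a => ?_⟩
  rcases H a with ⟨h1, h2⟩ | ⟨h1, h2⟩ <;> simp_all

end SemiDec

end Semidecidable

end FreeTimesAbelian

namespace FreeTimesAbelian

/-! ### Primitive recursive operations on lists, integers and codes -/

section PrimrecLemmas

variable {α β γ σ : Type*} [Primcodable α] [Primcodable β] [Primcodable γ] [Primcodable σ]

@[fun_prop]
theorem primrec_append {f g : α → List β} (hf : Primrec f) (hg : Primrec g) :
    Primrec fun a => f a ++ g a := Primrec.list_append.comp hf hg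

@[fun_prop]
theorem primrec_cons {f : α → β} {g : α → List β} (hf : Primrec f) (hg : Primrec g) :
    Primrec fun a => f a :: g a := Primrec.list_cons.comp hf hg

@[fun_prop]
theorem primrec_length {f : α → List β} (hf : Primrec f) : Primrec fun a => (f a).length :=
  Primrec.list_length.comp hf

@[fun_prop]
theorem primrec_nat_add {f g : α → ℕ} (hf : Primrec f) (hg : Primrec g) :
    Primrec fun a => f a + g a := Primrec.nat_add.comp hf hg

@[fun_prop]
theorem primrec_nat_mul {f g : α → ℕ} (hf : Primrec f) (hg : Primrec g) :
    Primrec fun a => f a * g a := Primrec.nat_mul.comp hf hg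

@[fun_prop]
theorem primrec_nat_sub {f g : α → ℕ} (hf : Primrec f) (hg : Primrec g) :
    Primrec fun a => f a - g a := Primrec.nat_sub.comp hf hg

@[fun_prop]
theorem primrec_nat_pow {f g : α → ℕ} (hf : Primrec f) (hg : Primrec g) :
    Primrec fun a => f a ^ g a :=
  (Primrec₂.unpaired'.1 Nat.Primrec.pow).comp hf hg

@[fun_prop]
theorem primrec_map {f : α → List β} {g : α → β → γ} (hf : Primrec f)
    (hg : Primrec fun x : α × β => g x.1 x.2) : Primrec fun a => (f a).map (g a) :=
  Primrec.list_map hf hg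

@[fun_prop]
theorem primrec_flatMap {f : α → List β} {g : α → β → List γ} (hf : Primrec f)
    (hg : Primrec fun x : α × β => g x.1 x.2) : Primrec fun a => (f a).flatMap (g a) :=
  Primrec.list_flatMap hf hg

@[fun_prop]
theorem primrec_reverse {f : α → List β} (hf : Primrec f) : Primrec fun a => (f a).reverse :=
  Primrec.list_reverse.comp hf

theorem primrec_foldr {f : α → List β} {g : α → σ} {h : α → β → σ → σ} (hf : Primrec f)
    (hg : Primrec g) (hh : Primrec fun x : α × β × σ => h x.1 x.2.1 x.2.2) :
    Primrec fun a => (f a).foldr (h a) (g a) :=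
  Primrec.list_foldr (h := fun a x => h a x.1 x.2) hf hg hh

end PrimrecLemmas

section IntPrimrec

/-- Integers are encoded with the non-negative ones on even and the negative ones on odd numbers.
This gives access to the positive and negative parts, through which addition and multiplication
reduce to `ℕ`. -/
theorem encode_int_natCast (k : ℕ) : Encodable.encode (k : ℤ) = 2 * k := rfl

theorem encode_int_negSucc (k : ℕ) : Encodable.encode (Int.negSucc k) = 2 * k + 1 := rfl

theorem primrec_int_toNat : Primrec Int.toNat := by
  have h : Primrec fun z : ℤ => bif (Encodable.encode z).bodd then 0 else (Encodable.encode z).div2 :=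
    Primrec.cond (Primrec.nat_bodd.comp Primrec.encode) (Primrec.const 0)
      (Primrec.nat_div2.comp Primrec.encode)
  refine h.of_eq fun z => ?_
  cases z with
  | ofNat k =>
    rw [Int.ofNat_eq_natCast, encode_int_natCast]
    simp [Nat.div2_val]
  | negSucc k =>
    rw [encode_int_negSucc]
    simp

theorem primrec_int_neg_toNat : Primrec fun z : ℤ => (-z).toNat := by
  have h : Primrec fun z : ℤ => bif (Encodable.encode z).bodd then (Encodable.encode z).div2 + 1
      else 0 :=
    Primrec.cond (Primrec.nat_bodd.comp Primrec.encode)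
      (Primrec.succ.comp (Primrec.nat_div2.comp Primrec.encode)) (Primrec.const 0)
  refine h.of_eq fun z => ?_
  cases z with
  | ofNat k =>
    rw [Int.ofNat_eq_natCast, encode_int_natCast]
    simp
  | negSucc k =>
    rw [encode_int_negSucc]
    simp [Nat.div2_val, Int.neg_negSucc]

theorem primrec_int_subNat : Primrec fun x : ℕ × ℕ => (x.1 : ℤ) - x.2 := by
  have h : Primrec fun x : ℕ × ℕ => if x.2 ≤ x.1 then 2 * (x.1 - x.2) else 2 * (x.2 - x.1 - 1) + 1 :=
    Primrec.ite (Primrec.nat_le.comp Primrec.snd Primrec.fst) (by fun_prop) (by fun_prop)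
  rw [← Primrec.encode_iff]
  refine h.of_eq fun x => ?_
  split_ifs with hx
  · rw [← Int.ofNat_sub hx, encode_int_natCast]
  · have : (x.1 : ℤ) - x.2 = Int.negSucc (x.2 - x.1 - 1) := by
      rw [Int.negSucc_eq]; omega
    rw [this, encode_int_negSucc]

variable {α : Type*} [Primcodable α]

@[fun_prop]
theorem primrec_int_add {f g : α → ℤ} (hf : Primrec f) (hg : Primrec g) :
    Primrec fun a => f a + g a := by
  have hf1 := primrec_int_toNat.comp hf
  have hg1 := primrec_int_toNat.comp hg
  have hf2 := primrec_int_neg_toNat.comp hf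
  have hg2 := primrec_int_neg_toNat.comp hg
  refine (primrec_int_subNat.comp (Primrec.pair (primrec_nat_add hf1 hg1)
    (primrec_nat_add hf2 hg2))).of_eq fun a => ?_
  have h1 := Int.toNat_sub_toNat_neg (f a)
  have h2 := Int.toNat_sub_toNat_neg (g a)
  push_cast
  omega

@[fun_prop]
theorem primrec_int_mul {f g : α → ℤ} (hf : Primrec f) (hg : Primrec g) :
    Primrec fun a => f a * g a := by
  have hf1 := primrec_int_toNat.comp hf
  have hg1 := primrec_int_toNat.comp hg
  have hf2 := primrec_int_neg_toNat.comp hf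
  have hg2 := primrec_int_neg_toNat.comp hg
  refine (primrec_int_subNat.comp (Primrec.pair
    (primrec_nat_add (primrec_nat_mul hf1 hg1) (primrec_nat_mul hf2 hg2))
    (primrec_nat_add (primrec_nat_mul hf1 hg2) (primrec_nat_mul hf2 hg1)))).of_eq fun a => ?_
  have h1 := Int.toNat_sub_toNat_neg (f a)
  have h2 := Int.toNat_sub_toNat_neg (g a)
  conv_rhs => rw [← h1, ← h2]
  push_cast
  ring

@[fun_prop]
theorem primrec_int_neg {f : α → ℤ} (hf : Primrec f) : Primrec fun a => - f a :=
  (primrec_int_mul (Primrec.const (-1)) hf).of_eq fun a => by ring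

@[fun_prop]
theorem primrec_int_cast {f : α → ℕ} (hf : Primrec f) : Primrec fun a => (f a : ℤ) :=
  (primrec_int_subNat.comp (Primrec.pair hf (Primrec.const 0))).of_eq fun a => by simp

theorem primrec_int_dvd {f : α → ℕ} {g : α → ℤ} (hf : Primrec f) (hg : Primrec g) :
    PrimrecPred fun a => (f a : ℤ) ∣ g a := by
  have h : PrimrecPred fun a => ((g a).toNat + (-g a).toNat) % f a = 0 :=
    Primrec.eq.comp (Primrec.nat_mod.comp
      (primrec_nat_add (primrec_int_toNat.comp hg) (primrec_int_neg_toNat.comp hg)) hf)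
      (Primrec.const 0)
  refine h.of_eq fun a => ?_
  rw [← Nat.dvd_iff_mod_eq_zero, Int.natCast_dvd]
  have : (g a).toNat + (-g a).toNat = (g a).natAbs := by omega
  rw [this]

end IntPrimrec

section Codes

variable {n m : ℕ} {α : Type*} [Primcodable α]

theorem primrec_vec_apply {f : α → Fin m → ℤ} (hf : Primrec f) {i : α → Fin m} (hi : Primrec i) :
    Primrec fun a => f a (i a) :=
  Primrec.fin_app.comp hf hi

theorem primrec_vec_lam {f : α → Fin m → ℤ} (hf : Primrec fun x : α × Fin m => f x.1 x.2) :
    Primrec f :=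
  Primrec.fin_curry.2 hf

@[fun_prop]
theorem primrec_vec_add {f g : α → Fin m → ℤ} (hf : Primrec f) (hg : Primrec g) :
    Primrec fun a => f a + g a :=
  primrec_vec_lam (primrec_int_add (primrec_vec_apply (hf.comp Primrec.fst) Primrec.snd)
    (primrec_vec_apply (hg.comp Primrec.fst) Primrec.snd))

@[fun_prop]
theorem primrec_vec_neg {f : α → Fin m → ℤ} (hf : Primrec f) : Primrec fun a => - f a :=
  primrec_vec_lam (primrec_int_neg (primrec_vec_apply (hf.comp Primrec.fst) Primrec.snd))

@[fun_prop]
theorem primrec_vec_smul {k : α → ℕ} {f : α → Fin m → ℤ} (hk : Primrec k) (hf : Primrec f) :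
    Primrec fun a => k a • f a :=
  (primrec_vec_lam (f := fun a i => (k a : ℤ) * f a i)
    (primrec_int_mul (primrec_int_cast (hk.comp Primrec.fst))
      (primrec_vec_apply (hf.comp Primrec.fst) Primrec.snd))).of_eq fun a => by
    ext i; simp

/-- The product of two codes. -/
def Code.mul (x y : Code n m) : Code n m := (x.1 ++ y.1, x.2 + y.2)

/-- The inverse of a code. -/
def Code.inv (x : Code n m) : Code n m := (FreeGroup.invRev x.1, -x.2)

/-- The code of the neutral element. -/
def Code.one : Code n m := ([], 0)

/-- The powers of a code. -/
def Code.pow (x : Code n m) (k : ℕ) : Code n m := Nat.rec Code.one (fun _ y => Code.mul y x) k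

/-- Multiplication of the vector part by `k`. -/
def Code.scale (k : ℕ) (x : Code n m) : Code n m := (x.1, k • x.2)

/-- The free part of a code, as a code. -/
def Code.free (x : Code n m) : Code n m := (x.1, 0)

@[simp]
theorem Code.elt_mul (x y : Code n m) : (x.mul y).elt = x.elt * y.elt := rfl

@[simp]
theorem Code.elt_inv (x : Code n m) : x.inv.elt = x.elt⁻¹ := by
  simp [Code.inv, Code.elt, FreeGroup.inv_mk]

@[simp]
theorem Code.elt_pow (x : Code n m) (k : ℕ) : (x.pow k).elt = x.elt ^ k := by
  induction k with
  | zero => rw [pow_zero]; rfl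
  | succ k ih => rw [pow_succ, ← ih]; rfl

@[fun_prop]
theorem primrec_code_mul {f g : α → Code n m} (hf : Primrec f) (hg : Primrec g) :
    Primrec fun a => (f a).mul (g a) := by
  unfold Code.mul
  fun_prop

@[fun_prop]
theorem primrec_invRev {f : α → List (Fin n × Bool)} (hf : Primrec f) :
    Primrec fun a => FreeGroup.invRev (f a) := by
  unfold FreeGroup.invRev
  have : Primrec not := Primrec.not
  fun_prop

@[fun_prop]
theorem primrec_code_inv {f : α → Code n m} (hf : Primrec f) : Primrec fun a => (f a).inv := by
  unfold Code.inv
  fun_prop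

@[fun_prop]
theorem primrec_code_pow {f : α → Code n m} {k : α → ℕ} (hf : Primrec f) (hk : Primrec k) :
    Primrec fun a => (f a).pow (k a) := by
  unfold Code.pow
  refine Primrec.nat_rec' (h := fun a y => y.2.mul (f a)) hk (Primrec.const Code.one) ?_
  exact primrec_code_mul (Primrec.snd.comp Primrec.snd) (hf.comp Primrec.fst)

@[fun_prop]
theorem primrec_code_scale {f : α → Code n m} {k : α → ℕ} (hf : Primrec f) (hk : Primrec k) :
    Primrec fun a => Code.scale (k a) (f a) := by
  unfold Code.scale
  fun_prop

@[fun_prop]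
theorem primrec_code_free {f : α → Code n m} (hf : Primrec f) : Primrec fun a => (f a).free := by
  unfold Code.free
  fun_prop

@[fun_prop]
theorem primrec_reduce {f : α → List (Fin n × Bool)} (hf : Primrec f) :
    Primrec fun a => FreeGroup.reduce (f a) := by
  have h : Primrec fun a => (f a).foldr (fun x l => (List.casesOn l [x] fun hd tl =>
      if x.1 = hd.1 ∧ x.2 = not hd.2 then tl else x :: hd :: tl : List (Fin n × Bool))) [] := by
    refine primrec_foldr (h := fun _ x l => (List.casesOn l [x] fun hd tl =>
      if x.1 = hd.1 ∧ x.2 = not hd.2 then tl else x :: hd :: tl)) hf (Primrec.const []) ?_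
    refine Primrec.list_casesOn (h := fun (z : α × (Fin n × Bool) × List (Fin n × Bool))
        (w : (Fin n × Bool) × List (Fin n × Bool)) =>
      if z.2.1.1 = w.1.1 ∧ z.2.1.2 = not w.1.2 then w.2 else z.2.1 :: w.1 :: w.2) (by fun_prop)
      (by fun_prop) ?_
    refine Primrec.ite (PrimrecPred.and (Primrec.eq.comp (by fun_prop) (by fun_prop))
      (Primrec.eq.comp (by fun_prop) (Primrec.not.comp (by fun_prop)))) (by fun_prop) (by fun_prop)
  refine h.of_eq fun a => ?_
  induction f a with
  | nil => rfl
  | cons x l ih => rw [List.foldr_cons, ih, FreeGroup.reduce.cons]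

/-- The word problem: two words agree in the free group iff their reduced forms coincide. -/
theorem primrec_word_eq {f g : α → List (Fin n × Bool)} (hf : Primrec f) (hg : Primrec g) :
    PrimrecPred fun a => FreeGroup.mk (f a) = FreeGroup.mk (g a) :=
  (Primrec.eq.comp (primrec_reduce hf) (primrec_reduce hg)).of_eq fun _ =>
    ⟨FreeGroup.reduce.exact, FreeGroup.reduce.sound⟩

theorem Code.elt_eq_iff {x y : Code n m} :
    x.elt = y.elt ↔ FreeGroup.mk x.1 = FreeGroup.mk y.1 ∧ x.2 = y.2 := by
  simp [Code.elt, Prod.ext_iff]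

theorem Code.elt_surjective : Function.Surjective (Code.elt : Code n m → FTA n m) := by
  rintro ⟨u, a⟩
  exact ⟨(u.toWord, Multiplicative.toAdd a), by simp [Code.elt, FreeGroup.mk_toWord]⟩

theorem primrec_elt_eq {f g : α → Code n m} (hf : Primrec f) (hg : Primrec g) :
    PrimrecPred fun a => (f a).elt = (g a).elt :=
  ((primrec_word_eq (Primrec.fst.comp hf) (Primrec.fst.comp hg)).and
    (Primrec.eq.comp (Primrec.snd.comp hf) (Primrec.snd.comp hg))).of_eq fun _ =>
    Code.elt_eq_iff.symm

end Codes

end FreeTimesAbelian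

namespace FreeTimesAbelian

/-! ### Membership is semidecidable -/

section Membership

variable {n m : ℕ} {α : Type*} [Primcodable α]

/-- The product of a list of codes. -/
def Code.listProd (c : List (Code n m)) : Code n m := c.foldr Code.mul Code.one

theorem Code.elt_listProd (c : List (Code n m)) : (Code.listProd c).elt = (c.map Code.elt).prod := by
  induction c with
  | nil => rfl
  | cons x c ih => rw [List.map_cons, List.prod_cons, ← ih]; rfl

theorem Code.elt_mem_subgroupOf {L : List (Code n m)} {x : Code n m} (hx : x ∈ L) :
    x.elt ∈ subgroupOf L :=
  Subgroup.subset_closure ⟨x, hx, rfl⟩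

theorem subgroupOf_le_iff {L : List (Code n m)} {K : Subgroup (FTA n m)} :
    subgroupOf L ≤ K ↔ ∀ x ∈ L, x.elt ∈ K := by
  rw [subgroupOf, Subgroup.closure_le]
  constructor
  · exact fun h x hx => h ⟨x, hx, rfl⟩
  · rintro h _ ⟨x, hx, rfl⟩
    exact h x hx

theorem elt_mem_subgroupOf_iff {L : List (Code n m)} {x : Code n m} :
    x.elt ∈ subgroupOf L ↔ ∃ c : List (Code n m),
      (∀ z ∈ c, ∃ y ∈ L, z.elt = y.elt ∨ z.elt = y.inv.elt) ∧ (Code.listProd c).elt = x.elt := by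
  constructor
  · intro h
    rw [subgroupOf, ← Subgroup.mem_toSubmonoid, Subgroup.closure_toSubmonoid] at h
    obtain ⟨l, hl, hx⟩ := Submonoid.exists_list_of_mem_closure h
    obtain ⟨c, rfl⟩ : ∃ c : List (Code n m), c.map Code.elt = l := by
      obtain ⟨c, hc⟩ := (List.map_surjective_iff.2 Code.elt_surjective) l
      exact ⟨c, hc⟩
    refine ⟨c, fun z hz => ?_, by rw [Code.elt_listProd, hx]⟩
    rcases hl z.elt (List.mem_map_of_mem hz) with ⟨y, hy, h⟩ | ⟨y, hy, h⟩
    · exact ⟨y, hy, Or.inl h.symm⟩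
    · exact ⟨y, hy, Or.inr (by rw [Code.elt_inv, h, inv_inv])⟩
  · rintro ⟨c, hc, hx⟩
    rw [← hx, Code.elt_listProd]
    refine Subgroup.list_prod_mem _ fun g hg => ?_
    obtain ⟨z, hz, rfl⟩ := List.mem_map.1 hg
    obtain ⟨y, hy, h | h⟩ := hc z hz
    · exact h ▸ Code.elt_mem_subgroupOf hy
    · rw [h, Code.elt_inv]
      exact Subgroup.inv_mem _ (Code.elt_mem_subgroupOf hy)

theorem semiDec_mem {f : α → List (Code n m)} {g : α → Code n m} (hf : Primrec f)
    (hg : Primrec g) : SemiDec fun a => (g a).elt ∈ subgroupOf (f a) := by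
  refine SemiDec.of_iff ?_ fun a => elt_mem_subgroupOf_iff
  refine SemiDec.ex ?_
  refine SemiDec.and ?_ (SemiDec.of_primrec (primrec_elt_eq ?_ (by fun_prop)))
  · refine SemiDec.all ?_ (by fun_prop)
    refine SemiDec.exMem ?_ (by fun_prop)
    exact SemiDec.or (SemiDec.of_primrec (primrec_elt_eq (by fun_prop) (by fun_prop)))
      (SemiDec.of_primrec (primrec_elt_eq (by fun_prop) (by fun_prop)))
  · unfold Code.listProd
    exact primrec_foldr (h := fun _ x y => Code.mul x y) (by fun_prop) (by fun_prop) (by fun_prop)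

end Membership

/-! ### Characters separating a vector from a subgroup of `ℤ^m` -/

section Vectors

variable {m : ℕ} {α : Type*} [Primcodable α]

/-- The standard bilinear pairing on `ℤ^m`. -/
def pairing (χ v : Fin m → ℤ) : ℤ := ∑ i, χ i * v i

@[fun_prop]
theorem primrec_pairing {f g : α → Fin m → ℤ} (hf : Primrec f) (hg : Primrec g) :
    Primrec fun a => pairing (f a) (g a) := by
  have h : Primrec fun a => (List.finRange m).foldr (fun i s => f a i * g a i + s) 0 := by
    refine primrec_foldr (h := fun a i s => f a i * g a i + s) (Primrec.const _) (Primrec.const 0) ?_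
    refine primrec_int_add (primrec_int_mul (primrec_vec_apply (by fun_prop) (by fun_prop))
      (primrec_vec_apply (by fun_prop) (by fun_prop))) (by fun_prop)
  refine h.of_eq fun a => ?_
  rw [pairing, Fin.sum_univ_def, List.sum_eq_foldr, List.foldr_map]

theorem exists_pairing_of_addMonoidHom {q : ℕ} (ψ : (Fin m → ℤ) →+ ZMod q) :
    ∃ χ : Fin m → ℤ, ∀ v, ψ v = (pairing χ v : ℤ) := by
  choose χ hχ using fun i => ZMod.intCast_surjective (ψ (Pi.single i 1))
  refine ⟨χ, fun v => ?_⟩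
  have hv : v = ∑ i, v i • (Pi.single i 1 : Fin m → ℤ) := by
    ext j
    simp [Finset.sum_apply, Pi.single_apply]
  conv_lhs => rw [hv]
  rw [map_sum, pairing, Int.cast_sum]
  refine Finset.sum_congr rfl fun i _ => ?_
  rw [map_zsmul, Int.cast_mul, hχ, zsmul_eq_mul, mul_comm]

/-- By the structure theorem, a non-zero element has a non-zero coordinate in some cyclic factor.
Infinite factors correspond to `q = 0`, as `ZMod 0` is `ℤ`. -/
theorem exists_addMonoidHom_zmod_ne_zero {A : Type*} [AddCommGroup A] [AddGroup.FG A] {a : A}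
    (ha : a ≠ 0) : ∃ (q : ℕ) (ψ : A →+ ZMod q), ψ a ≠ 0 := by
  classical
  obtain ⟨r, ι, _, p, _, e, ⟨E⟩⟩ := AddCommGroup.equiv_free_prod_directSum_zmod A
  have hE : E a ≠ 0 := by simpa using ha
  by_cases h1 : (E a).1 = 0
  · have h2 : (E a).2 ≠ 0 := fun h2 => hE (Prod.ext h1 h2)
    obtain ⟨i, hi⟩ : ∃ i, (E a).2 i ≠ 0 := by
      by_contra! h
      exact h2 (DFinsupp.ext h)
    exact ⟨_, ((DFinsupp.evalAddMonoidHom i).comp (AddMonoidHom.snd _ _)).comp E.toAddMonoidHom, hi⟩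
  · obtain ⟨i, hi⟩ : ∃ i, (E a).1 i ≠ 0 := by
      by_contra! h
      exact h1 (Finsupp.ext h)
    exact ⟨0, ((Finsupp.applyAddHom i).comp (AddMonoidHom.fst _ _)).comp E.toAddMonoidHom, hi⟩

/-- Turns non-membership into an existential statement: a character of the quotient that does not
kill `b` lifts to a pairing modulo `q`, and the divisibilities can be tested on generators. -/
theorem notMem_addSubgroup_iff {S : AddSubgroup (Fin m → ℤ)} {b : Fin m → ℤ} :
    b ∉ S ↔ ∃ (χ : Fin m → ℤ) (q : ℕ), (∀ s ∈ S, (q : ℤ) ∣ pairing χ s) ∧ ¬ (q : ℤ) ∣ pairing χ b := by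
  constructor
  · intro hb
    have : AddGroup.FG ((Fin m → ℤ) ⧸ S) :=
      AddGroup.fg_of_surjective (f := QuotientAddGroup.mk' S) (QuotientAddGroup.mk'_surjective S)
    obtain ⟨q, ψ, hψ⟩ := exists_addMonoidHom_zmod_ne_zero
      (a := (b : (Fin m → ℤ) ⧸ S)) (by simpa [QuotientAddGroup.eq_zero_iff] using hb)
    obtain ⟨χ, hχ⟩ := exists_pairing_of_addMonoidHom (ψ.comp (QuotientAddGroup.mk' S))
    refine ⟨χ, q, fun s hs => ?_, fun h => hψ ?_⟩
    · rw [← ZMod.intCast_zmod_eq_zero_iff_dvd, ← hχ]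
      simp [(QuotientAddGroup.eq_zero_iff s).2 hs]
    · rw [← ZMod.intCast_zmod_eq_zero_iff_dvd, ← hχ] at h
      exact h
  · rintro ⟨χ, q, h1, h2⟩ hb
    exact h2 (h1 b hb)

end Vectors

end FreeTimesAbelian

namespace FreeTimesAbelian

/-! ### Weighted permutation automata as membership certificates -/

section Automata

variable {n m : ℕ} {α : Type*} [Primcodable α]

/-- Words, used as states of automata. -/
abbrev Wd (n : ℕ) : Type := List (Fin n × Bool)

/-- An elementary weighted transposition `(p, q, c)` of the states: it swaps `p` and `q` and
multiplies the weight by `c` at `p`. -/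
abbrev Op (n m : ℕ) : Type := Wd n × Wd n × Code n m

/-- A weighted permutation automaton: each letter acts by a product of elementary operations. -/
abbrev Aut (n m : ℕ) : Type := Fin n → List (Op n m)

/-- The permutation of `S × G` defined by an elementary weighted transposition. -/
def opPerm {S G : Type*} [DecidableEq S] [Group G] (p q : S) (c : G) : Equiv.Perm (S × G) where
  toFun x := (Equiv.swap p q x.1, if x.1 = p then c * x.2 else x.2)
  invFun x := (Equiv.swap p q x.1, if Equiv.swap p q x.1 = p then c⁻¹ * x.2 else x.2)
  left_inv x := by
    ext
    · simp
    · by_cases h : x.1 = p <;> simp [h]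
  right_inv x := by
    ext
    · simp
    · by_cases h : Equiv.swap p q x.1 = p
      · simp only [h, ↓reduceIte, mul_inv_cancel_left]
      · simp only [h, ↓reduceIte]

/-- The permutation defined by a list of operations. -/
def opsPerm (B : List (Op n m)) : Equiv.Perm (Wd n × FTA n m) :=
  (B.map fun o => opPerm o.1 o.2.1 o.2.2.elt).prod

/-- The action of the free group defined by an automaton. -/
def Aut.action (A : Aut n m) : FreeGroup (Fin n) →* Equiv.Perm (Wd n × FTA n m) :=
  FreeGroup.lift fun i => opsPerm (A i)

/-- The action of an operation on coded configurations. -/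
def opStep (o : Op n m) (x : Wd n × Code n m) : Wd n × Code n m :=
  (if x.1 = o.1 then o.2.1 else if x.1 = o.2.1 then o.1 else x.1,
    if x.1 = o.1 then o.2.2.mul x.2 else x.2)

/-- The inverse action of an operation on coded configurations. -/
def opBack (o : Op n m) (x : Wd n × Code n m) : Wd n × Code n m :=
  (if x.1 = o.1 then o.2.1 else if x.1 = o.2.1 then o.1 else x.1,
    -- The forward step multiplies by the weight on leaving `o.1`, so the inverse step tests whether
    -- the state it returns to is `o.1`.
    if (if x.1 = o.1 then o.2.1 else if x.1 = o.2.1 then o.1 else x.1) = o.1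
      then o.2.2.inv.mul x.2 else x.2)

/-- The action of a letter on coded configurations. -/
def Aut.step (A : Aut n m) (l : Fin n × Bool) (x : Wd n × Code n m) : Wd n × Code n m :=
  bif l.2 then (A l.1).foldr opStep x else (A l.1).foldl (fun y o => opBack o y) x

/-- The configuration reached from the initial one by reading a word from right to left. -/
def Aut.run (A : Aut n m) (w : Wd n) : Wd n × Code n m := w.foldr A.step ([], Code.one)

theorem map_elt_opStep (o : Op n m) (x : Wd n × Code n m) :
    Prod.map id Code.elt (opStep o x) =
      opPerm o.1 o.2.1 o.2.2.elt (Prod.map id Code.elt x) := by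
  simp only [opStep, opPerm, Equiv.coe_fn_mk, Prod.map, id, Equiv.swap_apply_def]
  split_ifs <;> simp

theorem map_elt_opBack (o : Op n m) (x : Wd n × Code n m) :
    Prod.map id Code.elt (opBack o x) =
      (opPerm o.1 o.2.1 o.2.2.elt)⁻¹ (Prod.map id Code.elt x) := by
  change _ = (opPerm o.1 o.2.1 o.2.2.elt).symm _
  simp only [opBack, opPerm, Equiv.coe_fn_symm_mk, Prod.map, id, Equiv.swap_apply_def]
  split_ifs <;> simp

theorem map_elt_step (A : Aut n m) (l : Fin n × Bool) (x : Wd n × Code n m) :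
    Prod.map id Code.elt (A.step l x) =
      A.action (FreeGroup.mk [l]) (Prod.map id Code.elt x) := by
  obtain ⟨i, b⟩ := l
  cases b with
  | true =>
    have h : A.action (FreeGroup.mk [(i, true)]) = opsPerm (A i) := FreeGroup.lift_apply_of ..
    rw [h, Aut.step, cond_true, opsPerm]
    dsimp only
    induction A i with
    | nil => rfl
    | cons o B ih =>
      rw [List.foldr_cons, map_elt_opStep, ih, List.map_cons, List.prod_cons, Equiv.Perm.mul_apply]
  | false =>
    have h : A.action (FreeGroup.mk [(i, false)]) = (opsPerm (A i))⁻¹ := by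
      have h1 : FreeGroup.mk [(i, false)] = (FreeGroup.of i)⁻¹ := rfl
      rw [h1, map_inv]
      congr 1
    rw [h, Aut.step, cond_false, opsPerm]
    dsimp only
    generalize A i = B
    induction B generalizing x with
    | nil => rfl
    | cons o B ih =>
      rw [List.foldl_cons, ih, map_elt_opBack, List.map_cons, List.prod_cons, mul_inv_rev,
        Equiv.Perm.mul_apply]

theorem map_elt_run (A : Aut n m) (w : Wd n) :
    Prod.map id Code.elt (A.run w) = A.action (FreeGroup.mk w) ([], 1) := by
  induction w with
  | nil => rfl
  | cons l w ih =>
    have h : FreeGroup.mk (l :: w) = FreeGroup.mk [l] * FreeGroup.mk w := rfl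
    rw [h, map_mul, Equiv.Perm.mul_apply, ← ih, ← map_elt_step]
    rfl

@[fun_prop]
theorem primrec_step {A : α → Aut n m} {l : α → Fin n × Bool} {x : α → Wd n × Code n m}
    (hA : Primrec A) (hl : Primrec l) (hx : Primrec x) : Primrec fun a => (A a).step (l a) (x a) := by
  unfold Aut.step
  have hAl : Primrec fun a => A a (l a).1 := Primrec.fin_app.comp hA (by fun_prop)
  refine Primrec.cond (by fun_prop) ?_ ?_
  · refine primrec_foldr (h := fun _ => opStep) hAl hx ?_
    unfold opStep
    refine Primrec.pair (Primrec.ite (Primrec.eq.comp (by fun_prop) (by fun_prop)) (by fun_prop)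
      (Primrec.ite (Primrec.eq.comp (by fun_prop) (by fun_prop)) (by fun_prop) (by fun_prop)))
      (Primrec.ite (Primrec.eq.comp (by fun_prop) (by fun_prop)) (by fun_prop) (by fun_prop))
  · refine Primrec.list_foldl (h := fun _ z => opBack z.2 z.1) hAl hx ?_
    unfold opBack
    have h : Primrec fun z : α × (Wd n × Code n m) × Op n m =>
        if z.2.1.1 = z.2.2.1 then z.2.2.2.1 else if z.2.1.1 = z.2.2.2.1 then z.2.2.1 else z.2.1.1 :=
      Primrec.ite (Primrec.eq.comp (by fun_prop) (by fun_prop)) (by fun_prop)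
        (Primrec.ite (Primrec.eq.comp (by fun_prop) (by fun_prop)) (by fun_prop) (by fun_prop))
    exact Primrec.pair h (Primrec.ite (Primrec.eq.comp h (by fun_prop)) (by fun_prop) (by fun_prop))

@[fun_prop]
theorem primrec_run {A : α → Aut n m} {w : α → Wd n} (hA : Primrec A) (hw : Primrec w) :
    Primrec fun a => (A a).run (w a) := by
  unfold Aut.run
  exact primrec_foldr (h := fun a => (A a).step) hw (by fun_prop) (by fun_prop)

theorem opsPerm_commute (B : List (Op n m)) (g' : FTA n m) :
    Commute (opsPerm B) (Equiv.prodCongr (Equiv.refl _) (Equiv.mulRight g')) := by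
  refine Commute.list_prod_left _ _ fun f hf => ?_
  obtain ⟨o, -, rfl⟩ := List.mem_map.1 hf
  refine Equiv.ext fun x => Prod.ext rfl ?_
  simp only [opPerm, Equiv.Perm.mul_apply, Equiv.coe_fn_mk, Equiv.prodCongr_apply, Prod.map,
    Equiv.refl_apply, Equiv.coe_mulRight]
  split_ifs
  · rw [mul_assoc]
  · rfl

theorem opsPerm_mul_right (B : List (Op n m)) (s : Wd n) (g g' : FTA n m) :
    opsPerm B (s, g * g') = ((opsPerm B (s, g)).1, (opsPerm B (s, g)).2 * g') :=
  congrArg (fun f : Equiv.Perm (Wd n × FTA n m) => f (s, g)) (opsPerm_commute B g').eq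

/-- Weights multiply on the left, so the action commutes with right translations of the weight
coordinate. A run from weight `1` therefore determines the run from any weight, and weights of loops
at a state compose multiplicatively. -/
theorem action_mul_right (A : Aut n m) (u : FreeGroup (Fin n)) (s : Wd n) (g g' : FTA n m) :
    A.action u (s, g * g') = ((A.action u (s, g)).1, (A.action u (s, g)).2 * g') := by
  have h : Commute (A.action u) (Equiv.prodCongr (Equiv.refl _) (Equiv.mulRight g')) := by
    induction u using FreeGroup.induction_on with
    | C1 => rw [map_one]; exact Commute.one_left _
    | of i => exact (FreeGroup.lift_apply_of (f := fun i => opsPerm (A i)) ▸ opsPerm_commute (A i) g')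
    | inv_of i ih => rw [map_inv]; exact ih.inv_left
    | mul u v hu hv => rw [map_mul]; exact hu.mul_left hv
  exact congrArg (fun f : Equiv.Perm (Wd n × FTA n m) => f (s, g)) h.eq

theorem opsPerm_snd_mem {H : Subgroup (FTA n m)} {B : List (Op n m)}
    (hB : ∀ o ∈ B, o.2.2.elt ∈ H) (x : Wd n × FTA n m) : (opsPerm B x).2 ∈ H ↔ x.2 ∈ H := by
  have hop : ∀ (p q : Wd n) (c : FTA n m), c ∈ H → ∀ x, (opPerm p q c x).2 ∈ H ↔ x.2 ∈ H := by
    intro p q c hc x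
    simp only [opPerm, Equiv.coe_fn_mk]
    split_ifs
    · exact Subgroup.mul_mem_cancel_left _ hc
    · exact Iff.rfl
  induction B with
  | nil => exact Iff.rfl
  | cons o B ih =>
    rw [opsPerm, List.map_cons, List.prod_cons, Equiv.Perm.mul_apply,
      hop _ _ _ (hB o List.mem_cons_self)]
    exact ih fun o ho => hB o (List.mem_cons_of_mem _ ho)

theorem action_snd_mem {A : Aut n m} {H : Subgroup (FTA n m)}
    (hA : ∀ i, ∀ o ∈ A i, o.2.2.elt ∈ H) (u : FreeGroup (Fin n)) (x : Wd n × FTA n m) :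
    (A.action u x).2 ∈ H ↔ x.2 ∈ H := by
  induction u using FreeGroup.induction_on generalizing x with
  | C1 => simp
  | of i =>
    have : A.action (FreeGroup.of i) = opsPerm (A i) := FreeGroup.lift_apply_of ..
    rw [this]
    exact opsPerm_snd_mem (hA i) x
  | inv_of i ih =>
    have := ih ((A.action (FreeGroup.of i))⁻¹ x)
    rw [show A.action (FreeGroup.of i) ((A.action (FreeGroup.of i))⁻¹ x) = x from
      (A.action (FreeGroup.of i)).apply_symm_apply x] at this
    rw [map_inv]
    exact this.symm
  | mul u v hu hv =>
    rw [map_mul, Equiv.Perm.mul_apply]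
    exact (hu _).trans (hv _)

/-- `A` certifies the membership problem for the subgroup generated by `L`. -/
def Aut.IsCert (A : Aut n m) (L : List (Code n m)) : Prop :=
  (∀ i ∈ List.finRange n, ∀ o ∈ A i, o.2.2.elt ∈ subgroupOf L) ∧
    ∀ y ∈ L, (A.run y.1).1 = [] ∧ FreeGroup.mk (A.run y.1).2.1 = FreeGroup.mk y.1

/-- The generators of the intersection with `ℤ^m` given by a certificate. -/
def Aut.kerList (A : Aut n m) (L : List (Code n m)) : List (Code n m) :=
  L.map fun y => ([], y.2 + -(A.run y.1).2.2)

theorem semiDec_isCert {A : α → Aut n m} {L : α → List (Code n m)} (hA : Primrec A)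
    (hL : Primrec L) : SemiDec fun a => (A a).IsCert (L a) := by
  unfold Aut.IsCert
  refine SemiDec.and ?_ ?_
  · refine SemiDec.all ?_ (by fun_prop)
    refine SemiDec.all ?_ (Primrec.fin_app.comp (by fun_prop) (by fun_prop))
    exact semiDec_mem (by fun_prop) (by fun_prop)
  · refine SemiDec.all ?_ (by fun_prop)
    exact SemiDec.and (SemiDec.of_primrec (Primrec.eq.comp (by fun_prop) (by fun_prop)))
      (SemiDec.of_primrec (primrec_word_eq (by fun_prop) (by fun_prop)))

@[fun_prop]
theorem primrec_kerList {A : α → Aut n m} {L : α → List (Code n m)} (hA : Primrec A)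
    (hL : Primrec L) : Primrec fun a => (A a).kerList (L a) := by
  unfold Aut.kerList
  fun_prop

theorem fst_eq_one_of_mem_kerList {A : Aut n m} {L : List (Code n m)} {g : FTA n m}
    (hg : g ∈ subgroupOf (A.kerList L)) : g.1 = 1 := by
  have : subgroupOf (A.kerList L) ≤ (MonoidHom.fst _ _).ker := by
    rw [subgroupOf_le_iff]
    intro x hx
    obtain ⟨y, -, rfl⟩ := List.mem_map.1 hx
    rfl
  exact this hg

theorem commute_of_fst_eq_one {g : FTA n m} (hg : g.1 = 1) (h : FTA n m) : g * h = h * g := by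
  ext1
  · simp [hg]
  · exact mul_comm _ _

/-- Let `ρ(g)` be the weight reached from `([], 1)` by reading the free part of `g`. On loops at
`[]` it is multiplicative, and `g ρ(g)⁻¹` is central once the free parts agree; so the three
conditions define a subgroup, and it contains the generators by the definition of `kerList`.
Conversely all weights lie in `⟨L⟩`, hence so do `ρ(g)` and the vectors of `kerList`. -/
theorem Aut.IsCert.mem_iff {A : Aut n m} {L : List (Code n m)} (hA : A.IsCert L) {g : FTA n m} :
    g ∈ subgroupOf L ↔ (A.action g.1 ([], 1)).1 = [] ∧ (A.action g.1 ([], 1)).2.1 = g.1 ∧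
      g * (A.action g.1 ([], 1)).2⁻¹ ∈ subgroupOf (A.kerList L) := by
  have hw : ∀ u x, (A.action u x).2 ∈ subgroupOf L ↔ x.2 ∈ subgroupOf L :=
    action_snd_mem fun i => hA.1 i (List.mem_finRange i)
  have hgen : ∀ y ∈ L, (A.action y.elt.1 ([], 1)).1 = [] ∧
      (A.action y.elt.1 ([], 1)).2.1 = y.elt.1 ∧
      y.elt * (A.action y.elt.1 ([], 1)).2⁻¹ = Code.elt ([], y.2 + -(A.run y.1).2.2) := by
    intro y hy
    have h1 : A.action y.elt.1 ([], 1) = _ := (map_elt_run A y.1).symm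
    rw [h1]
    refine ⟨(hA.2 y hy).1, (hA.2 y hy).2, ?_⟩
    ext1
    · have := (hA.2 y hy).2
      simp only [Code.elt, Prod.map, Prod.fst_mul, Prod.fst_inv, this, mul_inv_cancel]
      rfl
    · rfl
  constructor
  · intro hg
    refine Subgroup.closure_induction (p := fun g _ => (A.action g.1 ([], 1)).1 = [] ∧
      (A.action g.1 ([], 1)).2.1 = g.1 ∧
      g * (A.action g.1 ([], 1)).2⁻¹ ∈ subgroupOf (A.kerList L)) ?_ ?_ ?_ ?_ hg
    · rintro _ ⟨y, hy, rfl⟩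
      obtain ⟨h1, h2, h3⟩ := hgen y hy
      refine ⟨h1, h2, ?_⟩
      rw [h3]
      exact Code.elt_mem_subgroupOf (List.mem_map.2 ⟨y, hy, rfl⟩)
    · simp
    · rintro x y - - ⟨hx1, hx2, hx3⟩ ⟨hy1, hy2, hy3⟩
      have h : A.action (x * y).1 ([], 1) =
          ([], (A.action x.1 ([], 1)).2 * (A.action y.1 ([], 1)).2) := by
        rw [Prod.fst_mul, map_mul, Equiv.Perm.mul_apply]
        have h1 : A.action y.1 ([], 1) = ([], 1 * (A.action y.1 ([], 1)).2) := by
          rw [one_mul]; exact Prod.ext hy1 rfl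
        rw [h1, action_mul_right, hx1]
        simp
      rw [h]
      refine ⟨rfl, by simp [hx2, hy2], ?_⟩
      have hc := commute_of_fst_eq_one (fst_eq_one_of_mem_kerList hy3)
      have : x * y * ((A.action x.1 ([], 1)).2 * (A.action y.1 ([], 1)).2)⁻¹ =
          (x * (A.action x.1 ([], 1)).2⁻¹) * (y * (A.action y.1 ([], 1)).2⁻¹) := by
        rw [mul_assoc x (A.action x.1 ([], 1)).2⁻¹, ← hc]
        group
      rw [this]
      exact Subgroup.mul_mem _ hx3 hy3
    · rintro x - ⟨hx1, hx2, hx3⟩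
      have h : A.action (x⁻¹).1 ([], 1) = ([], (A.action x.1 ([], 1)).2⁻¹) := by
        rw [Prod.fst_inv, map_inv, Equiv.Perm.inv_eq_iff_eq]
        have := action_mul_right A x.1 [] 1 (A.action x.1 ([], 1)).2⁻¹
        rw [one_mul] at this
        rw [this, hx1, mul_inv_cancel]
      rw [h]
      refine ⟨rfl, by simp [hx2], ?_⟩
      have hc := commute_of_fst_eq_one (fst_eq_one_of_mem_kerList hx3)
        ((A.action x.1 ([], 1)).2⁻¹)⁻¹
      have : x⁻¹ * ((A.action x.1 ([], 1)).2⁻¹)⁻¹ = (x * (A.action x.1 ([], 1)).2⁻¹)⁻¹ := by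
        rw [eq_inv_iff_mul_eq_one, mul_assoc, ← hc]
        group
      rw [this]
      exact Subgroup.inv_mem _ hx3
  · rintro ⟨-, -, h3⟩
    have hρ : ∀ u, (A.action u ([], 1)).2 ∈ subgroupOf L := fun u =>
      (hw u _).2 (Subgroup.one_mem _)
    have hk : subgroupOf (A.kerList L) ≤ subgroupOf L := by
      rw [subgroupOf_le_iff]
      intro x hx
      obtain ⟨y, hy, rfl⟩ := List.mem_map.1 hx
      rw [← (hgen y hy).2.2]
      exact Subgroup.mul_mem _ (Code.elt_mem_subgroupOf hy) (Subgroup.inv_mem _ (hρ _))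
    have := Subgroup.mul_mem _ (hk h3) (hρ g.1)
    rwa [inv_mul_cancel_right] at this

/-- A trivial free part acts as the identity, so the criterion collapses: `kerList` generates `⟨L⟩ ∩
ℤ^m`. -/
theorem Aut.IsCert.mem_kerList_iff {A : Aut n m} {L : List (Code n m)} (hA : A.IsCert L)
    {g : FTA n m} : g ∈ subgroupOf (A.kerList L) ↔ g ∈ subgroupOf L ∧ g.1 = 1 := by
  rw [hA.mem_iff]
  constructor
  · intro hg
    have h1 := fst_eq_one_of_mem_kerList hg
    rw [h1]
    simpa using hg
  · rintro ⟨⟨-, -, h⟩, h1⟩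
    rw [h1] at h
    simpa using h

end Automata

end FreeTimesAbelian

namespace FreeTimesAbelian

/-! ### Existence of certificates; non-membership is semidecidable -/

section Automata

variable {n m : ℕ} {α : Type*} [Primcodable α]

/-- Finite weighted partial injections of the states extend to products of elementary
operations. -/
theorem exists_ops {ι : Type*} [DecidableEq ι] {H : Subgroup (FTA n m)} (T : Finset ι)
    {f h : ι → Wd n} (hf : Set.InjOn f T) (hh : Set.InjOn h T) {c : ι → FTA n m}
    (hc : ∀ t ∈ T, c t ∈ H) :
    ∃ B : List (Op n m), (∀ o ∈ B, o.2.2.elt ∈ H) ∧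
      ∀ t ∈ T, ∀ g, opsPerm B (f t, g) = (h t, c t * g) := by
  induction T using Finset.induction_on with
  | empty => exact ⟨[], by simp, by simp⟩
  | insert a T ha ih =>
    obtain ⟨B, hB, hBT⟩ := ih (hf.mono (by simp)) (hh.mono (by simp))
      fun t ht => hc t (Finset.mem_insert_of_mem ht)
    -- The operations built for `T` send `f a` to some state `r` with weight `d`. One more
    -- transposition, of `r` and `h a` with weight `c a * d⁻¹`, repairs this and leaves alone the
    -- states `h t`, which differ from `r` and from `h a` by injectivity.
    obtain ⟨r, d, hrd⟩ : ∃ r d, opsPerm B (f a, 1) = (r, d) := ⟨_, _, rfl⟩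
    have hd : d ∈ H := by
      have := (opsPerm_snd_mem hB (f a, 1)).2 (Subgroup.one_mem _)
      rwa [hrd] at this
    have hr : ∀ t ∈ T, h t ≠ r := by
      intro t ht hrt
      have h1 := hBT t ht ((c t)⁻¹ * d)
      rw [mul_inv_cancel_left, hrt, ← hrd] at h1
      have h2 : f t = f a := congrArg Prod.fst ((opsPerm B).injective h1)
      have h3 := hf (Finset.mem_coe.2 (Finset.mem_insert_of_mem ht)) (by simp) h2
      exact ha (h3 ▸ ht)
    obtain ⟨e, he⟩ := Code.elt_surjective (c a * d⁻¹)
    have hcons : ∀ x, opsPerm ((r, h a, e) :: B) x = opPerm r (h a) (c a * d⁻¹) (opsPerm B x) := by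
      intro x
      rw [opsPerm, List.map_cons, List.prod_cons, Equiv.Perm.mul_apply, he]
      rfl
    refine ⟨(r, h a, e) :: B, ?_, ?_⟩
    · intro o ho
      rcases List.mem_cons.1 ho with rfl | ho
      · rw [he]
        exact H.mul_mem (hc a (Finset.mem_insert_self _ _)) (H.inv_mem hd)
      · exact hB o ho
    · intro t ht g
      rw [hcons]
      rcases Finset.mem_insert.1 ht with rfl | ht'
      · have := opsPerm_mul_right B (f t) 1 g
        rw [one_mul, hrd] at this
        rw [this]
        simp [opPerm, mul_assoc]
      · have hne : h t ≠ h a := fun h' =>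
          ha (hh (Finset.mem_coe.2 ht) (by simp) h' ▸ ht')
        rw [hBT t ht']
        simp [opPerm, hr t ht', Equiv.swap_apply_of_ne_of_ne (hr t ht') hne]

/-- The automaton is a finite part of the action on the cosets of the group `H0` of free parts.
States are words for a transversal `r`, and the letter `x` at a coset `ω` carries a lift to `⟨L⟩` of
the Schreier element `r(xω)⁻¹ x r(ω)`. Along a suffix `s` of a generator the free parts of the
weights telescope to `r(s)⁻¹ s`, which is the generator itself when the loop closes. Only finitely
many cosets are visited, so `exists_ops` realizes each letter by finitely many operations. -/
theorem exists_isCert (L : List (Code n m)) : ∃ A : Aut n m, A.IsCert L := by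
  classical
  let H0 : Subgroup (FreeGroup (Fin n)) := (subgroupOf L).map (MonoidHom.fst _ _)
  -- The trivial coset must be represented by `1`, so that its state is the initial state `[]`.
  let r : FreeGroup (Fin n) ⧸ H0 → FreeGroup (Fin n) := Function.update Quotient.out ↑(1 : FreeGroup (Fin n)) 1
  have hr1 : r ↑(1 : FreeGroup (Fin n)) = 1 := Function.update_self ..
  have hr : ∀ ω, (r ω : FreeGroup (Fin n) ⧸ H0) = ω := by
    intro ω
    by_cases h : ω = ↑(1 : FreeGroup (Fin n))
    · rw [h, hr1]
    · simp only [r]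
      rw [Function.update_of_ne h]
      exact Quotient.out_eq ω
  let σ : FreeGroup (Fin n) ⧸ H0 → Wd n := fun ω => (r ω).toWord
  have hσ : Function.Injective σ := by
    intro ω ω' h
    rw [← hr ω, ← hr ω', FreeGroup.toWord_injective h]
  let V : Finset (FreeGroup (Fin n) ⧸ H0) :=
    (L.flatMap fun y => y.1.tails.map fun s => (↑(FreeGroup.mk s) : FreeGroup (Fin n) ⧸ H0)).toFinset
  have hlift : ∀ (i : Fin n) (ω : FreeGroup (Fin n) ⧸ H0), ∃ c : FTA n m, c ∈ subgroupOf L ∧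
      c.1 = (r (FreeGroup.of i • ω))⁻¹ * FreeGroup.of i * r ω := by
    intro i ω
    have : (r (FreeGroup.of i • ω))⁻¹ * (FreeGroup.of i * r ω) ∈ H0 := by
      rw [← QuotientGroup.eq, hr]
      conv_lhs => rw [← hr ω]
      rfl
    obtain ⟨c, hc, h⟩ := this
    exact ⟨c, hc, by rw [mul_assoc]; exact h⟩
  choose c hcH hc using hlift
  have hops : ∀ i : Fin n, ∃ B : List (Op n m), (∀ o ∈ B, o.2.2.elt ∈ subgroupOf L) ∧
      ∀ ω ∈ V, ∀ g, opsPerm B (σ ω, g) = (σ (FreeGroup.of i • ω), c i ω * g) := fun i =>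
    exists_ops V hσ.injOn (h := fun ω => σ (FreeGroup.of i • ω))
      (hσ.comp (MulAction.injective (FreeGroup.of i))).injOn fun ω _ => hcH i ω
  choose A hA hAV using hops
  refine ⟨A, fun i _ => hA i, fun y hy => ?_⟩
  have hof : ∀ i, Aut.action A (FreeGroup.of i) = opsPerm (A i) := fun i =>
    FreeGroup.lift_apply_of ..
  have key : ∀ s : Wd n, s <:+ y.1 → ∃ g : FTA n m,
      Aut.action A (FreeGroup.mk s) ([], 1) = (σ ↑(FreeGroup.mk s), g) ∧
        g.1 = (r ↑(FreeGroup.mk s))⁻¹ * FreeGroup.mk s := by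
    intro s
    induction s with
    | nil =>
      intro _
      refine ⟨1, ?_, ?_⟩
      · rw [← FreeGroup.one_eq_mk, map_one]
        simp [σ, hr1]
      · rw [← FreeGroup.one_eq_mk, hr1]
        simp
    | cons l s ih =>
      intro hs
      obtain ⟨g, hg, hg1⟩ := ih ((List.suffix_cons l s).trans hs)
      have hV : ∀ s : Wd n, s <:+ y.1 → (↑(FreeGroup.mk s) : FreeGroup (Fin n) ⧸ H0) ∈ V := by
        intro s hs
        simp only [V, List.mem_toFinset, List.mem_flatMap, List.mem_map, List.mem_tails]
        exact ⟨y, hy, s, hs, rfl⟩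
      have hmul : FreeGroup.mk (l :: s) = FreeGroup.mk [l] * FreeGroup.mk s := rfl
      rw [hmul, map_mul, Equiv.Perm.mul_apply, hg]
      obtain ⟨i, b⟩ := l
      cases b with
      | true =>
        have hi : FreeGroup.mk [(i, true)] = FreeGroup.of i := rfl
        rw [hi, hof, hAV i _ (hV s ((List.suffix_cons _ s).trans hs))]
        refine ⟨_, rfl, ?_⟩
        rw [Prod.fst_mul, hc, hg1]
        have : (↑(FreeGroup.of i * FreeGroup.mk s) : FreeGroup (Fin n) ⧸ H0) =
          FreeGroup.of i • ↑(FreeGroup.mk s) := rfl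
        rw [this]
        group
      | false =>
        have hi : FreeGroup.mk [(i, false)] = (FreeGroup.of i)⁻¹ := rfl
        -- An inverse letter is read backwards: the forward rule is applied at the target coset,
        -- which also lies in `V`, and then inverted.
        have h1 := hAV i _ (hV _ hs) ((c i ↑(FreeGroup.mk ((i, false) :: s)))⁻¹ * g)
        have h2 : FreeGroup.of i • (↑(FreeGroup.mk ((i, false) :: s)) : FreeGroup (Fin n) ⧸ H0) =
            ↑(FreeGroup.mk s) := by
          rw [hmul, hi]
          change ((FreeGroup.of i * ((FreeGroup.of i)⁻¹ * FreeGroup.mk s) : FreeGroup (Fin n)) :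
            FreeGroup (Fin n) ⧸ H0) = _
          rw [mul_inv_cancel_left]
        rw [h2, mul_inv_cancel_left] at h1
        refine ⟨(c i ↑(FreeGroup.mk ((i, false) :: s)))⁻¹ * g, ?_, ?_⟩
        · rw [hi, map_inv, hof, Equiv.Perm.inv_eq_iff_eq, ← h1, hmul, hi]
        · rw [Prod.fst_mul, Prod.fst_inv, hc, hg1, h2, hmul, hi]
          group
  obtain ⟨g, hg, hg1⟩ := key y.1 (List.suffix_refl _)
  have hy1 : (↑(FreeGroup.mk y.1) : FreeGroup (Fin n) ⧸ H0) = ↑(1 : FreeGroup (Fin n)) := by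
    rw [QuotientGroup.eq]
    exact H0.mul_mem (H0.inv_mem ⟨y.elt, Code.elt_mem_subgroupOf hy, rfl⟩) H0.one_mem
  rw [← map_elt_run, hy1] at hg
  rw [hy1, hr1, inv_one, one_mul] at hg1
  refine ⟨?_, ?_⟩
  · have := congrArg Prod.fst hg
    simpa [σ, hr1] using this
  · rw [← hg1]
    exact congrArg (fun x => x.2.1) hg

/-- A certificate automaton always exists, and non-membership means that one clause of
`Aut.IsCert.mem_iff` fails. The first two clauses are decidable; failure of the third is witnessed
by a character modulo `q`. -/
theorem notMem_subgroupOf_iff {L : List (Code n m)} {x : Code n m} :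
    x.elt ∉ subgroupOf L ↔ ∃ A : Aut n m, A.IsCert L ∧ ((A.run x.1).1 ≠ [] ∨
      FreeGroup.mk (A.run x.1).2.1 ≠ FreeGroup.mk x.1 ∨
      ∃ χ : Fin m → ℤ, ∃ q : ℕ, (∀ y ∈ A.kerList L, (q : ℤ) ∣ pairing χ y.2) ∧
        ¬ (q : ℤ) ∣ pairing χ (x.2 + -(A.run x.1).2.2)) := by
  have hadd : ∀ χ v w : Fin m → ℤ, pairing χ (v + w) = pairing χ v + pairing χ w := by
    intro χ v w
    simp [pairing, mul_add, Finset.sum_add_distrib]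
  have hneg : ∀ χ v : Fin m → ℤ, pairing χ (-v) = - pairing χ v := by
    intro χ v
    simp [pairing]
  have hrun : ∀ A : Aut n m, (A.action x.elt.1 ([], 1)).1 = (A.run x.1).1 ∧
      (A.action x.elt.1 ([], 1)).2 = (A.run x.1).2.elt := by
    intro A
    have h : A.action x.elt.1 ([], 1) = _ := (map_elt_run A x.1).symm
    rw [h]
    exact ⟨rfl, rfl⟩
  constructor
  · intro hx
    obtain ⟨A, hA⟩ := exists_isCert L
    refine ⟨A, hA, ?_⟩
    rw [hA.mem_iff, (hrun A).1, (hrun A).2] at hx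
    by_cases h1 : (A.run x.1).1 = []
    swap
    · exact Or.inl h1
    by_cases h2 : FreeGroup.mk (A.run x.1).2.1 = FreeGroup.mk x.1
    swap
    · exact Or.inr (Or.inl h2)
    refine Or.inr (Or.inr ?_)
    let S : AddSubgroup (Fin m → ℤ) := Subgroup.toAddSubgroup'
      ((subgroupOf (A.kerList L)).comap (MonoidHom.inr (FreeGroup (Fin n)) _))
    have hS : ∀ v, v ∈ S ↔ Code.elt ([], v) ∈ subgroupOf (A.kerList L) := fun v => Iff.rfl
    have hb : x.2 + -(A.run x.1).2.2 ∉ S := by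
      rw [hS]
      intro h
      refine hx ⟨h1, h2, ?_⟩
      convert h using 1
      ext1
      · simp only [Code.elt, Prod.fst_mul, Prod.fst_inv, h2, mul_inv_cancel]
        rfl
      · rfl
    obtain ⟨χ, q, h3, h4⟩ := notMem_addSubgroup_iff.1 hb
    refine ⟨χ, q, fun y hy => h3 _ ?_, h4⟩
    rw [hS]
    convert Code.elt_mem_subgroupOf hy using 1
    obtain ⟨z, -, rfl⟩ := List.mem_map.1 hy
    rfl
  · rintro ⟨A, hA, h⟩ hx
    rw [hA.mem_iff, (hrun A).1, (hrun A).2] at hx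
    obtain ⟨h1, h2, h3⟩ := hx
    rcases h with h | h | ⟨χ, q, h4, h5⟩
    · exact h h1
    · exact h h2
    · let S : Subgroup (FTA n m) :=
        { carrier := {g | (q : ℤ) ∣ pairing χ (Multiplicative.toAdd g.2)}
          one_mem' := by simp [pairing]
          mul_mem' := by
            intro g g' hg hg'
            simp only [Set.mem_ofPred_eq, Prod.snd_mul, toAdd_mul, hadd] at *
            exact dvd_add hg hg'
          inv_mem' := by
            intro g hg
            simp only [Set.mem_ofPred_eq, Prod.snd_inv, toAdd_inv, hneg, dvd_neg] at *
            exact hg }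
      have hle : subgroupOf (A.kerList L) ≤ S := subgroupOf_le_iff.2 h4
      exact h5 (hle h3)

theorem semiDec_notMem {f : α → List (Code n m)} {g : α → Code n m} (hf : Primrec f)
    (hg : Primrec g) : SemiDec fun a => (g a).elt ∉ subgroupOf (f a) := by
  refine SemiDec.of_iff ?_ fun a => notMem_subgroupOf_iff
  refine SemiDec.ex ?_
  refine SemiDec.and (semiDec_isCert (by fun_prop) (by fun_prop)) ?_
  refine SemiDec.or (SemiDec.of_primrec (PrimrecPred.not (Primrec.eq.comp (by fun_prop)
    (by fun_prop)))) (SemiDec.or (SemiDec.of_primrec (PrimrecPred.not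
      (primrec_word_eq (by fun_prop) (by fun_prop)))) ?_)
  refine SemiDec.ex ?_
  refine SemiDec.ex ?_
  refine SemiDec.and ?_ (SemiDec.of_primrec (PrimrecPred.not
    (primrec_int_dvd (by fun_prop) (by fun_prop))))
  refine SemiDec.all ?_ (by fun_prop)
  exact SemiDec.of_primrec (primrec_int_dvd (by fun_prop) (by fun_prop))

end Automata

end FreeTimesAbelian

namespace FreeTimesAbelian

open FreeGroup

/-! ### Paths inside finite sets of vertices -/

section Tracing

variable {X Ω : Type*} {f : FreeGroup X → Ω} {V : Set Ω} {a b : FreeGroup X}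
  {w z : List (X × Bool)}

/-- All the vertices `f (a p)`, for `p` a prefix of `w`, lie in `V`. -/
def Traces (f : FreeGroup X → Ω) (V : Set Ω) (a : FreeGroup X) (w : List (X × Bool)) : Prop :=
  ∀ i, f (a * mk (w.take i)) ∈ V

/-- `f` is compatible with right multiplication. -/
def RightCompat (f : FreeGroup X → Ω) : Prop := ∀ a b x, f a = f b → f (a * x) = f (b * x)

theorem traces_append : Traces f V a (w ++ z) ↔ Traces f V a w ∧ Traces f V (a * mk w) z := by
  constructor
  · intro h
    refine ⟨fun i => ?_, fun i => ?_⟩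
    · have := h (min i w.length)
      rw [List.take_append_of_le_length (min_le_right _ _)] at this
      rcases le_total i w.length with hi | hi
      · rwa [min_eq_left hi] at this
      · rwa [min_eq_right hi, List.take_length, ← List.take_of_length_le hi] at this
    · have := h (w.length + i)
      rwa [List.take_length_add_append, ← mul_mk, ← mul_assoc] at this
  · rintro ⟨h1, h2⟩ i
    rcases le_total i w.length with hi | hi
    · rw [List.take_append_of_le_length hi]
      exact h1 i
    · obtain ⟨j, rfl⟩ := Nat.exists_eq_add_of_le hi
      rw [List.take_length_add_append, ← mul_mk, ← mul_assoc]
      exact h2 j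

theorem Traces.last (h : Traces f V a w) : f (a * mk w) ∈ V := by
  have := h w.length
  rwa [List.take_length] at this

theorem Traces.congr (hf : RightCompat f) (hab : f a = f b) (h : Traces f V a w) :
    Traces f V b w := fun i => hf _ _ (mk (w.take i)) hab ▸ h i

theorem Traces.invRev (h : Traces f V a w) : Traces f V (a * mk w) (invRev w) := by
  intro i
  have h1 : mk w * mk ((FreeGroup.invRev w).take i) = mk (w.take (w.length - i)) := by
    have h2 : (FreeGroup.invRev w).take i = FreeGroup.invRev (w.drop (w.length - i)) := by
      unfold FreeGroup.invRev
      rw [List.take_reverse, List.length_map, List.map_drop]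
    rw [h2, ← inv_mk, mul_inv_eq_iff_eq_mul, mul_mk, List.take_append_drop]
  rw [mul_assoc, h1]
  exact h _

/-- A cancelling pair of letters returns to the vertex where it started, so deleting it only removes
vertices from the path. -/
theorem Traces.red (h : Traces f V a w) (hr : Red w z) : Traces f V a z := by
  induction hr with
  | refl => exact h
  | tail _ hs ih =>
    cases hs with
    | @not L₁ L₂ x c =>
      rw [show L₁ ++ (x, c) :: (x, !c) :: L₂ = L₁ ++ ([(x, c), (x, !c)] ++ L₂) by simp,
        traces_append, traces_append] at ih
      rw [traces_append]
      refine ⟨ih.1, ?_⟩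
      have h2 := ih.2.2
      have h3 : mk [(x, c), (x, !c)] = 1 := Quot.sound (Red.Step.not (L₁ := []) (L₂ := []))
      rwa [h3, mul_one] at h2

theorem Traces.toWord [DecidableEq X] (h : Traces f V a w) : Traces f V a (mk w).toWord := by
  rw [toWord_mk]
  exact h.red reduce.red

/-- Cutting loops: every vertex reached by a path inside a finite set is reached by a short one. -/
theorem Traces.exists_short {V : Finset Ω} (hf : RightCompat f) (h : Traces f V a w) :
    ∃ w' : List (X × Bool), w'.length ≤ V.card ∧ f (a * mk w') = f (a * mk w) := by
  induction hlen : w.length using Nat.strong_induction_on generalizing w with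
  | _ N ih =>
    subst hlen
    by_cases hc : w.length ≤ V.card
    · exact ⟨w, hc, rfl⟩
    push Not at hc
    -- Pigeonhole on the first `V.card + 1` prefixes gives two that end at the same vertex; the loop
    -- between them is cut out.
    obtain ⟨i, hi, j, hj, hij, he⟩ := Finset.exists_ne_map_eq_of_card_lt_of_maps_to
      (s := Finset.range (V.card + 1)) (t := V) (by simp)
      (f := fun i => f (a * mk (w.take i))) (fun i _ => h i)
    wlog hlt : i < j generalizing i j
    · exact this j hj i hi hij.symm he.symm (by omega)
    rw [Finset.mem_range] at hi hj
    have hw : Traces f V a (w.take j ++ w.drop j) := by rwa [List.take_append_drop]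
    have hw1 : Traces f V a (w.take i ++ w.drop i) := by rwa [List.take_append_drop]
    rw [traces_append] at hw hw1
    have hnew : Traces f V a (w.take i ++ w.drop j) :=
      traces_append.2 ⟨hw1.1, hw.2.congr hf he.symm⟩
    obtain ⟨w', hl, hw'⟩ := ih _ (by rw [List.length_append, List.length_take, List.length_drop]; omega)
      hnew rfl
    refine ⟨w', hl, hw'.trans ?_⟩
    rw [← mul_mk, ← mul_assoc, hf _ _ _ he, mul_assoc, mul_mk, List.take_append_drop]

/-- A vertex stabilizer all of whose elements are read inside a finite set is generated by short
elements. -/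
theorem le_closure_short {V : Finset Ω} (hf : RightCompat f) {K : Subgroup (FreeGroup X)}
    (hK : ∀ x, x ∈ K ↔ f x = f 1)
    (hV : ∀ x ∈ K, ∃ w, mk w = x ∧ Traces f V 1 w) :
    K ≤ Subgroup.closure {x | x ∈ K ∧ ∃ w : List (X × Bool), w.length ≤ 2 * V.card + 1 ∧ mk w = x} := by
  -- Schreier's argument with short paths to the vertices in place of a transversal: each letter `l`
  -- of `w` contributes a factor `s' l s⁻¹`, whence the length `2 * V.card + 1`.
  have key : ∀ w : List (X × Bool), Traces f V 1 w → ∀ s : List (X × Bool), s.length ≤ V.card →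
      f (mk s) = f (mk w) → mk w * (mk s)⁻¹ ∈ Subgroup.closure
        {x | x ∈ K ∧ ∃ w : List (X × Bool), w.length ≤ 2 * V.card + 1 ∧ mk w = x} := by
    intro w
    induction w using List.reverseRecOn with
    | nil =>
      intro _ s hs hfs
      refine Subgroup.subset_closure ⟨?_, FreeGroup.invRev s, by rw [invRev_length]; omega, ?_⟩
      · rw [hK]
        have := hf _ _ (mk s)⁻¹ hfs
        rw [mul_inv_cancel] at this
        exact this.symm
      · rw [← inv_mk, ← one_eq_mk, one_mul]
    | append_singleton w l ih =>
      intro hw s hs hfs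
      have hw0 := (traces_append.1 hw).1
      obtain ⟨s', hs', hfs'⟩ := hw0.exists_short hf
      rw [one_mul, one_mul] at hfs'
      have h1 := ih hw0 s' hs' hfs'
      have h2 : mk s' * mk [l] * (mk s)⁻¹ ∈ Subgroup.closure
          {x | x ∈ K ∧ ∃ w : List (X × Bool), w.length ≤ 2 * V.card + 1 ∧ mk w = x} := by
        refine Subgroup.subset_closure ⟨?_, s' ++ [l] ++ FreeGroup.invRev s, ?_, ?_⟩
        · rw [hK]
          have h3 : f (mk s' * mk [l]) = f (mk s) := by
            rw [hf _ _ _ hfs', mul_mk, hfs]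
          rw [hf _ _ _ h3, mul_inv_cancel]
        · simp only [List.length_append, invRev_length, List.length_singleton]
          omega
        · rw [← mul_mk, ← mul_mk, inv_mk]
      have h4 := Subgroup.mul_mem _ h1 h2
      convert h4 using 1
      rw [← mul_mk]
      group
  intro x hx
  obtain ⟨w, rfl, hw⟩ := hV x hx
  have := key w hw [] (by simp) (by rw [(hK _).1 hx]; rfl)
  rwa [← one_eq_mk, inv_one, mul_one] at this

end Tracing

/-! ### The finite core of a Schreier graph -/

section Core

variable {X : Type*}

/-- The vertex `P a` of the Schreier graph of `P`. -/
def vertex (P : Subgroup (FreeGroup X)) (a : FreeGroup X) : FreeGroup X ⧸ P := ↑a⁻¹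

theorem vertex_eq_iff {P : Subgroup (FreeGroup X)} {a b : FreeGroup X} :
    vertex P a = vertex P b ↔ a * b⁻¹ ∈ P := by
  rw [vertex, vertex, QuotientGroup.eq, inv_inv]

theorem rightCompat_vertex (P : Subgroup (FreeGroup X)) : RightCompat (vertex P) := by
  intro a b x h
  rw [vertex_eq_iff] at h ⊢
  simpa [mul_assoc] using h

/-- The subgroup generated by a list of words. -/
def wordSubgroup (L : List (List (X × Bool))) : Subgroup (FreeGroup X) :=
  Subgroup.closure {x | ∃ w ∈ L, mk w = x}

open Classical in
/-- The vertices of the Schreier graph read along the words of `L` and along `q`. -/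
noncomputable def core (L : List (List (X × Bool))) (q : List (X × Bool)) :
    Finset (FreeGroup X ⧸ wordSubgroup L) :=
  (((q :: L).flatMap List.inits).map fun p => vertex (wordSubgroup L) (mk p)).toFinset

theorem mem_core {L : List (List (X × Bool))} {q : List (X × Bool)}
    {ω : FreeGroup X ⧸ wordSubgroup L} :
    ω ∈ core L q ↔ ∃ w ∈ q :: L, ∃ p, p <+: w ∧ vertex (wordSubgroup L) (mk p) = ω := by
  simp only [core, List.mem_toFinset, List.mem_map, List.mem_flatMap, List.mem_inits]
  constructor
  · rintro ⟨p, ⟨w, hw, hp⟩, h⟩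
    exact ⟨w, hw, p, hp, h⟩
  · rintro ⟨w, hw, p, hp, h⟩
    exact ⟨p, ⟨w, hw, hp⟩, h⟩

/-- The number of prefixes of the words of a list. -/
def totalLength (L : List (List (X × Bool))) : ℕ := (L.map fun w => w.length + 1).sum

theorem card_core_le (L : List (List (X × Bool))) (q : List (X × Bool)) :
    (core L q).card ≤ totalLength L + q.length + 1 := by
  classical
  refine (List.toFinset_card_le _).trans ?_
  rw [List.length_map, List.length_flatMap]
  simp only [List.length_inits, List.map_cons, List.sum_cons]
  unfold totalLength
  omega

theorem length_le_totalLength {L : List (List (X × Bool))} {w : List (X × Bool)} (hw : w ∈ L) :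
    w.length ≤ totalLength L := by
  have := List.le_sum_of_mem (List.mem_map_of_mem (f := fun w : List (X × Bool) => w.length + 1) hw)
  unfold totalLength
  omega

/-- Reduced closed paths at a vertex stay in the core. -/
theorem traces_core [DecidableEq X] {L : List (List (X × Bool))} {q : List (X × Bool)} {x : FreeGroup X}
    (hx : mk q * x * (mk q)⁻¹ ∈ wordSubgroup L) :
    Traces (vertex (wordSubgroup L)) (core L q) (mk q) x.toWord := by
  have hf := rightCompat_vertex (wordSubgroup L)
  have hpre : ∀ w ∈ q :: L, Traces (vertex (wordSubgroup L)) (core L q) 1 w := by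
    intro w hw i
    rw [one_mul]
    exact Finset.mem_coe.2 (mem_core.2 ⟨w, hw, _, List.take_prefix _ _, rfl⟩)
  have hone : ∀ y ∈ wordSubgroup L, vertex (wordSubgroup L) y = vertex (wordSubgroup L) 1 := by
    intro y hy
    rw [vertex_eq_iff]
    simpa using hy
  have hq := hpre q List.mem_cons_self
  -- An unreduced product of generators and inverses is read inside the core, since each factor is a
  -- loop at the base vertex. The claim follows by conjugating with `q` and reducing freely.
  have key : ∀ y ∈ wordSubgroup L, ∃ v, mk v = y ∧
      Traces (vertex (wordSubgroup L)) (core L q) 1 v := by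
    intro y hy
    induction hy using Subgroup.closure_induction with
    | mem y hy =>
      obtain ⟨w, hw, rfl⟩ := hy
      exact ⟨w, rfl, hpre w (List.mem_cons_of_mem _ hw)⟩
    | one =>
      refine ⟨[], one_eq_mk.symm, fun i => ?_⟩
      have := hq 0
      simpa using this
    | mul y y' hy hy' ih ih' =>
      obtain ⟨v, rfl, hv⟩ := ih
      obtain ⟨v', rfl, hv'⟩ := ih'
      refine ⟨v ++ v', by rw [mul_mk], traces_append.2 ⟨hv, ?_⟩⟩
      rw [one_mul]
      exact hv'.congr hf (hone _ hy).symm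
    | inv y hy ih =>
      obtain ⟨v, rfl, hv⟩ := ih
      refine ⟨invRev v, inv_mk.symm, ?_⟩
      have := hv.invRev
      rw [one_mul] at this
      exact this.congr hf (hone _ hy)
  obtain ⟨v, hv, hvt⟩ := key _ hx
  have hmk : mk (invRev q ++ (v ++ q)) = x := by
    rw [← mul_mk, ← mul_mk, hv, ← inv_mk]
    group
  have ht : Traces (vertex (wordSubgroup L)) (core L q) (mk q) (invRev q ++ (v ++ q)) := by
    rw [traces_append, traces_append]
    have h1 : mk q * mk (invRev q) = 1 := by rw [← inv_mk, mul_inv_cancel]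
    have h2 := hq.invRev
    rw [one_mul] at h2
    rw [h1, one_mul]
    exact ⟨h2, hvt, hq.congr hf (hv ▸ (hone _ hx).symm)⟩
  have := ht.toWord
  rwa [hmk] at this

end Core

/-! ### Roots in the free group: bounded representatives and stabilizers -/

section Roots

variable {X : Type*}

/-- The elements `x` such that left multiplication by `x` does not change the cosets
`P u ^ i`, `i < k`. -/
def rootStab (P : Subgroup (FreeGroup X)) (u : FreeGroup X) (k : ℕ) : Subgroup (FreeGroup X) where
  carrier := {x | ∀ i < k, u ^ i * x * (u ^ i)⁻¹ ∈ P}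
  one_mem' := fun i _ => by simp [P.one_mem]
  mul_mem' := by
    intro x y hx hy i hi
    have := P.mul_mem (hx i hi) (hy i hi)
    simpa [mul_assoc] using this
  inv_mem' := by
    intro x hx i hi
    have := P.inv_mem (hx i hi)
    simpa [mul_assoc] using this

theorem mem_rootStab {P : Subgroup (FreeGroup X)} {u : FreeGroup X} {k : ℕ} {x : FreeGroup X} :
    x ∈ rootStab P u k ↔ ∀ i < k, u ^ i * x * (u ^ i)⁻¹ ∈ P := Iff.rfl

theorem mk_pow_eq (w : List (X × Bool)) (i : ℕ) : mk w ^ i = mk (List.replicate i w).flatten := by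
  induction i with
  | zero => simp [one_eq_mk]
  | succ i ih => rw [pow_succ', ih, mul_mk, List.replicate_succ, List.flatten_cons]

/-- A bound for the lengths of generators of `rootStab`. -/
def stabBound (L : List (List (X × Bool))) (l k : ℕ) : ℕ :=
  2 * (totalLength L + k * l + 1) ^ k + 1

/-- `rootStab` is the stabilizer of the tuple of vertices `P u^i`, `i < k`, in a `k`-fold product of
Schreier graphs. In each coordinate a reduced closed path stays in a core of bounded size, so
`le_closure_short` applies to the product of the cores. -/
theorem rootStab_le_closure [DecidableEq X] (L : List (List (X × Bool))) (w : List (X × Bool)) (k : ℕ) :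
    rootStab (wordSubgroup L) (mk w) k ≤ Subgroup.closure
      {x | x ∈ rootStab (wordSubgroup L) (mk w) k ∧
        ∃ v : List (X × Bool), v.length ≤ stabBound L w.length k ∧ mk v = x} := by
  classical
  let f : FreeGroup X → Fin k → FreeGroup X ⧸ wordSubgroup L := fun a i =>
    vertex (wordSubgroup L) (mk w ^ (i : ℕ) * a)
  have hf : RightCompat f := by
    intro a b x h
    funext i
    have := rightCompat_vertex (wordSubgroup L) _ _ x (congrFun h i)
    simpa [f, mul_assoc] using this
  let V : Finset (Fin k → FreeGroup X ⧸ wordSubgroup L) :=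
    Fintype.piFinset fun i => core L (List.replicate (i : ℕ) w).flatten
  have hcard : V.card ≤ (totalLength L + k * w.length + 1) ^ k := by
    rw [Fintype.card_piFinset]
    refine (Finset.prod_le_pow_card _ _ (totalLength L + k * w.length + 1) fun i _ => ?_).trans
      (by simp)
    refine (card_core_le _ _).trans ?_
    have : (i : ℕ) * w.length ≤ k * w.length := Nat.mul_le_mul_right _ i.2.le
    simp only [List.length_flatten, List.map_replicate, List.sum_replicate, smul_eq_mul]
    omega
  refine (le_closure_short (V := V) hf ?_ ?_).trans (Subgroup.closure_mono ?_)
  · intro x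
    rw [mem_rootStab, funext_iff, Fin.forall_iff]
    refine forall₂_congr fun i hi => ?_
    simp only [f]
    rw [vertex_eq_iff, mul_one]
  · intro x hx
    refine ⟨x.toWord, mk_toWord, fun i => ?_⟩
    rw [Finset.mem_coe, Fintype.mem_piFinset]
    intro j
    have := traces_core (L := L) (q := (List.replicate (j : ℕ) w).flatten) (x := x)
      (by rw [← mk_pow_eq]; exact hx j j.2) i
    rw [← mk_pow_eq] at this
    simpa [f] using this
  · rintro x ⟨hx, v, hv, rfl⟩
    refine ⟨hx, v, hv.trans ?_, rfl⟩
    unfold stabBound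
    omega

/-- The tuples of cosets of the powers of `v` and `u` agree up to translation by `P`. -/
def RootEquiv (P : Subgroup (FreeGroup X)) (k : ℕ) (v u : FreeGroup X) : Prop :=
  ∃ h ∈ P, ∀ i ≤ k, v ^ i * h * (u ^ i)⁻¹ ∈ P

/-- A bound for the lengths of representatives of `k`-roots. -/
def repBound (L : List (List (X × Bool))) (k : ℕ) : ℕ :=
  2 * totalLength L + (totalLength L + 1) ^ k

/-- With `v = r c r⁻¹` and `c` cyclically reduced, the reduced word of `v^k` is `r c^k r⁻¹` and
stays in the core. The end of `r` is thus reached by a prefix `r0` of a generator. Reading `c`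
simultaneously from the `k` vertices `P r c^i` is a path in the `k`-th power of the core; cutting
its loops gives a short `c'` with the same endpoints. The short root is `r0 c' r0⁻¹`, and the
translating element is `r r0⁻¹ ∈ P`. -/
theorem exists_short_rootEquiv [DecidableEq X] (L : List (List (X × Bool))) {k : ℕ} (hk : 1 ≤ k)
    {v : FreeGroup X} (hv : v ^ k ∈ wordSubgroup L) :
    ∃ w : List (X × Bool), w.length ≤ repBound L k ∧ RootEquiv (wordSubgroup L) k v (mk w) := by
  classical
  set P := wordSubgroup L with hP
  have hf := rightCompat_vertex P
  set r := reduceCyclically.conjugator v.toWord with hr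
  set c := reduceCyclically v.toWord with hc
  have hvrc : v = mk r * mk c * (mk r)⁻¹ := by
    rw [inv_mk, mul_mk, mul_mk, reduceCyclically.conj_conjugator_reduceCyclically, mk_toWord]
  have hword : (v ^ k).toWord = r ++ ((List.replicate k c).flatten ++ invRev r) := by
    conv_lhs => rw [← mk_toWord (x := v), mk_pow_eq, toWord_mk]
    rw [reduceCyclically.reduce_flatten_replicate isReduced_toWord, if_neg (by omega),
      List.append_assoc]
  have ht : Traces (vertex P) (core L []) 1 (v ^ k).toWord :=
    traces_core (q := []) (by simpa [← one_eq_mk] using hv)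
  rw [hword, traces_append, traces_append, one_mul] at ht
  obtain ⟨ht1, ht2, -⟩ := ht
  have hstep : ∀ i < k, Traces (vertex P) (core L []) (mk r * mk c ^ i) c := by
    intro i hi
    have h1 : (List.replicate k c).flatten =
        (List.replicate i c).flatten ++ (c ++ (List.replicate (k - i - 1) c).flatten) := by
      rw [← List.flatten_cons, ← List.replicate_succ, ← List.flatten_append,
        List.replicate_append_replicate]
      congr 2
      omega
    rw [h1, traces_append, traces_append, ← mk_pow_eq] at ht2
    exact ht2.2.1
  obtain ⟨r0, hr0, hrr0⟩ : ∃ r0 : List (X × Bool), r0.length ≤ totalLength L ∧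
      vertex P (mk r0) = vertex P (mk r) := by
    have := ht1.last
    rw [one_mul, Finset.mem_coe, mem_core] at this
    obtain ⟨w, hw, p, hp, h⟩ := this
    refine ⟨p, ?_, h⟩
    rcases List.mem_cons.1 hw with rfl | hw
    · simp [List.prefix_nil.1 hp]
    · exact hp.length_le.trans (length_le_totalLength hw)
  let f : FreeGroup X → Fin k → FreeGroup X ⧸ P := fun a i => vertex P (mk r * mk c ^ (i : ℕ) * a)
  have hf' : RightCompat f := by
    intro a b x h
    funext i
    have := hf _ _ x (congrFun h i)
    simpa [f, mul_assoc] using this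
  have htr : Traces f (Fintype.piFinset fun _ : Fin k => core L [] : Finset _) 1 c := by
    intro i
    rw [Finset.mem_coe, Fintype.mem_piFinset]
    intro j
    have := hstep j j.2 i
    simpa [f] using this
  obtain ⟨c', hc', hfc⟩ := htr.exists_short hf'
  rw [one_mul, one_mul] at hfc
  have hcard : c'.length ≤ (totalLength L + 1) ^ k := by
    refine hc'.trans ?_
    rw [Fintype.card_piFinset_const]
    exact Nat.pow_le_pow_left (card_core_le L []) k
  -- `c'` moves `P r c^i` to `P r c^(i+1)` for every `i < k`, just as `c` does, so the powers follow
  -- the same vertices.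
  have hpow : ∀ i ≤ k, vertex P (mk r * mk c' ^ i) = vertex P (mk r * mk c ^ i) := by
    intro i
    induction i with
    | zero => intro _; simp
    | succ i ih =>
      intro hi
      have h1 := hf _ _ (mk c') (ih (by omega))
      have h2 : vertex P (mk r * mk c ^ i * mk c') = vertex P (mk r * mk c ^ i * mk c) :=
        congrFun hfc ⟨i, by omega⟩
      rw [pow_succ, pow_succ, ← mul_assoc, ← mul_assoc, h1, h2]
  have hh : mk r * (mk r0)⁻¹ ∈ P := vertex_eq_iff.1 hrr0.symm
  refine ⟨r0 ++ c' ++ invRev r0, ?_, mk r * (mk r0)⁻¹, hh, fun i hi => ?_⟩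
  · simp only [List.length_append, invRev_length]
    unfold repBound
    omega
  · rw [← mul_mk, ← mul_mk, ← inv_mk, conj_pow, hvrc, conj_pow]
    have h1 := P.mul_mem (vertex_eq_iff.1 (hpow i hi).symm) hh
    convert h1 using 1
    group

end Roots

end FreeTimesAbelian

namespace FreeTimesAbelian

/-! ### Certificates for finite unions of cosets -/

section CosetCovers

variable {n m : ℕ} {α : Type*} [Primcodable α]

/-- A finite certificate for the fact that the cosets `⟨W⟩ t`, `t ∈ T`, cover `⟨L⟩`. -/
def IsCosetCover (L W T : List (Code n m)) : Prop :=
  (∃ t ∈ T, t.elt ∈ subgroupOf W) ∧ ∀ t ∈ T, ∀ y ∈ L,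
    (∃ t' ∈ T, (t.mul (y.mul t'.inv)).elt ∈ subgroupOf W) ∧
      ∃ t' ∈ T, (t.mul (y.inv.mul t'.inv)).elt ∈ subgroupOf W

theorem semiDec_isCosetCover {L W T : α → List (Code n m)} (hL : Primrec L) (hW : Primrec W)
    (hT : Primrec T) : SemiDec fun a => IsCosetCover (L a) (W a) (T a) := by
  unfold IsCosetCover
  refine SemiDec.and ?_ ?_
  · refine SemiDec.exMem ?_ hT
    exact semiDec_mem (by fun_prop) (by fun_prop)
  · refine SemiDec.all ?_ hT
    refine SemiDec.all ?_ (by fun_prop)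
    refine SemiDec.and ?_ ?_
    · refine SemiDec.exMem ?_ (by fun_prop)
      exact semiDec_mem (by fun_prop) (by fun_prop)
    · refine SemiDec.exMem ?_ (by fun_prop)
      exact semiDec_mem (by fun_prop) (by fun_prop)

/-- The union of the cosets contains `1` and is stable under right multiplication by generators and
their inverses. -/
theorem IsCosetCover.exists_mem {L W T : List (Code n m)} (h : IsCosetCover L W T) {g : FTA n m}
    (hg : g ∈ subgroupOf L) : ∃ t ∈ T, g * t.elt⁻¹ ∈ subgroupOf W := by
  induction hg using Subgroup.closure_induction_right with
  | one =>
    obtain ⟨t, ht, htW⟩ := h.1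
    exact ⟨t, ht, by rw [one_mul]; exact Subgroup.inv_mem _ htW⟩
  | mul_right x _ y hy ih =>
    obtain ⟨t, ht, htW⟩ := ih
    obtain ⟨z, hz, rfl⟩ := hy
    obtain ⟨t', ht', ht'W⟩ := (h.2 t ht z hz).1
    refine ⟨t', ht', ?_⟩
    have := Subgroup.mul_mem _ htW ht'W
    simpa [mul_assoc] using this
  | mul_inv_cancel x _ y hy ih =>
    obtain ⟨t, ht, htW⟩ := ih
    obtain ⟨z, hz, rfl⟩ := hy
    obtain ⟨t', ht', ht'W⟩ := (h.2 t ht z hz).2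
    refine ⟨t', ht', ?_⟩
    have := Subgroup.mul_mem _ htW ht'W
    simpa [mul_assoc] using this

theorem exists_subgroupOf_eq {A : Subgroup (FTA n m)} (hA : A.FG) :
    ∃ W : List (Code n m), subgroupOf W = A := by
  obtain ⟨S, rfl⟩ := hA
  choose f hf using Code.elt_surjective (n := n) (m := m)
  refine ⟨S.toList.map f, ?_⟩
  rw [subgroupOf]
  congr 1
  ext g
  constructor
  · rintro ⟨x, hx, rfl⟩
    obtain ⟨s, hs, rfl⟩ := List.mem_map.1 hx
    rw [hf]
    simpa using hs
  · intro hg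
    exact ⟨f g, List.mem_map_of_mem (by simpa using hg), hf g⟩

theorem fg_subgroupOf (L : List (Code n m)) : (subgroupOf L).FG := by
  classical
  refine ⟨(L.map Code.elt).toFinset, ?_⟩
  rw [subgroupOf]
  congr 1
  ext g
  simp

/-- Subgroups of finite index have generators and representatives of the cosets. -/
theorem exists_cosetCover (L : List (Code n m)) {A : Subgroup (FTA n m)} (hA : A ≤ subgroupOf L)
    (hfin : (A.subgroupOf (subgroupOf L)).FiniteIndex) :
    ∃ W T : List (Code n m), subgroupOf W = A ∧ (∀ t ∈ T, t.elt ∈ subgroupOf L) ∧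
      IsCosetCover L W T ∧ T.Pairwise fun t t' => (t.mul t'.inv).elt ∉ subgroupOf W := by
  classical
  have hfgL : Group.FG (subgroupOf L) := (Group.fg_iff_subgroup_fg _).2 (fg_subgroupOf L)
  have hfg : A.FG := by
    have h1 : (A.subgroupOf (subgroupOf L)).FG :=
      (Group.fg_iff_subgroup_fg _).1 (Subgroup.fg_of_index_ne_zero _)
    obtain ⟨S, hS⟩ := h1
    refine ⟨S.image (subgroupOf L).subtype, ?_⟩
    rw [Finset.coe_image, ← MonoidHom.map_closure, hS, Subgroup.subgroupOf_map_subtype,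
      inf_eq_left.2 hA]
  obtain ⟨W, hW⟩ := exists_subgroupOf_eq hfg
  choose f hf using Code.elt_surjective (n := n) (m := m)
  have := Fintype.ofFinite (subgroupOf L ⧸ A.subgroupOf (subgroupOf L))
  -- The quotient consists of left cosets while covers use right cosets, hence the inverse.
  let rep : subgroupOf L ⧸ A.subgroupOf (subgroupOf L) → Code n m := fun q =>
    f ((q.out : subgroupOf L) : FTA n m)⁻¹
  have hrep : ∀ q, (rep q).elt = ((q.out : subgroupOf L) : FTA n m)⁻¹ := fun q => hf _
  have hex : ∀ g ∈ subgroupOf L, ∃ q, g * (rep q).elt⁻¹ ∈ A := by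
    intro g hg
    refine ⟨((⟨g, hg⟩ : subgroupOf L)⁻¹ : subgroupOf L), ?_⟩
    rw [hrep, inv_inv]
    have h1 := QuotientGroup.mk_out_eq_mul (A.subgroupOf (subgroupOf L)) (⟨g, hg⟩ : subgroupOf L)⁻¹
    obtain ⟨a, ha⟩ := h1
    rw [ha]
    have := a.2
    rw [Subgroup.mem_subgroupOf] at this
    simpa using this
  refine ⟨W, Finset.univ.toList.map rep, hW, ?_, ⟨?_, ?_⟩, ?_⟩
  · intro t ht
    obtain ⟨q, -, rfl⟩ := List.mem_map.1 ht
    rw [hrep]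
    exact Subgroup.inv_mem _ (SetLike.coe_mem _)
  · obtain ⟨q, hq⟩ := hex 1 (Subgroup.one_mem _)
    refine ⟨rep q, List.mem_map_of_mem (by simp), ?_⟩
    rw [hW]
    simpa using hq
  · intro t ht y hy
    obtain ⟨q, -, rfl⟩ := List.mem_map.1 ht
    have hq : (rep q).elt ∈ subgroupOf L := by
      rw [hrep]
      exact Subgroup.inv_mem _ (SetLike.coe_mem _)
    have hyL := Code.elt_mem_subgroupOf hy
    obtain ⟨q1, h1⟩ := hex _ (Subgroup.mul_mem _ hq hyL)
    obtain ⟨q2, h2⟩ := hex _ (Subgroup.mul_mem _ hq (Subgroup.inv_mem _ hyL))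
    rw [hW]
    exact ⟨⟨rep q1, List.mem_map_of_mem (by simp), by simpa [mul_assoc] using h1⟩,
      rep q2, List.mem_map_of_mem (by simp), by simpa [mul_assoc] using h2⟩
  · rw [List.pairwise_map]
    refine (Finset.nodup_toList _).imp fun {q q'} hne h => hne ?_
    rw [hW, Code.elt_mul, Code.elt_inv, hrep, hrep, inv_inv] at h
    rw [← Quotient.out_eq q, ← Quotient.out_eq q']
    refine QuotientGroup.eq.2 ?_
    rw [Subgroup.mem_subgroupOf]
    simpa using h

end CosetCovers

/-! ### The preimage of a subgroup under `u t^b ↦ u t^{kb}` -/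

section Scaling

variable {n m : ℕ} {α : Type*} [Primcodable α]

/-- The endomorphism `u t^b ↦ u t^{kb}`. -/
def scaleHom (n m k : ℕ) : FTA n m →* FTA n m :=
  (MonoidHom.id _).prodMap (powMonoidHom k)

theorem Code.elt_scale (k : ℕ) (x : Code n m) : (Code.scale k x).elt = scaleHom n m k x.elt := rfl

theorem scaleHom_injective {k : ℕ} (hk : 1 ≤ k) : Function.Injective (scaleHom n m k) := by
  rintro ⟨u, a⟩ ⟨v, b⟩ h
  have h1 : u = v := congrArg Prod.fst h
  have h2 : a ^ k = b ^ k := congrArg Prod.snd h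
  have h3 : a = b := by
    refine Multiplicative.toAdd.injective ?_
    funext i
    have h4 := congrFun (congrArg Multiplicative.toAdd h2) i
    simp only [toAdd_pow, Pi.smul_apply, nsmul_eq_mul] at h4
    exact mul_left_cancel₀ (by exact_mod_cast (by omega : k ≠ 0)) h4
  rw [h1, h3]

theorem mem_range_scaleHom {k : ℕ} {x : Code n m} :
    x.elt ∈ (scaleHom n m k).range ↔ ∀ i, (k : ℤ) ∣ x.2 i := by
  constructor
  · rintro ⟨y, hy⟩ i
    have := congrFun (congrArg (fun z : FTA n m => Multiplicative.toAdd z.2) hy) i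
    refine ⟨Multiplicative.toAdd y.2 i, ?_⟩
    rw [← nsmul_eq_mul]
    exact this.symm
  · intro h
    choose b hb using h
    refine ⟨Code.elt (x.1, b), ?_⟩
    rw [← Code.elt_scale, Code.elt_eq_iff]
    refine ⟨rfl, ?_⟩
    funext i
    simp [Code.scale, hb i]

theorem finiteIndex_range_scaleHom {k : ℕ} (hk : 1 ≤ k) : (scaleHom n m k).range.FiniteIndex := by
  let B : Subgroup (Multiplicative (Fin m → ℤ)) := (powMonoidHom k).range
  have hBi : B.FiniteIndex := Subgroup.finiteIndex_range_powMonoidHom_of_fg _ (by omega)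
  have : (scaleHom n m k).range = B.comap (MonoidHom.snd _ _) := by
    ext ⟨u, a⟩
    constructor
    · rintro ⟨y, hy⟩
      exact ⟨y.2, congrArg Prod.snd hy⟩
    · rintro ⟨b, hb⟩
      exact ⟨(u, b), Prod.ext rfl hb⟩
  rw [this, Subgroup.finiteIndex_iff, Subgroup.index_comap_of_surjective _ Prod.snd_surjective]
  exact hBi.index_ne_zero

theorem subgroupOf_map_scale (k : ℕ) (W : List (Code n m)) :
    subgroupOf (W.map (Code.scale k)) = (subgroupOf W).map (scaleHom n m k) := by
  rw [subgroupOf, subgroupOf, MonoidHom.map_closure]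
  congr 1
  ext g
  constructor
  · rintro ⟨x, hx, rfl⟩
    obtain ⟨y, hy, rfl⟩ := List.mem_map.1 hx
    exact ⟨y.elt, ⟨y, hy, rfl⟩, rfl⟩
  · rintro ⟨_, ⟨y, hy, rfl⟩, rfl⟩
    exact ⟨Code.scale k y, List.mem_map_of_mem hy, rfl⟩

/-- A finite certificate for the fact that `W` generates the preimage of `⟨L⟩` under
`u t^b ↦ u t^{kb}`. -/
def IsScalePreimage (L : List (Code n m)) (k : ℕ) (W : List (Code n m)) : Prop :=
  (∀ x ∈ W, (Code.scale k x).elt ∈ subgroupOf L) ∧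
    ∃ T : List (Code n m), IsCosetCover L (W.map (Code.scale k)) T ∧
      ∀ t ∈ T, (∃ i ∈ List.finRange m, ¬ (k : ℤ) ∣ t.2 i) ∨
        t.elt ∈ subgroupOf (W.map (Code.scale k))

theorem semiDec_isScalePreimage {L W : α → List (Code n m)} {k : α → ℕ} (hL : Primrec L)
    (hk : Primrec k) (hW : Primrec W) : SemiDec fun a => IsScalePreimage (L a) (k a) (W a) := by
  unfold IsScalePreimage
  refine SemiDec.and ?_ ?_
  · refine SemiDec.all ?_ hW
    exact semiDec_mem (by fun_prop) (by fun_prop)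
  · refine SemiDec.ex ?_
    refine SemiDec.and (semiDec_isCosetCover (by fun_prop) (by fun_prop) (by fun_prop)) ?_
    refine SemiDec.all ?_ (by fun_prop)
    refine SemiDec.or ?_ (semiDec_mem (by fun_prop) (by fun_prop))
    refine SemiDec.exMem ?_ (by fun_prop)
    exact SemiDec.of_primrec (PrimrecPred.not (primrec_int_dvd (by fun_prop)
      (primrec_vec_apply (by fun_prop) (by fun_prop))))

/-- In the covering of `⟨L⟩`, a coset whose representative has a vector not divisible by `k` misses
the image of `scaleHom`; the other cosets are trivial. So the scaled list generates `⟨L⟩ ∩ range`,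
and `scaleHom` is injective. -/
theorem IsScalePreimage.subgroupOf_eq {L W : List (Code n m)} {k : ℕ} (hk : 1 ≤ k)
    (h : IsScalePreimage L k W) : subgroupOf W = (subgroupOf L).comap (scaleHom n m k) := by
  obtain ⟨h1, T, hT, hTk⟩ := h
  refine le_antisymm (subgroupOf_le_iff.2 h1) fun x hx => ?_
  rw [Subgroup.mem_comap] at hx
  obtain ⟨t, ht, htW⟩ := hT.exists_mem hx
  rw [subgroupOf_map_scale] at htW
  have ht' : t.elt ∈ subgroupOf (W.map (Code.scale k)) := by
    rcases hTk t ht with ⟨i, -, hi⟩ | h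
    · refine absurd ?_ hi
      refine mem_range_scaleHom.1 ?_ i
      have h2 := Subgroup.mul_mem _ (Subgroup.inv_mem _ (Subgroup.map_le_range _ _ htW))
        (⟨x, rfl⟩ : scaleHom n m k x ∈ (scaleHom n m k).range)
      simpa using h2
    · exact h
  rw [subgroupOf_map_scale] at ht'
  have h3 := Subgroup.mul_mem _ htW ht'
  rw [inv_mul_cancel_right] at h3
  obtain ⟨y, hy, hyx⟩ := h3
  rwa [← scaleHom_injective hk hyx]

/-- The image of `scaleHom` has finite index, so `⟨L⟩ ∩ range` has finite index in `⟨L⟩` and is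
finitely generated; the vectors of its generators are then divided by `k`. -/
theorem exists_isScalePreimage (L : List (Code n m)) {k : ℕ} (hk : 1 ≤ k) :
    ∃ W, IsScalePreimage L k W := by
  have hfin := finiteIndex_range_scaleHom (n := n) (m := m) hk
  have hfin' : ((subgroupOf L ⊓ (scaleHom n m k).range).subgroupOf (subgroupOf L)).FiniteIndex := by
    rw [Subgroup.inf_subgroupOf_left]
    infer_instance
  obtain ⟨W, T, hW, hTL, hcov, -⟩ := exists_cosetCover L inf_le_left hfin'
  have hpre : ∀ x : Code n m, ∃ y : Code n m, x ∈ W → (Code.scale k y).elt = x.elt := by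
    intro x
    by_cases hx : x ∈ W
    · have h1 := Code.elt_mem_subgroupOf hx
      rw [hW] at h1
      obtain ⟨z, hz⟩ := h1.2
      obtain ⟨y, rfl⟩ := Code.elt_surjective z
      exact ⟨y, fun _ => hz⟩
    · exact ⟨x, fun h => absurd h hx⟩
  choose f hf using hpre
  have hW' : subgroupOf ((W.map f).map (Code.scale k)) = subgroupOf W := by
    rw [subgroupOf, subgroupOf]
    congr 1
    ext g
    constructor
    · rintro ⟨x, hx, rfl⟩
      rw [List.map_map] at hx
      obtain ⟨y, hy, rfl⟩ := List.mem_map.1 hx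
      exact ⟨y, hy, (hf y hy).symm⟩
    · rintro ⟨x, hx, rfl⟩
      exact ⟨Code.scale k (f x), List.mem_map_of_mem (List.mem_map_of_mem hx), hf x hx⟩
  refine ⟨W.map f, ?_, T, ?_, ?_⟩
  · intro x hx
    obtain ⟨y, hy, rfl⟩ := List.mem_map.1 hx
    have h1 := Code.elt_mem_subgroupOf hy
    rw [hW] at h1
    rw [hf y hy]
    exact h1.1
  · unfold IsCosetCover at hcov ⊢
    rwa [hW']
  · intro t ht
    rw [hW']
    by_cases htW : t.elt ∈ subgroupOf W
    · exact Or.inr htW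
    left
    by_contra! hall
    have hr : t.elt ∈ (scaleHom n m k).range :=
      mem_range_scaleHom.2 fun i => hall i (List.mem_finRange i)
    exact htW (hW ▸ ⟨hTL t ht, hr⟩)

end Scaling

end FreeTimesAbelian

namespace FreeTimesAbelian

/-! ### The homomorphisms `x ↦ (x g)^j g^{-j}` modulo `H` -/

section Delta

variable {n m : ℕ}

/-- The subgroup `H ℤ^m`. -/
def saturation (H : Subgroup (FTA n m)) : Subgroup (FTA n m) :=
  (H.map (MonoidHom.fst _ _)).comap (MonoidHom.fst _ _)

theorem le_saturation (H : Subgroup (FTA n m)) : H ≤ saturation H := fun x hx => ⟨x, hx, rfl⟩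

/-- The quotient of `H ℤ^m` by `H` is abelian. -/
theorem exists_quotient (H : Subgroup (FTA n m)) :
    ∃ (A : Type) (_ : CommGroup A) (q : FTA n m → A),
      (∀ x ∈ saturation H, ∀ y ∈ saturation H, q (x * y) = q x * q y) ∧
        ∀ x ∈ saturation H, q x = 1 ↔ x ∈ H := by
  classical
  -- Each element of `H ℤ^m` is an element of `H` times a central one. Hence `H` is normal in `H
  -- ℤ^m`, and commutators of `H ℤ^m` are already commutators of `H`.
  have hsplit : ∀ x ∈ saturation H, ∃ h ∈ H, ∃ z : FTA n m, z.1 = 1 ∧ x = h * z := by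
    rintro x ⟨h, hh, hx⟩
    refine ⟨h, hh, h⁻¹ * x, ?_, by group⟩
    have hx' : h.1 = x.1 := hx
    simp [hx']
  have hconj : ∀ x ∈ saturation H, ∀ h ∈ H, x * h * x⁻¹ ∈ H := by
    intro x hx h hh
    obtain ⟨y, hy, z, hz, rfl⟩ := hsplit x hx
    have hc := commute_of_fst_eq_one hz h
    have : y * z * h * (y * z)⁻¹ = y * h * y⁻¹ := by
      rw [mul_assoc y, hc]
      group
    rw [this]
    exact H.mul_mem (H.mul_mem hy hh) (H.inv_mem hy)
  have hnormal : (H.subgroupOf (saturation H)).Normal := by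
    constructor
    intro h hh x
    exact hconj x x.2 h hh
  have hcomm : ∀ a b : saturation H ⧸ H.subgroupOf (saturation H), a * b = b * a := by
    intro a b
    induction a using QuotientGroup.induction_on with
    | H a =>
      induction b using QuotientGroup.induction_on with
      | H b =>
        rw [← QuotientGroup.mk_mul, ← QuotientGroup.mk_mul, QuotientGroup.eq,
          Subgroup.mem_subgroupOf]
        obtain ⟨x, hx, z, hz, hxz⟩ := hsplit a a.2
        obtain ⟨y, hy, z', hz', hyz⟩ := hsplit b b.2
        have h1 : ((a : FTA n m) * (b : FTA n m))⁻¹ * ((b : FTA n m) * (a : FTA n m)) =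
            (x * y)⁻¹ * (y * x) := by
          rw [hxz, hyz]
          have e1 : x * z * (y * z') = x * y * (z * z') := by
            rw [mul_assoc, ← mul_assoc z, commute_of_fst_eq_one hz y]; group
          have e2 : y * z' * (x * z) = y * x * (z * z') := by
            rw [mul_assoc, ← mul_assoc z', commute_of_fst_eq_one hz' x, commute_of_fst_eq_one hz z']
            group
          have hzz : (z * z').1 = 1 := by simp [hz, hz']
          rw [e1, e2, ← commute_of_fst_eq_one hzz (x * y), ← commute_of_fst_eq_one hzz (y * x)]
          group
        have : (((a * b)⁻¹ * (b * a) : saturation H) : FTA n m) = (x * y)⁻¹ * (y * x) := h1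
        rw [this]
        exact H.mul_mem (H.inv_mem (H.mul_mem hx hy)) (H.mul_mem hy hx)
  let inst : CommGroup (saturation H ⧸ H.subgroupOf (saturation H)) :=
    { (inferInstance : Group (saturation H ⧸ H.subgroupOf (saturation H))) with mul_comm := hcomm }
  refine ⟨saturation H ⧸ H.subgroupOf (saturation H), inst,
    fun x => if hx : x ∈ saturation H then QuotientGroup.mk (⟨x, hx⟩ : saturation H) else 1, ?_, ?_⟩
  · intro x hx y hy
    simp only [hx, hy, Subgroup.mul_mem _ hx hy, dif_pos]
    rfl
  · intro x hx
    simp only [hx, dif_pos]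
    rw [QuotientGroup.eq_one_iff, Subgroup.mem_subgroupOf]

/-- If the conjugates `g ^ i x g ^ (-i)` of the elements `x` of `C` lie in `H ℤ^m`, then
`x ↦ (x g) ^ j g ^ (-j)` is a homomorphism modulo `H`. -/
theorem exists_delta {H C : Subgroup (FTA n m)} {g : FTA n m} {k : ℕ}
    (hC : ∀ x ∈ C, ∀ i < k, g ^ i * x * (g ^ i)⁻¹ ∈ saturation H) :
    ∃ (A : Type) (_ : CommGroup A) (δ : ℕ → C →* A),
      (∀ j ≤ k, ∀ x : C, δ j x = 1 ↔ (x * g) ^ j * (g ^ j)⁻¹ ∈ H) ∧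
      ∀ j ≤ k, g ^ j ∈ saturation H →
        (∀ x y : C, δ j x = δ j y → ((x * g) ^ j ∈ H ↔ (y * g) ^ j ∈ H)) ∧
        (g ^ k ∈ H → ∀ x : C, (x * g) ^ k ∈ H → δ j x ^ k = 1) := by
  obtain ⟨A, _, q, hq, hqH⟩ := exists_quotient H
  let c : ℕ → C → A := fun i x => if i < k then q (g ^ i * x * (g ^ i)⁻¹) else 1
  have hcmul : ∀ i x y, c i (x * y) = c i x * c i y := by
    intro i x y
    simp only [c]
    split_ifs with hi
    · rw [← hq _ (hC x x.2 i hi) _ (hC y y.2 i hi)]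
      congr 1
      simp [mul_assoc]
    · rw [mul_one]
  have hq1 : q 1 = 1 := (hqH 1 (Subgroup.one_mem _)).2 H.one_mem
  let ch : ℕ → C →* A := fun i =>
    { toFun := c i
      map_one' := by
        simp only [c]
        split_ifs
        · simpa using hq1
        · rfl
      map_mul' := hcmul i }
  have key : ∀ j ≤ k, ∀ x : C, (x * g) ^ j * (g ^ j)⁻¹ ∈ saturation H ∧
      q ((x * g) ^ j * (g ^ j)⁻¹) = (∏ i ∈ Finset.range j, ch i) x := by
    intro j
    induction j with
    | zero =>
      intro _ x
      simp [hq1]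
    | succ j ih =>
      intro hj x
      obtain ⟨h1, h2⟩ := ih (by omega) x
      have h3 : ((x : FTA n m) * g) ^ (j + 1) * (g ^ (j + 1))⁻¹ =
          (x * g) ^ j * (g ^ j)⁻¹ * (g ^ j * x * (g ^ j)⁻¹) := by
        rw [pow_succ, pow_succ]
        group
      rw [h3, Finset.prod_range_succ, MonoidHom.mul_apply, ← h2]
      refine ⟨Subgroup.mul_mem _ h1 (hC x x.2 j hj), ?_⟩
      rw [hq _ h1 _ (hC x x.2 j hj)]
      congr 1
      change _ = c j x
      simp only [c, if_pos (Nat.lt_of_succ_le hj)]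
  have hqpow : ∀ x ∈ saturation H, ∀ i : ℕ, q (x ^ i) = q x ^ i := by
    intro x hx i
    induction i with
    | zero => simpa using hq1
    | succ i ih => rw [pow_succ, pow_succ, hq _ (Subgroup.pow_mem _ hx i) _ hx, ih]
  refine ⟨A, inferInstance, fun j => ∏ i ∈ Finset.range j, ch i, fun j hj x => ?_,
    fun j hj hgj => ?_⟩
  · rw [← (key j hj x).2]
    exact hqH _ (key j hj x).1
  have hsat : ∀ x : C, ((x : FTA n m) * g) ^ j ∈ saturation H := by
    intro x
    have := Subgroup.mul_mem _ (key j hj x).1 hgj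
    rwa [inv_mul_cancel_right] at this
  have hqx : ∀ x : C, q ((x * g) ^ j) = (∏ i ∈ Finset.range j, ch i) x * q (g ^ j) := by
    intro x
    rw [← (key j hj x).2, ← hq _ (key j hj x).1 _ hgj, inv_mul_cancel_right]
  refine ⟨fun x y hxy => ?_, fun hgk x hx => ?_⟩
  · rw [← hqH _ (hsat x), ← hqH _ (hsat y), hqx, hqx, hxy]
  -- The `k`-th power of `(x g)^j` is the `j`-th power of `(x g)^k ∈ H`, and likewise for `g`. So
  -- both classes are killed by `k`, and hence so is their quotient `δ j x`.
  · have h5 : q ((x * g) ^ j) ^ k = 1 := by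
      rw [← hqpow _ (hsat x), ← pow_mul, mul_comm, pow_mul]
      exact (hqH _ (le_saturation H (H.pow_mem hx j))).2 (H.pow_mem hx j)
    have h6 : q (g ^ j) ^ k = 1 := by
      rw [← hqpow _ hgj, ← pow_mul, mul_comm, pow_mul]
      exact (hqH _ (le_saturation H (H.pow_mem hgk j))).2 (H.pow_mem hgk j)
    rw [hqx, mul_pow, h6, mul_one] at h5
    exact h5

/-- The subgroup `K` such that `K g` is the set of `k`-roots of `H` with free part in
`rootStab P g.1 k * g.1`. -/
theorem exists_rootGroup {H : Subgroup (FTA n m)} {P : Subgroup (FreeGroup (Fin n))}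
    (hP : P ≤ H.map (MonoidHom.fst _ _)) (g : FTA n m) (k : ℕ) :
    ∃ K : Subgroup (FTA n m), ∀ x, x ∈ K ↔
      x.1 ∈ rootStab P g.1 k ∧ (x * g) ^ k * (g ^ k)⁻¹ ∈ H := by
  have hC : ∀ x ∈ (rootStab P g.1 k).comap (MonoidHom.fst _ (Multiplicative (Fin m → ℤ))), ∀ i < k,
      g ^ i * x * (g ^ i)⁻¹ ∈ saturation H := fun x hx i hi => hP (hx i hi)
  obtain ⟨A, _, δ, hδ, -⟩ := exists_delta hC
  refine ⟨(δ k).ker.map (Subgroup.subtype _), fun x => ?_⟩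
  constructor
  · rintro ⟨y, hy, rfl⟩
    exact ⟨y.2, (hδ k le_rfl y).1 hy⟩
  · rintro ⟨h1, h2⟩
    exact ⟨⟨x, h1⟩, (hδ k le_rfl ⟨x, h1⟩).2 h2, rfl⟩

/-- The same telescoping product in the free group: all elements of the coset `rootStab P u k * u`
share the vertices `P u^i`, `i ≤ k`. -/
theorem mul_pow_mul_inv_mem {X : Type*} {P : Subgroup (FreeGroup X)} {u x : FreeGroup X} {k : ℕ}
    (hx : x ∈ rootStab P u k) : ∀ i ≤ k, (x * u) ^ i * (u ^ i)⁻¹ ∈ P := by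
  intro i
  induction i with
  | zero => intro _; simp [P.one_mem]
  | succ i ih =>
    intro hi
    have h := P.mul_mem (ih (by omega)) (hx i hi)
    convert h using 1
    rw [pow_succ, pow_succ]
    group

end Delta

end FreeTimesAbelian

namespace FreeTimesAbelian

/-! ### Effective handling of free parts and bounded words -/

section FreeParts

variable {n m : ℕ} {α : Type*} [Primcodable α]

/-- The group of the free parts of the elements of `⟨L⟩`. -/
def freeSubgroup (L : List (Code n m)) : Subgroup (FreeGroup (Fin n)) :=
  wordSubgroup (L.map Prod.fst)

theorem map_fst_subgroupOf (L : List (Code n m)) :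
    (subgroupOf L).map (MonoidHom.fst _ _) = freeSubgroup L := by
  rw [subgroupOf, MonoidHom.map_closure, freeSubgroup, wordSubgroup]
  congr 1
  ext u
  constructor
  · rintro ⟨_, ⟨x, hx, rfl⟩, rfl⟩
    exact ⟨x.1, List.mem_map_of_mem hx, rfl⟩
  · rintro ⟨w, hw, rfl⟩
    obtain ⟨x, hx, rfl⟩ := List.mem_map.1 hw
    exact ⟨Code.elt x, ⟨x, hx, rfl⟩, rfl⟩

theorem mem_freeSubgroup {L : List (Code n m)} {u : FreeGroup (Fin n)} :
    u ∈ freeSubgroup L ↔ ∃ a, (u, a) ∈ subgroupOf L := by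
  rw [← map_fst_subgroupOf]
  constructor
  · rintro ⟨⟨v, a⟩, h, rfl⟩
    exact ⟨a, h⟩
  · rintro ⟨a, h⟩
    exact ⟨(u, a), h, rfl⟩

/-- Setting all vectors to `0` embeds the group of free parts into the product, so the tests for
membership and non-membership there apply. -/
theorem mk_mem_freeSubgroup_iff {L : List (Code n m)} {w : Wd n} :
    FreeGroup.mk w ∈ freeSubgroup L ↔
      Code.elt ((w, 0) : Code n m) ∈ subgroupOf (L.map Code.free) := by
  have h : subgroupOf (L.map Code.free) =
      (freeSubgroup L).map (MonoidHom.inl _ (Multiplicative (Fin m → ℤ))) := by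
    rw [subgroupOf, freeSubgroup, wordSubgroup, MonoidHom.map_closure]
    congr 1
    ext g
    constructor
    · rintro ⟨x, hx, rfl⟩
      obtain ⟨y, hy, rfl⟩ := List.mem_map.1 hx
      exact ⟨FreeGroup.mk y.1, ⟨y.1, List.mem_map_of_mem hy, rfl⟩, rfl⟩
    · rintro ⟨_, ⟨w, hw, rfl⟩, rfl⟩
      obtain ⟨y, hy, rfl⟩ := List.mem_map.1 hw
      exact ⟨Code.free y, List.mem_map_of_mem hy, rfl⟩
  rw [h]
  constructor
  · exact fun hw => ⟨_, hw, rfl⟩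
  · rintro ⟨v, hv, h⟩
    have : v = FreeGroup.mk w := congrArg Prod.fst h
    exact this ▸ hv

theorem semiDec_mem_freeSubgroup {L : α → List (Code n m)} {w : α → Wd n} (hL : Primrec L)
    (hw : Primrec w) : SemiDec fun a => FreeGroup.mk (w a) ∈ freeSubgroup (L a) :=
  (semiDec_mem (f := fun a => (L a).map Code.free) (g := fun a => (w a, 0)) (by fun_prop)
    (by fun_prop)).of_iff fun _ => mk_mem_freeSubgroup_iff

theorem semiDec_notMem_freeSubgroup {L : α → List (Code n m)} {w : α → Wd n} (hL : Primrec L)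
    (hw : Primrec w) : SemiDec fun a => FreeGroup.mk (w a) ∉ freeSubgroup (L a) :=
  (semiDec_notMem (f := fun a => (L a).map Code.free) (g := fun a => (w a, 0)) (by fun_prop)
    (by fun_prop)).of_iff fun _ => not_congr mk_mem_freeSubgroup_iff

@[fun_prop]
theorem primrec_flatten_replicate {i : α → ℕ} {w : α → Wd n} (hi : Primrec i) (hw : Primrec w) :
    Primrec fun a => (List.replicate (i a) (w a)).flatten := by
  have h : Primrec fun a => (List.range (i a)).flatMap fun _ => w a :=
    primrec_flatMap (Primrec.list_range.comp hi) (by fun_prop)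
  refine h.of_eq fun a => ?_
  rw [List.flatMap_def, List.map_const', List.length_range]

theorem semiDec_mem_rootStab {L : α → List (Code n m)} {u x : α → Wd n} {k : α → ℕ}
    (hL : Primrec L) (hu : Primrec u) (hx : Primrec x) (hk : Primrec k) :
    SemiDec fun a =>
      FreeGroup.mk (x a) ∈ rootStab (freeSubgroup (L a)) (FreeGroup.mk (u a)) (k a) := by
  have h : SemiDec fun a => ∀ i < k a, FreeGroup.mk ((List.replicate i (u a)).flatten ++
      (x a ++ FreeGroup.invRev (List.replicate i (u a)).flatten)) ∈ freeSubgroup (L a) := by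
    refine SemiDec.allLt ?_ hk
    exact semiDec_mem_freeSubgroup (by fun_prop) (by fun_prop)
  refine h.of_iff fun a => ?_
  rw [mem_rootStab]
  refine forall₂_congr fun i _ => ?_
  rw [mk_pow_eq, FreeGroup.inv_mk, FreeGroup.mul_mk, FreeGroup.mul_mk, List.append_assoc]

theorem semiDec_notMem_rootStab {L : α → List (Code n m)} {u x : α → Wd n} {k : α → ℕ}
    (hL : Primrec L) (hu : Primrec u) (hx : Primrec x) (hk : Primrec k) :
    SemiDec fun a =>
      FreeGroup.mk (x a) ∉ rootStab (freeSubgroup (L a)) (FreeGroup.mk (u a)) (k a) := by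
  have h : SemiDec fun a => ∃ i < k a, FreeGroup.mk ((List.replicate i (u a)).flatten ++
      (x a ++ FreeGroup.invRev (List.replicate i (u a)).flatten)) ∉ freeSubgroup (L a) := by
    refine SemiDec.exLt ?_ hk
    exact semiDec_notMem_freeSubgroup (by fun_prop) (by fun_prop)
  refine h.of_iff fun a => ?_
  rw [mem_rootStab]
  push Not
  refine exists_congr fun i => and_congr_right fun _ => ?_
  rw [mk_pow_eq, FreeGroup.inv_mk, FreeGroup.mul_mk, FreeGroup.mul_mk, List.append_assoc]

theorem semiDec_rootEquiv {L : α → List (Code n m)} {v u : α → Wd n} {k : α → ℕ}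
    (hL : Primrec L) (hv : Primrec v) (hu : Primrec u) (hk : Primrec k) :
    SemiDec fun a =>
      RootEquiv (freeSubgroup (L a)) (k a) (FreeGroup.mk (v a)) (FreeGroup.mk (u a)) := by
  have h : SemiDec fun a => ∃ h : Wd n, FreeGroup.mk h ∈ freeSubgroup (L a) ∧ ∀ i < k a + 1,
      FreeGroup.mk ((List.replicate i (v a)).flatten ++
        (h ++ FreeGroup.invRev (List.replicate i (u a)).flatten)) ∈ freeSubgroup (L a) := by
    refine SemiDec.ex ?_
    refine SemiDec.and (semiDec_mem_freeSubgroup (by fun_prop) (by fun_prop)) ?_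
    refine SemiDec.allLt ?_ (by fun_prop)
    exact semiDec_mem_freeSubgroup (by fun_prop) (by fun_prop)
  refine h.of_iff fun a => ?_
  have hi : ∀ (h : Wd n) (i : ℕ), FreeGroup.mk ((List.replicate i (v a)).flatten ++
        (h ++ FreeGroup.invRev (List.replicate i (u a)).flatten)) =
      FreeGroup.mk (v a) ^ i * FreeGroup.mk h * (FreeGroup.mk (u a) ^ i)⁻¹ := by
    intro h i
    rw [mk_pow_eq, mk_pow_eq, FreeGroup.inv_mk, FreeGroup.mul_mk, FreeGroup.mul_mk,
      List.append_assoc]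
  simp only [hi, Nat.lt_succ_iff]
  constructor
  · rintro ⟨h, hh, H⟩
    exact ⟨h.toWord, by rwa [FreeGroup.mk_toWord], by rwa [FreeGroup.mk_toWord]⟩
  · rintro ⟨h, hh, H⟩
    exact ⟨FreeGroup.mk h, hh, H⟩

/-- The words of length at most `R`. -/
def wordsUpTo (n R : ℕ) : List (Wd n) :=
  Nat.rec [[]] (fun _ l => [] :: l.flatMap fun w =>
    ((List.finRange n).flatMap fun i => [(i, true), (i, false)]).map fun x => x :: w) R

theorem mem_wordsUpTo {R : ℕ} {w : Wd n} : w ∈ wordsUpTo n R ↔ w.length ≤ R := by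
  induction R generalizing w with
  | zero => simp [wordsUpTo]
  | succ R ih =>
    change w ∈ [] :: (wordsUpTo n R).flatMap _ ↔ _
    cases w with
    | nil => simp
    | cons x w =>
      rw [List.length_cons, Nat.add_le_add_iff_right, ← ih]
      obtain ⟨i, b⟩ := x
      cases b <;> simp

@[fun_prop]
theorem primrec_wordsUpTo {R : α → ℕ} (hR : Primrec R) : Primrec fun a => wordsUpTo n (R a) := by
  unfold wordsUpTo
  refine Primrec.nat_rec' (h := fun _ y => [] :: y.2.flatMap fun w =>
    ((List.finRange n).flatMap fun i => [(i, true), (i, false)]).map fun x => x :: w) hR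
    (Primrec.const _) ?_
  refine primrec_cons (by fun_prop) (primrec_flatMap (by fun_prop) ?_)
  exact primrec_map (Primrec.const _) (by fun_prop)

@[fun_prop]
theorem primrec_totalLength {L : α → List (Wd n)} (hL : Primrec L) :
    Primrec fun a => totalLength (L a) := by
  have h : Primrec fun a => (L a).foldr (fun w s => w.length + 1 + s) 0 :=
    primrec_foldr (h := fun _ w s => w.length + 1 + s) hL (Primrec.const 0) (by fun_prop)
  refine h.of_eq fun a => ?_
  rw [totalLength, List.sum_eq_foldr, List.foldr_map]

@[fun_prop]
theorem primrec_repBound {L : α → List (Wd n)} {k : α → ℕ} (hL : Primrec L) (hk : Primrec k) :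
    Primrec fun a => repBound (L a) (k a) := by
  unfold repBound
  fun_prop

@[fun_prop]
theorem primrec_stabBound {L : α → List (Wd n)} {l k : α → ℕ} (hL : Primrec L) (hl : Primrec l)
    (hk : Primrec k) : Primrec fun a => stabBound (L a) (l a) (k a) := by
  unfold stabBound
  fun_prop

end FreeParts

/-! ### Semidecidable certificates for root decompositions -/

section RootSystems

variable {n m : ℕ} {α : Type*} [Primcodable α]

/-- A finite certificate for the fact that the coded coset `c` is the set of `k`-roots of `⟨L⟩`
with free part in `rootStab P w k * w`, where `w` is the free part of the representative and `P`
is the group of the free parts of `⟨Q⟩`. -/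
def IsRootCoset (L : List (Code n m)) (k : ℕ) (Q Z : List (Code n m)) (c : CosetCode n m) : Prop :=
  (c.2.pow k).elt ∈ subgroupOf L ∧
  (∀ x ∈ c.1, FreeGroup.mk x.1 ∈ rootStab (freeSubgroup Q) (FreeGroup.mk c.2.1) k ∧
    ((x.mul c.2).pow k).elt ∈ subgroupOf L) ∧
  (∀ v ∈ wordsUpTo n (stabBound (Q.map Prod.fst) c.2.1.length k),
    FreeGroup.mk v ∉ rootStab (freeSubgroup Q) (FreeGroup.mk c.2.1) k ∨
      ∃ b : Fin m → ℤ, Code.elt (v, b) ∈ subgroupOf c.1) ∧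
  ∀ z ∈ Z, z.elt ∈ subgroupOf c.1

/-- A finite certificate for a decomposition of the set of `k`-roots of `⟨L⟩`. -/
def IsRootSystem (L : List (Code n m)) (k : ℕ) (Q : List (Code n m)) (D : List (CosetCode n m)) :
    Prop :=
  IsScalePreimage L k Q ∧
  (∃ A : Aut n m, A.IsCert Q ∧ ∀ c ∈ D, IsRootCoset L k Q (A.kerList Q) c) ∧
  (D.Pairwise fun c c' => ∃ i < k, FreeGroup.mk ((List.replicate i c.2.1).flatten ++
    FreeGroup.invRev (List.replicate i c'.2.1).flatten) ∉ freeSubgroup Q) ∧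
  ∀ u ∈ wordsUpTo n (repBound (Q.map Prod.fst) k),
    FreeGroup.mk (List.replicate k u).flatten ∉ freeSubgroup Q ∨
      ∃ c ∈ D, RootEquiv (freeSubgroup Q) k (FreeGroup.mk u) (FreeGroup.mk c.2.1)

theorem semiDec_isRootCoset {L Q Z : α → List (Code n m)} {k : α → ℕ} {c : α → CosetCode n m}
    (hL : Primrec L) (hk : Primrec k) (hQ : Primrec Q) (hZ : Primrec Z) (hc : Primrec c) :
    SemiDec fun a => IsRootCoset (L a) (k a) (Q a) (Z a) (c a) := by
  unfold IsRootCoset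
  refine SemiDec.and (semiDec_mem (by fun_prop) (by fun_prop)) (SemiDec.and ?_ (SemiDec.and ?_ ?_))
  · refine SemiDec.all ?_ (by fun_prop)
    exact SemiDec.and (semiDec_mem_rootStab (by fun_prop) (by fun_prop) (by fun_prop) (by fun_prop))
      (semiDec_mem (by fun_prop) (by fun_prop))
  · refine SemiDec.all ?_ (by fun_prop)
    refine SemiDec.or (semiDec_notMem_rootStab (by fun_prop) (by fun_prop) (by fun_prop)
      (by fun_prop)) ?_
    refine SemiDec.ex ?_
    exact semiDec_mem (by fun_prop) (by fun_prop)
  · refine SemiDec.all ?_ (by fun_prop)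
    exact semiDec_mem (by fun_prop) (by fun_prop)

theorem semiDec_isRootSystem {L Q : α → List (Code n m)} {k : α → ℕ} {D : α → List (CosetCode n m)}
    (hL : Primrec L) (hk : Primrec k) (hQ : Primrec Q) (hD : Primrec D) :
    SemiDec fun a => IsRootSystem (L a) (k a) (Q a) (D a) := by
  unfold IsRootSystem
  refine SemiDec.and (semiDec_isScalePreimage (by fun_prop) (by fun_prop) (by fun_prop))
    (SemiDec.and ?_ (SemiDec.and ?_ ?_))
  · refine SemiDec.ex ?_
    refine SemiDec.and (semiDec_isCert (by fun_prop) (by fun_prop)) ?_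
    refine SemiDec.all ?_ (by fun_prop)
    exact semiDec_isRootCoset (by fun_prop) (by fun_prop) (by fun_prop) (by fun_prop) (by fun_prop)
  · refine SemiDec.pairwise ?_ hD
    refine SemiDec.exLt ?_ (by fun_prop)
    exact semiDec_notMem_freeSubgroup (by fun_prop) (by fun_prop)
  · refine SemiDec.all ?_ (by fun_prop)
    refine SemiDec.or (semiDec_notMem_freeSubgroup (by fun_prop) (by fun_prop)) ?_
    refine SemiDec.exMem ?_ (by fun_prop)
    exact semiDec_rootEquiv (by fun_prop) (by fun_prop) (by fun_prop) (by fun_prop)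

end RootSystems

end FreeTimesAbelian

namespace FreeTimesAbelian

/-! ### Soundness and existence of root systems -/

section RootSystems

variable {n m : ℕ} {L Q : List (Code n m)} {k : ℕ}

theorem IsScalePreimage.mem_iff (hk : 1 ≤ k) (hQ : IsScalePreimage L k Q) {u : FreeGroup (Fin n)}
    {a : Multiplicative (Fin m → ℤ)} : (u, a) ∈ subgroupOf Q ↔ (u, a ^ k) ∈ subgroupOf L := by
  rw [hQ.subgroupOf_eq hk]
  rfl

/-- With `exists_root`, this reduces roots of `⟨L⟩` to roots in the free group: `(u t^a)^k = u^k
t^{ka}` lies in `⟨L⟩` iff `u^k t^a` lies in `⟨Q⟩`. -/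
theorem IsScalePreimage.pow_mem_freeSubgroup (hk : 1 ≤ k) (hQ : IsScalePreimage L k Q)
    {g : FTA n m} (hg : g ^ k ∈ subgroupOf L) : g.1 ^ k ∈ freeSubgroup Q :=
  mem_freeSubgroup.2 ⟨g.2, (hQ.mem_iff hk).2 hg⟩

theorem IsScalePreimage.exists_root (hk : 1 ≤ k) (hQ : IsScalePreimage L k Q)
    {u : FreeGroup (Fin n)} (hu : u ^ k ∈ freeSubgroup Q) :
    ∃ a, ((u, a) : FTA n m) ^ k ∈ subgroupOf L := by
  obtain ⟨a, ha⟩ := mem_freeSubgroup.1 hu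
  exact ⟨a, (hQ.mem_iff hk).1 ha⟩

theorem IsScalePreimage.freeSubgroup_le (hk : 1 ≤ k) (hQ : IsScalePreimage L k Q) :
    freeSubgroup Q ≤ (subgroupOf L).map (MonoidHom.fst _ _) := by
  intro u hu
  obtain ⟨a, ha⟩ := mem_freeSubgroup.1 hu
  exact ⟨(u, a ^ k), (hQ.mem_iff hk).1 ha, rfl⟩

theorem mul_inv_pow_mem_iff {H : Subgroup (FTA n m)} {g : FTA n m} (hg : g ^ k ∈ H) {x : FTA n m} :
    x ^ k * (g ^ k)⁻¹ ∈ H ↔ x ^ k ∈ H :=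
  Subgroup.mul_mem_cancel_right _ (H.inv_mem hg)

/-- The right-hand side defines a group `K`, which contains the listed generators. Conversely the
short generators of `rootStab` lift to `⟨c.1⟩`, so an element of `K` can be corrected to have
trivial free part. What remains is a vector `a` with `ka ∈ ⟨L⟩`, that is, an element of `⟨Q⟩ ∩ ℤ^m`,
generated by `kerList`. -/
theorem IsRootCoset.mem_iff (hk : 1 ≤ k) (hQ : IsScalePreimage L k Q) {A : Aut n m}
    (hA : A.IsCert Q) {c : CosetCode n m} (hc : IsRootCoset L k Q (A.kerList Q) c) {x : FTA n m} :
    x ∈ subgroupOf c.1 ↔ x.1 ∈ rootStab (freeSubgroup Q) (FreeGroup.mk c.2.1) k ∧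
      (x * c.2.elt) ^ k ∈ subgroupOf L := by
  obtain ⟨h1, h2, h3, h4⟩ := hc
  rw [Code.elt_pow] at h1
  obtain ⟨K, hK⟩ := exists_rootGroup (hQ.freeSubgroup_le hk) (Code.elt c.2) k
  have hK' : ∀ x, x ∈ K ↔ x.1 ∈ rootStab (freeSubgroup Q) (FreeGroup.mk c.2.1) k ∧
      (x * c.2.elt) ^ k ∈ subgroupOf L := by
    intro x
    rw [hK, mul_inv_pow_mem_iff h1]
    rfl
  rw [← hK']
  have hle : subgroupOf c.1 ≤ K := by
    rw [subgroupOf_le_iff]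
    intro x hx
    rw [hK']
    exact ⟨(h2 x hx).1, by simpa using (h2 x hx).2⟩
  refine ⟨fun hx => hle hx, fun hx => ?_⟩
  have hlift : ∀ u ∈ rootStab (freeSubgroup Q) (FreeGroup.mk c.2.1) k,
      u ∈ (subgroupOf c.1).map (MonoidHom.fst _ _) := by
    intro u hu
    have hcl := rootStab_le_closure (Q.map Prod.fst) c.2.1 k hu
    refine (Subgroup.closure_le _).2 ?_ hcl
    rintro _ ⟨hv, v, hlen, rfl⟩
    rcases h3 v (mem_wordsUpTo.2 hlen) with h | ⟨b, hb⟩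
    · exact absurd hv h
    · exact ⟨_, hb, rfl⟩
  obtain ⟨y, hy, hyx⟩ := hlift _ ((hK' x).1 hx).1
  have hyx' : y.1 = x.1 := hyx
  have hz : x * y⁻¹ ∈ K := K.mul_mem hx (K.inv_mem (hle hy))
  have hz1 : (x * y⁻¹).1 = 1 := by simp [hyx']
  have hzc : x * y⁻¹ ∈ subgroupOf c.1 := by
    refine subgroupOf_le_iff.2 h4 ?_
    rw [hA.mem_kerList_iff]
    refine ⟨?_, hz1⟩
    have h5 := (hK _).1 hz
    rw [Commute.mul_pow (commute_of_fst_eq_one hz1 (Code.elt c.2)), mul_inv_cancel_right] at h5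
    have h6 : (1, (x * y⁻¹).2 ^ k) ∈ subgroupOf L := by
      convert h5.2 using 1
      ext1
      · simp only [Prod.pow_fst, hz1, one_pow]
      · rfl
    have h7 := (hQ.mem_iff hk).2 h6
    convert h7 using 1
    exact Prod.ext hz1 rfl
  have := Subgroup.mul_mem _ hzc hy
  rwa [inv_mul_cancel_right] at this

theorem IsRootCoset.mem_coset_iff (hk : 1 ≤ k) (hQ : IsScalePreimage L k Q) {A : Aut n m}
    (hA : A.IsCert Q) {c : CosetCode n m} (hc : IsRootCoset L k Q (A.kerList Q) c) {y : FTA n m} :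
    y ∈ CosetCode.coset c ↔
      y.1 * (FreeGroup.mk c.2.1)⁻¹ ∈ rootStab (freeSubgroup Q) (FreeGroup.mk c.2.1) k ∧
        y ^ k ∈ subgroupOf L := by
  constructor
  · rintro ⟨x, hx, rfl⟩
    obtain ⟨h1, h2⟩ := (hc.mem_iff hk hQ hA).1 hx
    refine ⟨?_, h2⟩
    convert h1 using 1
    exact mul_inv_cancel_right _ _
  · rintro ⟨h1, h2⟩
    refine ⟨y * (Code.elt c.2)⁻¹, (hc.mem_iff hk hQ hA).2 ⟨h1, ?_⟩, ?_⟩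
    · rwa [inv_mul_cancel_right]
    · exact (inv_mul_cancel_right _ _).symm

theorem RootEquiv.trans {X : Type*} {P : Subgroup (FreeGroup X)} {u v w : FreeGroup X}
    (h : RootEquiv P k u v) (h' : RootEquiv P k v w) : RootEquiv P k u w := by
  obtain ⟨x, hx, H⟩ := h
  obtain ⟨y, hy, H'⟩ := h'
  refine ⟨x * y, P.mul_mem hx hy, fun i hi => ?_⟩
  have := P.mul_mem (H i hi) (H' i hi)
  convert this using 1
  group

theorem IsRootSystem.separated {D : List (CosetCode n m)} (h : IsRootSystem L k Q D) :
    D.Pairwise fun c c' => ∃ i < k, FreeGroup.mk c.2.1 ^ i * (FreeGroup.mk c'.2.1 ^ i)⁻¹ ∉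
      freeSubgroup Q := by
  refine h.2.2.1.imp fun {c c'} hcc => ?_
  obtain ⟨i, hi, H⟩ := hcc
  refine ⟨i, hi, ?_⟩
  rwa [mk_pow_eq, mk_pow_eq, FreeGroup.inv_mk, FreeGroup.mul_mk]

/-- A common element of two cosets would force their representatives to share the vertices `P u^i`,
`i < k`, against the separation clause. For the covering, the free part of a root is equivalent to a
short word and then to a listed representative. The translating element of `P` lifts to `⟨L⟩`, and
conjugation by the lift moves the root into the listed coset. -/
theorem IsRootSystem.isCosetDecomposition {D : List (CosetCode n m)} (hk : 1 ≤ k)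
    (h : IsRootSystem L k Q D) :
    IsCosetDecomposition (subgroupOf L) (kRoots k (subgroupOf L : Set (FTA n m))) D := by
  have hsep := h.separated
  obtain ⟨hQ, ⟨A, hA, hD⟩, -, hcov⟩ := h
  refine ⟨fun c hc => ?_, ?_, ?_⟩
  · have := (hD c hc).1
    rwa [Code.elt_pow] at this
  · refine List.Pairwise.imp_of_mem ?_ hsep
    intro c c' hc hc' hcc
    rw [Set.disjoint_left]
    intro y hy hy'
    obtain ⟨i, hi, hni⟩ := hcc
    have h1 := mul_pow_mul_inv_mem (((hD c hc).mem_coset_iff hk hQ hA).1 hy).1 i hi.le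
    have h2 := mul_pow_mul_inv_mem (((hD c' hc').mem_coset_iff hk hQ hA).1 hy').1 i hi.le
    rw [inv_mul_cancel_right] at h1 h2
    refine hni ?_
    have := Subgroup.mul_mem _ (Subgroup.inv_mem _ h1) h2
    convert this using 1
    group
  · ext y
    constructor
    · intro hy
      have hy' : y ^ k ∈ subgroupOf L := hy
      obtain ⟨u, hulen, hu⟩ := exists_short_rootEquiv (Q.map Prod.fst) hk
        (hQ.pow_mem_freeSubgroup hk hy')
      have hP : wordSubgroup (Q.map Prod.fst) = freeSubgroup Q := rfl
      rw [hP] at hu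
      have huk : FreeGroup.mk u ^ k ∈ freeSubgroup Q := by
        obtain ⟨x, hx, H⟩ := hu
        have h1 := Subgroup.mul_mem _ (hQ.pow_mem_freeSubgroup hk hy') hx
        have h2 := Subgroup.mul_mem _ (Subgroup.inv_mem _ (H k le_rfl)) h1
        convert h2 using 1
        group
      rcases hcov u (mem_wordsUpTo.2 hulen) with h | ⟨c, hc, huc⟩
      · rw [← mk_pow_eq] at h
        exact absurd huk h
      obtain ⟨x, hx, H⟩ := hu.trans huc
      obtain ⟨g, hg, hgx⟩ := hQ.freeSubgroup_le hk hx
      have hgx' : g.1 = x := hgx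
      refine ⟨g⁻¹, Subgroup.inv_mem _ hg, g⁻¹ * y * g, ⟨c, hc, ?_⟩, by group⟩
      rw [(hD c hc).mem_coset_iff hk hQ hA]
      refine ⟨fun i hi => ?_, ?_⟩
      -- With `v` the free part of `y` and `u` that of the representative, the quotient of the
      -- conditions at `i` and `i + 1` is `u^i (x⁻¹ v x u⁻¹) u^{-i}`.
      · have h1 := Subgroup.mul_mem _ (Subgroup.inv_mem _ (H i hi.le)) (H (i + 1) hi)
        convert h1 using 1
        simp only [Prod.fst_mul, Prod.fst_inv, hgx', pow_succ]
        group
      · have : (g⁻¹ * y * g) ^ k = g⁻¹ * y ^ k * g := by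
          have := conj_pow (i := k) (a := g⁻¹) (b := y)
          rwa [inv_inv] at this
        rw [this]
        exact Subgroup.mul_mem _ (Subgroup.mul_mem _ (Subgroup.inv_mem _ hg) hy') hg
    · rintro ⟨g, hg, x, ⟨c, hc, hx⟩, rfl⟩
      have h1 := (((hD c hc).mem_coset_iff hk hQ hA).1 hx).2
      have : (g⁻¹ * x * g) ^ k = g⁻¹ * x ^ k * g := by
        have := conj_pow (i := k) (a := g⁻¹) (b := x)
        rwa [inv_inv] at this
      change (g⁻¹ * x * g) ^ k ∈ subgroupOf L
      rw [this]
      exact Subgroup.mul_mem _ (Subgroup.mul_mem _ (Subgroup.inv_mem _ hg) h1) hg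

theorem IsRootSystem.rep_fst_ne {D : List (CosetCode n m)} (h : IsRootSystem L k Q D) :
    D.Pairwise fun c c' => (CosetCode.rep c).1 ≠ (CosetCode.rep c').1 := by
  refine h.separated.imp fun {c c'} hcc he => ?_
  obtain ⟨i, hi, hni⟩ := hcc
  have he' : FreeGroup.mk c.2.1 = FreeGroup.mk c'.2.1 := he
  rw [he', mul_inv_cancel] at hni
  exact hni (Subgroup.one_mem _)

/-- Greedy choice from the end of the list; neither symmetry nor transitivity of `r` is needed. -/
theorem exists_representatives {β : Type*} (r : β → β → Prop) (hr : ∀ b, r b b) (l : List β) :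
    ∃ s : List β, (∀ b ∈ s, b ∈ l) ∧ s.Pairwise (fun b c => ¬ r b c) ∧ ∀ b ∈ l, ∃ c ∈ s, r b c := by
  induction l with
  | nil => exact ⟨[], by simp⟩
  | cons a l ih =>
    obtain ⟨s, h1, h2, h3⟩ := ih
    by_cases ha : ∃ c ∈ s, r a c
    · refine ⟨s, fun b hb => List.mem_cons_of_mem _ (h1 b hb), h2, fun b hb => ?_⟩
      rcases List.mem_cons.1 hb with rfl | hb
      · exact ha
      · exact h3 b hb
    · push Not at ha
      refine ⟨a :: s, ?_, List.pairwise_cons.2 ⟨ha, h2⟩, ?_⟩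
      · intro b hb
        rcases List.mem_cons.1 hb with rfl | hb
        · exact List.mem_cons_self
        · exact List.mem_cons_of_mem _ (h1 b hb)
      · intro b hb
        rcases List.mem_cons.1 hb with rfl | hb
        · exact ⟨b, List.mem_cons_self, hr b⟩
        · obtain ⟨c, hc, h⟩ := h3 b hb
          exact ⟨c, List.mem_cons_of_mem _ hc, h⟩

/-- Generators are one lift of each short element of `rootStab`, together with the vectors of
`kerList`. A lift exists because multiplying `w` by an element of `rootStab` gives another root of
`freeSubgroup Q`. -/
theorem exists_isRootCoset (hk : 1 ≤ k) (hQ : IsScalePreimage L k Q) {A : Aut n m}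
    (hA : A.IsCert Q) {w : Wd n} (hw : FreeGroup.mk w ^ k ∈ freeSubgroup Q) :
    ∃ c : CosetCode n m, c.2.1 = w ∧ IsRootCoset L k Q (A.kerList Q) c := by
  classical
  obtain ⟨a, ha⟩ := hQ.exists_root hk hw
  have hlift : ∀ v : Wd n, ∃ b : Fin m → ℤ,
      FreeGroup.mk v ∈ rootStab (freeSubgroup Q) (FreeGroup.mk w) k →
        (Code.elt (v, b) * (FreeGroup.mk w, a)) ^ k ∈ subgroupOf L := by
    intro v
    by_cases hv : FreeGroup.mk v ∈ rootStab (freeSubgroup Q) (FreeGroup.mk w) k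
    · have h1 := Subgroup.mul_mem _ (mul_pow_mul_inv_mem hv k le_rfl) hw
      rw [inv_mul_cancel_right] at h1
      obtain ⟨a', ha'⟩ := hQ.exists_root hk h1
      refine ⟨Multiplicative.toAdd (a' * a⁻¹), fun _ => ?_⟩
      convert ha' using 2
      exact Prod.ext rfl (inv_mul_cancel_right _ _)
    · exact ⟨0, fun h => absurd h hv⟩
  choose b hb using hlift
  let W : List (Code n m) := ((wordsUpTo n (stabBound (Q.map Prod.fst) w.length k)).filter
    fun v => FreeGroup.mk v ∈ rootStab (freeSubgroup Q) (FreeGroup.mk w) k).map fun v => (v, b v)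
  refine ⟨(W ++ A.kerList Q, (w, Multiplicative.toAdd a)), rfl, ?_, ?_, ?_, ?_⟩
  · rw [Code.elt_pow]
    exact ha
  · intro x hx
    rw [Code.elt_pow, Code.elt_mul]
    rcases List.mem_append.1 hx with hx | hx
    · obtain ⟨v, hv, rfl⟩ := List.mem_map.1 hx
      have hv' := (List.mem_filter.1 hv).2
      rw [decide_eq_true_iff] at hv'
      exact ⟨hv', hb v hv'⟩
    · have h1 := (hA.mem_kerList_iff).1 (Code.elt_mem_subgroupOf hx)
      have h2 : FreeGroup.mk x.1 = 1 := h1.2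
      refine ⟨by rw [h2]; exact Subgroup.one_mem _, ?_⟩
      rw [Commute.mul_pow (commute_of_fst_eq_one h1.2 _)]
      refine Subgroup.mul_mem _ ?_ ha
      have h3 := (hQ.mem_iff hk (u := x.elt.1) (a := x.elt.2)).1 h1.1
      convert h3 using 1
      ext1
      · simp only [Prod.pow_fst, h1.2, one_pow]
      · rfl
  · intro v hv
    by_cases hvs : FreeGroup.mk v ∈ rootStab (freeSubgroup Q) (FreeGroup.mk w) k
    · refine Or.inr ⟨b v, Code.elt_mem_subgroupOf (List.mem_append_left _ ?_)⟩
      exact List.mem_map.2 ⟨v, List.mem_filter.2 ⟨hv, by simpa using hvs⟩, rfl⟩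
    · exact Or.inl hvs
  · intro z hz
    exact Code.elt_mem_subgroupOf (List.mem_append_right _ hz)

theorem exists_isRootSystem (L : List (Code n m)) (hk : 1 ≤ k) :
    ∃ (Q : List (Code n m)) (D : List (CosetCode n m)), IsRootSystem L k Q D := by
  classical
  obtain ⟨Q, hQ⟩ := exists_isScalePreimage L hk
  obtain ⟨A, hA⟩ := exists_isCert Q
  obtain ⟨S, hS1, hS2, hS3⟩ := exists_representatives
    (fun u v : Wd n => RootEquiv (freeSubgroup Q) k (FreeGroup.mk u) (FreeGroup.mk v))
    (fun u => ⟨1, Subgroup.one_mem _, fun i _ => by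
      rw [mul_one, mul_inv_cancel]; exact Subgroup.one_mem _⟩)
    ((wordsUpTo n (repBound (Q.map Prod.fst) k)).filter
      fun u => FreeGroup.mk u ^ k ∈ freeSubgroup Q)
  have hSk : ∀ u ∈ S, FreeGroup.mk u ^ k ∈ freeSubgroup Q := by
    intro u hu
    simpa using (List.mem_filter.1 (hS1 u hu)).2
  have hex : ∀ u : Wd n, ∃ c : CosetCode n m, FreeGroup.mk u ^ k ∈ freeSubgroup Q →
      c.2.1 = u ∧ IsRootCoset L k Q (A.kerList Q) c := by
    intro u
    by_cases hu : FreeGroup.mk u ^ k ∈ freeSubgroup Q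
    · obtain ⟨c, hc⟩ := exists_isRootCoset hk hQ hA hu
      exact ⟨c, fun _ => hc⟩
    · exact ⟨([], Code.one), fun h => absurd h hu⟩
  choose c hc using hex
  refine ⟨Q, S.map c, hQ, ⟨A, hA, ?_⟩, ?_, ?_⟩
  · intro d hd
    obtain ⟨u, hu, rfl⟩ := List.mem_map.1 hd
    exact (hc u (hSk u hu)).2
  · rw [List.pairwise_map]
    refine List.Pairwise.imp_of_mem ?_ hS2
    intro u v hu hv huv
    rw [(hc u (hSk u hu)).1, (hc v (hSk v hv)).1]
    -- If the vertices agree for all `i < k`, the words are equivalent with translating element `1`: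
    -- at `i = k` both powers lie in the subgroup anyway.
    by_contra! hall
    refine huv ⟨1, Subgroup.one_mem _, fun i hi => ?_⟩
    rw [mul_one]
    rcases hi.lt_or_eq with hi | rfl
    · have := hall i hi
      rwa [← FreeGroup.mul_mk, ← FreeGroup.inv_mk, ← mk_pow_eq, ← mk_pow_eq] at this
    · exact Subgroup.mul_mem _ (hSk u hu) (Subgroup.inv_mem _ (hSk v hv))
  · intro u hu
    rw [← mk_pow_eq]
    by_cases huk : FreeGroup.mk u ^ k ∈ freeSubgroup Q
    · right
      obtain ⟨v, hv, huv⟩ := hS3 u (List.mem_filter.2 ⟨hu, by simpa using huk⟩)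
      refine ⟨c v, List.mem_map_of_mem hv, ?_⟩
      rw [(hc v (hSk v hv)).1]
      exact huv
    · exact Or.inl huk

end RootSystems

end FreeTimesAbelian

namespace FreeTimesAbelian

/-! ### Elements of given order and their certificates -/

section Orders

variable {n m : ℕ} {α : Type*} [Primcodable α]

theorem mem_ofOrder {G : Type*} [Group G] {H : Subgroup G} {k : ℕ} (hk : 1 ≤ k) {g : G} :
    g ∈ ofOrder k (H : Set G) ↔ g ^ k ∈ H ∧ ∀ j < k, j ≠ 0 → g ^ j ∉ H := by
  change sInf {j : ℕ | 1 ≤ j ∧ g ^ j ∈ (H : Set G)} = k ↔ _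
  constructor
  · intro h
    have hne : {j : ℕ | 1 ≤ j ∧ g ^ j ∈ (H : Set G)}.Nonempty := by
      by_contra hne
      rw [Set.not_nonempty_iff_eq_empty] at hne
      rw [hne, Nat.sInf_empty] at h
      omega
    have hmem := Nat.sInf_mem hne
    rw [h] at hmem
    refine ⟨hmem.2, fun j hj hj0 hgj => ?_⟩
    rw [← h] at hj
    exact Nat.notMem_of_lt_sInf hj ⟨Nat.one_le_iff_ne_zero.2 hj0, hgj⟩
  · rintro ⟨h1, h2⟩
    refine le_antisymm (Nat.sInf_le ⟨hk, h1⟩) ?_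
    refine le_csInf ⟨k, hk, h1⟩ fun j hj => ?_
    by_contra! hjk
    exact h2 j hjk (by have := hj.1; omega) hj.2

theorem conj_mem_ofOrder_iff {G : Type*} [Group G] {H : Subgroup G} {k : ℕ} (hk : 1 ≤ k) {g h : G}
    (hh : h ∈ H) : h⁻¹ * g * h ∈ ofOrder k (H : Set G) ↔ g ∈ ofOrder k (H : Set G) := by
  have hpow : ∀ j : ℕ, (h⁻¹ * g * h) ^ j ∈ H ↔ g ^ j ∈ H := by
    intro j
    have : (h⁻¹ * g * h) ^ j = h⁻¹ * g ^ j * h := by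
      have := conj_pow (i := j) (a := h⁻¹) (b := g)
      rwa [inv_inv] at this
    rw [this, Subgroup.mul_mem_cancel_right _ hh, Subgroup.mul_mem_cancel_left _ (H.inv_mem hh)]
  simp only [mem_ofOrder hk, hpow]

/-- The element coded by `x` has order `k ≥ 1` in `⟨L⟩`. -/
def HasOrder (L : List (Code n m)) (k : ℕ) (x : Code n m) : Prop :=
  (x.pow k).elt ∈ subgroupOf L ∧ ∀ j < k, j = 0 ∨ (x.pow j).elt ∉ subgroupOf L

theorem hasOrder_iff {L : List (Code n m)} {k : ℕ} (hk : 1 ≤ k) {x : Code n m} :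
    HasOrder L k x ↔ x.elt ∈ ofOrder k (subgroupOf L : Set (FTA n m)) := by
  rw [mem_ofOrder hk, HasOrder, Code.elt_pow]
  refine and_congr_right fun _ => forall₂_congr fun j _ => ?_
  rw [Code.elt_pow, ← or_iff_not_imp_left]

theorem semiDec_hasOrder {L : α → List (Code n m)} {k : α → ℕ} {x : α → Code n m} (hL : Primrec L)
    (hk : Primrec k) (hx : Primrec x) : SemiDec fun a => HasOrder (L a) (k a) (x a) := by
  unfold HasOrder
  refine SemiDec.and (semiDec_mem (by fun_prop) (by fun_prop)) ?_
  refine SemiDec.allLt ?_ hk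
  exact SemiDec.or (SemiDec.of_primrec (Primrec.eq.comp (by fun_prop) (by fun_prop)))
    (semiDec_notMem (by fun_prop) (by fun_prop))

theorem semiDec_not_hasOrder {L : α → List (Code n m)} {k : α → ℕ} {x : α → Code n m}
    (hL : Primrec L) (hk : Primrec k) (hx : Primrec x) :
    SemiDec fun a => ¬ HasOrder (L a) (k a) (x a) := by
  have h : SemiDec fun a => ((x a).pow (k a)).elt ∉ subgroupOf (L a) ∨
      ∃ j < k a, ¬ j = 0 ∧ ((x a).pow j).elt ∈ subgroupOf (L a) := by
    refine SemiDec.or (semiDec_notMem (by fun_prop) (by fun_prop)) ?_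
    refine SemiDec.exLt ?_ hk
    exact SemiDec.and (SemiDec.of_primrec (PrimrecPred.not
      (Primrec.eq.comp (by fun_prop) (by fun_prop)))) (semiDec_mem (by fun_prop) (by fun_prop))
  refine h.of_iff fun a => ?_
  rw [HasOrder, not_and_or]
  push Not
  rfl

theorem SemiDec.mem {β : Type*} [Primcodable β] {f : α → β} {l : α → List β} (hf : Primrec f)
    (hl : Primrec l) : SemiDec fun a => f a ∈ l a := by
  classical
  exact (SemiDec.exMem (p := fun a b => b = f a)
    (SemiDec.of_primrec (Primrec.eq.comp Primrec.snd (hf.comp Primrec.fst))) hl).of_iff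
      fun a => by simp

/-- A finite certificate for the fact that the cosets `⟨W⟩ t g`, `t ∈ T`, decompose the elements
of order `k` in the coset `c` with representative `g`. -/
def IsOrderPiece (L : List (Code n m)) (k : ℕ) (c : CosetCode n m) (W T : List (Code n m)) : Prop :=
  (∀ x ∈ W, x.elt ∈ subgroupOf c.1 ∧ ∀ j < k,
    FreeGroup.mk (List.replicate j c.2.1).flatten ∉ freeSubgroup L ∨
      (((x.mul c.2).pow j).mul (c.2.pow j).inv).elt ∈ subgroupOf L) ∧
  (∀ t ∈ T, t.elt ∈ subgroupOf c.1 ∧ HasOrder L k (t.mul c.2)) ∧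
  (T.Pairwise fun t t' => (t.mul t'.inv).elt ∉ subgroupOf W) ∧
  ∃ T' : List (Code n m), IsCosetCover c.1 W T' ∧ ∀ t ∈ T', ¬ HasOrder L k (t.mul c.2) ∨ t ∈ T

/-- A finite certificate for a decomposition of the set of elements of order `k`. -/
def IsOrderSystem (L : List (Code n m)) (k : ℕ)
    (E : List (CosetCode n m × List (Code n m) × List (Code n m))) : Prop :=
  (∃ Q : List (Code n m), IsRootSystem L k Q (E.map Prod.fst)) ∧
    ∀ p ∈ E, IsOrderPiece L k p.1 p.2.1 p.2.2

theorem semiDec_isOrderSystem {L : α → List (Code n m)} {k : α → ℕ}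
    {E : α → List (CosetCode n m × List (Code n m) × List (Code n m))} (hL : Primrec L)
    (hk : Primrec k) (hE : Primrec E) : SemiDec fun a => IsOrderSystem (L a) (k a) (E a) := by
  unfold IsOrderSystem
  refine SemiDec.and ?_ ?_
  · refine SemiDec.ex ?_
    exact semiDec_isRootSystem (by fun_prop) (by fun_prop) (by fun_prop) (by fun_prop)
  refine SemiDec.all ?_ hE
  unfold IsOrderPiece
  refine SemiDec.and ?_ (SemiDec.and ?_ (SemiDec.and ?_ ?_))
  · refine SemiDec.all ?_ (by fun_prop)
    refine SemiDec.and (semiDec_mem (by fun_prop) (by fun_prop)) ?_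
    refine SemiDec.allLt ?_ (by fun_prop)
    exact SemiDec.or (semiDec_notMem_freeSubgroup (by fun_prop) (by fun_prop))
      (semiDec_mem (by fun_prop) (by fun_prop))
  · refine SemiDec.all ?_ (by fun_prop)
    exact SemiDec.and (semiDec_mem (by fun_prop) (by fun_prop))
      (semiDec_hasOrder (by fun_prop) (by fun_prop) (by fun_prop))
  · refine SemiDec.pairwise ?_ (by fun_prop)
    exact semiDec_notMem (by fun_prop) (by fun_prop)
  · refine SemiDec.ex ?_
    refine SemiDec.and (semiDec_isCosetCover (by fun_prop) (by fun_prop) (by fun_prop)) ?_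
    refine SemiDec.all ?_ (by fun_prop)
    refine SemiDec.or (semiDec_not_hasOrder (by fun_prop) (by fun_prop) (by fun_prop)) ?_
    exact SemiDec.mem (by fun_prop) (by fun_prop)

/-- The coset codes extracted from an order system. -/
def orderCosets (E : List (CosetCode n m × List (Code n m) × List (Code n m))) :
    List (CosetCode n m) :=
  E.flatMap fun p => p.2.2.map fun t => (p.2.1, t.mul p.1.2)

@[fun_prop]
theorem primrec_orderCosets :
    Primrec (orderCosets : List (CosetCode n m × List (Code n m) × List (Code n m)) → _) := by
  unfold orderCosets
  fun_prop

end Orders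

end FreeTimesAbelian

namespace FreeTimesAbelian

/-! ### Soundness and existence of order systems -/

section OrderSystems

variable {n m : ℕ} {L Q : List (Code n m)} {k : ℕ}

theorem mk_flatten_mem_freeSubgroup_iff {x : Code n m} {j : ℕ} :
    FreeGroup.mk (List.replicate j x.1).flatten ∈ freeSubgroup L ↔
      x.elt ^ j ∈ saturation (subgroupOf L) := by
  rw [← mk_pow_eq, ← map_fst_subgroupOf]
  rfl

theorem IsRootCoset.conj_mem_saturation (hk : 1 ≤ k) (hQ : IsScalePreimage L k Q) {A : Aut n m}
    (hA : A.IsCert Q) {c : CosetCode n m} (hc : IsRootCoset L k Q (A.kerList Q) c) :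
    ∀ x ∈ subgroupOf c.1, ∀ i < k,
      c.2.elt ^ i * x * (c.2.elt ^ i)⁻¹ ∈ saturation (subgroupOf L) :=
  fun _ hx i hi => hQ.freeSubgroup_le hk (((hc.mem_iff hk hQ hA).1 hx).1 i hi)

theorem IsOrderPiece.le {c : CosetCode n m} {W T : List (Code n m)} (h : IsOrderPiece L k c W T) :
    subgroupOf W ≤ subgroupOf c.1 :=
  subgroupOf_le_iff.2 fun x hx => (h.1 x hx).1

/-- Let `g` be the representative and `H = ⟨L⟩`. For `j < k` with `g^j ∉ H ℤ^m`, no `(z g)^j` with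
`z ∈ ⟨c.1⟩` lies in `H`. Otherwise membership of `(z g)^j` depends only on `δ j z`, and `δ j` kills
`⟨W⟩`. -/
theorem IsOrderPiece.mul_mem_ofOrder_iff (hk : 1 ≤ k) (hQ : IsScalePreimage L k Q) {A : Aut n m}
    (hA : A.IsCert Q) {c : CosetCode n m} (hc : IsRootCoset L k Q (A.kerList Q) c)
    {W T : List (Code n m)} (h : IsOrderPiece L k c W T) {x y : FTA n m} (hx : x ∈ subgroupOf W)
    (hy : y ∈ subgroupOf c.1) :
    x * y * c.2.elt ∈ ofOrder k (subgroupOf L : Set (FTA n m)) ↔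
      y * c.2.elt ∈ ofOrder k (subgroupOf L : Set (FTA n m)) := by
  obtain ⟨B, _, δ, hδ, hδ'⟩ := exists_delta (hc.conj_mem_saturation hk hQ hA)
  have hxc := h.le hx
  have hxy := Subgroup.mul_mem _ hxc hy
  have hpow : ∀ j < k, (x * y * c.2.elt) ^ j ∈ subgroupOf L ↔ (y * c.2.elt) ^ j ∈ subgroupOf L := by
    intro j hj
    by_cases hg : c.2.elt ^ j ∈ saturation (subgroupOf L)
    · have hle : subgroupOf W ≤ (δ j).ker.map (Subgroup.subtype _) := by
        rw [subgroupOf_le_iff]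
        intro z hz
        refine ⟨⟨z.elt, (h.1 z hz).1⟩, ?_, rfl⟩
        refine (hδ j hj.le _).2 ?_
        rcases (h.1 z hz).2 j hj with h1 | h1
        · exact absurd (mk_flatten_mem_freeSubgroup_iff.2 hg) h1
        · simpa only [Code.elt_mul, Code.elt_pow, Code.elt_inv] using h1
      obtain ⟨z, hz, hzx⟩ := hle hx
      have hz' : δ j ⟨x, hxc⟩ = 1 := by
        have : (⟨x, hxc⟩ : subgroupOf c.1) = z := Subtype.ext hzx.symm
        rw [this]
        exact hz
      refine (hδ' j hj.le hg).1 ⟨x * y, hxy⟩ ⟨y, hy⟩ ?_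
      have : (⟨x * y, hxy⟩ : subgroupOf c.1) = ⟨x, hxc⟩ * ⟨y, hy⟩ := rfl
      rw [this, map_mul, hz', one_mul]
    · have hno : ∀ z ∈ subgroupOf c.1, (z * c.2.elt) ^ j ∉ subgroupOf L := by
        intro z hz hmem
        have h1 : (z * c.2.elt) ^ j * (c.2.elt ^ j)⁻¹ ∈ saturation (subgroupOf L) :=
          hQ.freeSubgroup_le hk
            (mul_pow_mul_inv_mem ((hc.mem_iff hk hQ hA).1 hz).1 j hj.le)
        have h2 := Subgroup.mul_mem _ (Subgroup.inv_mem _ h1) (le_saturation _ hmem)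
        refine hg ?_
        convert h2 using 1
        group
      exact iff_of_false (hno _ hxy) (hno _ hy)
  rw [mem_ofOrder hk, mem_ofOrder hk]
  refine and_congr (iff_of_true ((hc.mem_iff hk hQ hA).1 hxy).2 ((hc.mem_iff hk hQ hA).1 hy).2) ?_
  exact forall₂_congr fun j hj => by rw [hpow j hj]

theorem mem_orderCosets {E : List (CosetCode n m × List (Code n m) × List (Code n m))}
    {d : CosetCode n m} :
    d ∈ orderCosets E ↔ ∃ p ∈ E, ∃ t ∈ p.2.2, (p.2.1, t.mul p.1.2) = d := by
  simp only [orderCosets, List.mem_flatMap, List.mem_map]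

theorem IsOrderPiece.coset_subset {c : CosetCode n m} {W T : List (Code n m)}
    (h : IsOrderPiece L k c W T) {t : Code n m} (ht : t ∈ T) :
    CosetCode.coset (W, t.mul c.2) ⊆ CosetCode.coset c := by
  rintro _ ⟨x, hx, rfl⟩
  refine ⟨x * t.elt, Subgroup.mul_mem _ (h.le hx) (h.2.1 t ht).1, ?_⟩
  change x * (t.mul c.2).elt = x * t.elt * c.2.elt
  rw [Code.elt_mul, mul_assoc]

/-- Refines the root decomposition: having order `k` is invariant under conjugation by `⟨L⟩` and
constant on the cosets of each `⟨W⟩`. Disjointness comes from the root cosets for different pieces,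
and from the separation of `T` within a piece. -/
theorem IsOrderSystem.isCosetDecomposition (hk : 1 ≤ k)
    {E : List (CosetCode n m × List (Code n m) × List (Code n m))} (h : IsOrderSystem L k E) :
    IsCosetDecomposition (subgroupOf L) (ofOrder k (subgroupOf L : Set (FTA n m)))
      (orderCosets E) := by
  obtain ⟨⟨Q, hR⟩, hE⟩ := h
  have hdec := hR.isCosetDecomposition hk
  obtain ⟨hQ, ⟨A, hA, hD⟩, -, -⟩ := hR
  replace hD : ∀ p ∈ E, IsRootCoset L k Q (A.kerList Q) p.1 :=
    fun p hp => hD p.1 (List.mem_map_of_mem hp)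
  refine ⟨fun d hd => ?_, ?_, ?_⟩
  · obtain ⟨p, hp, t, ht, rfl⟩ := mem_orderCosets.1 hd
    exact (hasOrder_iff hk).1 ((hE p hp).2.1 t ht).2
  · rw [orderCosets, List.pairwise_flatMap]
    refine ⟨fun p hp => ?_, ?_⟩
    · rw [List.pairwise_map]
      refine (hE p hp).2.2.1.imp fun {t t'} htt => ?_
      rw [Set.disjoint_left]
      rintro _ ⟨x, hx, rfl⟩ ⟨y, hy, hxy⟩
      refine htt ?_
      have hxy' : x * (t.mul p.1.2).elt = y * (t'.mul p.1.2).elt := hxy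
      rw [Code.elt_mul, Code.elt_mul, ← mul_assoc, ← mul_assoc, mul_left_inj] at hxy'
      rw [Code.elt_mul, Code.elt_inv]
      have := Subgroup.mul_mem _ (Subgroup.inv_mem _ hx) hy
      convert this using 1
      rw [eq_inv_mul_iff_mul_eq, ← mul_assoc, hxy', mul_inv_cancel_right]
    · have hdisj := List.pairwise_map.1 hdec.disjoint
      refine List.Pairwise.imp_of_mem ?_ hdisj
      intro p p' hp hp' hpp d hd d' hd'
      obtain ⟨t, ht, rfl⟩ := List.mem_map.1 hd
      obtain ⟨t', ht', rfl⟩ := List.mem_map.1 hd'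
      exact hpp.mono ((hE p hp).coset_subset ht) ((hE p' hp').coset_subset ht')
  · ext g
    constructor
    · intro hg
      have hroot : g ∈ kRoots k (subgroupOf L : Set (FTA n m)) := ((mem_ofOrder hk).1 hg).1
      rw [hdec.eq] at hroot
      obtain ⟨h, hh, z, ⟨c, hc, hz⟩, rfl⟩ := hroot
      refine ⟨h, hh, z, ?_, rfl⟩
      rw [conj_mem_ofOrder_iff hk hh] at hg
      obtain ⟨p, hp, rfl⟩ := List.mem_map.1 hc
      obtain ⟨y, hy, rfl⟩ := hz
      obtain ⟨T', hT', hTT⟩ := (hE p hp).2.2.2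
      obtain ⟨t, ht, hyt⟩ := hT'.exists_mem hy
      have htc : t.elt ∈ subgroupOf p.1.1 := by
        have := Subgroup.mul_mem _ (Subgroup.inv_mem _ ((hE p hp).le hyt)) hy
        convert this using 1
        group
      have hord := (hE p hp).mul_mem_ofOrder_iff hk hQ hA (hD p hp) hyt htc
      rw [inv_mul_cancel_right] at hord
      have hto := hord.1 hg
      rw [← Code.elt_mul, ← hasOrder_iff hk] at hto
      have htT := (hTT t ht).resolve_left (not_not_intro hto)
      refine ⟨_, mem_orderCosets.2 ⟨p, hp, t, htT, rfl⟩, y * t.elt⁻¹, hyt, ?_⟩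
      change y * p.1.2.elt = y * t.elt⁻¹ * (t.mul p.1.2).elt
      rw [Code.elt_mul]
      group
    · rintro ⟨h, hh, z, ⟨d, hd, hz⟩, rfl⟩
      rw [conj_mem_ofOrder_iff hk hh]
      obtain ⟨p, hp, t, ht, rfl⟩ := mem_orderCosets.1 hd
      obtain ⟨x, hx, rfl⟩ := hz
      obtain ⟨htc, hto⟩ := (hE p hp).2.1 t ht
      have hord := (hE p hp).mul_mem_ofOrder_iff hk hQ hA (hD p hp) hx htc
      change x * (t.mul p.1.2).elt ∈ _
      rw [hasOrder_iff hk, Code.elt_mul] at hto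
      rw [Code.elt_mul, ← mul_assoc]
      exact hord.2 hto

/-- The image is a finitely generated abelian torsion group, hence finite. -/
theorem finiteIndex_ker_of_pow_eq_one {C B : Type*} [Group C] [Group.FG C] [CommGroup B]
    (f : C →* B) (hk : 1 ≤ k) (hf : ∀ x, f x ^ k = 1) : f.ker.FiniteIndex := by
  have htors : IsMulTorsion f.range := by
    rintro ⟨_, x, rfl⟩
    exact isOfFinOrder_iff_pow_eq_one.2 ⟨k, hk, Subtype.ext (hf x)⟩
  have : Finite f.range := CommGroup.finite_of_fg_isMulTorsion f.range htors
  infer_instance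

theorem exists_isOrderPiece (hk : 1 ≤ k) (hQ : IsScalePreimage L k Q) {A : Aut n m}
    (hA : A.IsCert Q) {c : CosetCode n m} (hc : IsRootCoset L k Q (A.kerList Q) c) :
    ∃ W T, IsOrderPiece L k c W T := by
  classical
  obtain ⟨B, _, δ, hδ, hδ'⟩ := exists_delta (hc.conj_mem_saturation hk hQ hA)
  have hgk : c.2.elt ^ k ∈ subgroupOf L := by
    have := hc.1
    rwa [Code.elt_pow] at this
  have hfg : Group.FG (subgroupOf c.1) := (Group.fg_iff_subgroup_fg _).2 (fg_subgroupOf c.1)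
  -- Only exponents `j < k` with `c.2.elt ^ j ∈ H ℤ^m` matter, where `H = ⟨L⟩`; for these `δ j`
  -- takes values of exponent dividing `k`, so the intersection of the kernels has finite index.
  let N : Subgroup (subgroupOf c.1) :=
    ⨅ j : {j : Fin k // c.2.elt ^ (j : ℕ) ∈ saturation (subgroupOf L)}, (δ j.1).ker
  have hN : N.FiniteIndex := by
    refine Subgroup.finiteIndex_iInf fun j => ?_
    refine finiteIndex_ker_of_pow_eq_one _ hk fun x => ?_
    exact (hδ' j.1 j.1.2.le j.2).2 hgk x ((hc.mem_iff hk hQ hA).1 x.2).2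
  have hNle : N.map (Subgroup.subtype _) ≤ subgroupOf c.1 := by
    rintro _ ⟨x, -, rfl⟩
    exact x.2
  have hN' : ((N.map (Subgroup.subtype _)).subgroupOf (subgroupOf c.1)).FiniteIndex := by
    rwa [Subgroup.subgroupOf, Subgroup.comap_map_eq_self_of_injective (Subgroup.subtype_injective _)]
  obtain ⟨W, T, hW, hT, hcov, hpw⟩ := exists_cosetCover c.1 hNle hN'
  refine ⟨W, T.filter fun t => HasOrder L k (t.mul c.2), fun x hx => ?_, fun t ht => ?_,
    hpw.filter _, T, hcov, fun t ht => ?_⟩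
  · have hxW := Code.elt_mem_subgroupOf hx
    rw [hW] at hxW
    obtain ⟨z, hz, hzx⟩ := hxW
    have hzx' : (z : FTA n m) = x.elt := hzx
    refine ⟨hzx' ▸ z.2, fun j hj => ?_⟩
    by_cases hg : c.2.elt ^ j ∈ saturation (subgroupOf L)
    · right
      have h1 := (hδ j hj.le z).1 ((Subgroup.mem_iInf.1 hz) ⟨⟨j, hj⟩, hg⟩)
      rw [hzx'] at h1
      simpa only [Code.elt_mul, Code.elt_pow, Code.elt_inv] using h1
    · left
      rwa [mk_flatten_mem_freeSubgroup_iff]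
  · obtain ⟨h1, h2⟩ := List.mem_filter.1 ht
    exact ⟨hT t h1, by simpa using h2⟩
  · by_cases hto : HasOrder L k (t.mul c.2)
    · exact Or.inr (List.mem_filter.2 ⟨ht, by simpa using hto⟩)
    · exact Or.inl hto

theorem exists_isOrderSystem (L : List (Code n m)) (hk : 1 ≤ k) : ∃ E, IsOrderSystem L k E := by
  obtain ⟨Q, D, hR⟩ := exists_isRootSystem L hk
  have hex : ∀ c, ∃ p : List (Code n m) × List (Code n m), c ∈ D → IsOrderPiece L k c p.1 p.2 := by
    intro c
    by_cases hc : c ∈ D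
    · obtain ⟨hQ, ⟨A, hA, hD⟩, -, -⟩ := hR
      obtain ⟨W, T, h⟩ := exists_isOrderPiece hk hQ hA (hD c hc)
      exact ⟨(W, T), fun _ => h⟩
    · exact ⟨([], []), fun h => absurd h hc⟩
  choose p hp using hex
  refine ⟨D.map fun c => (c, p c), ⟨Q, ?_⟩, fun e he => ?_⟩
  · rw [List.map_map]
    convert hR using 1
    exact List.map_id' D
  · obtain ⟨c, hc, rfl⟩ := List.mem_map.1 he
    exact hp c hc

end OrderSystems

end FreeTimesAbelian

namespace FreeTimesAbelian

/-! ### The algorithms, by search for certificates -/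

section Algorithms

theorem exists_computable_rootSystem (n m : ℕ) :
    ∃ f : List (Code n m) × ℕ → List (CosetCode n m), Computable f ∧
      ∀ L k, 1 ≤ k → ∃ Q, IsRootSystem L k Q (f (L, k)) := by
  -- The alternative `k = 0` makes the relation total, as uniformization requires; certificates are
  -- only shown to exist for `k ≥ 1`.
  have hs : SemiDec fun x : (List (Code n m) × ℕ) × List (CosetCode n m) =>
      x.1.2 = 0 ∨ ∃ Q, IsRootSystem x.1.1 x.1.2 Q x.2 := by
    refine SemiDec.or (SemiDec.of_primrec (Primrec.eq.comp (by fun_prop) (by fun_prop))) ?_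
    refine SemiDec.ex ?_
    exact semiDec_isRootSystem (by fun_prop) (by fun_prop) (by fun_prop) (by fun_prop)
  obtain ⟨f, hf, h⟩ := SemiDec.exists_computable
    (p := fun (a : List (Code n m) × ℕ) D => a.2 = 0 ∨ ∃ Q, IsRootSystem a.1 a.2 Q D) hs fun a => by
      rcases Nat.eq_zero_or_pos a.2 with h0 | hk
      · exact ⟨[], Or.inl h0⟩
      · obtain ⟨Q, D, h⟩ := exists_isRootSystem a.1 hk
        exact ⟨D, Or.inr ⟨Q, h⟩⟩
  exact ⟨f, hf, fun L k hk => (h (L, k)).resolve_left (Nat.one_le_iff_ne_zero.1 hk)⟩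

theorem exists_computable_hasOrder (n m : ℕ) :
    ∃ f : List (Code n m) × ℕ × Code n m → Bool, Computable f ∧
      ∀ L k x, 1 ≤ k →
        (f (L, k, x) = true ↔ x.elt ∈ ofOrder k (subgroupOf L : Set (FTA n m))) := by
  obtain ⟨f, hf, h⟩ := SemiDec.exists_decision
    (p := fun a : List (Code n m) × ℕ × Code n m => HasOrder a.1 a.2.1 a.2.2)
    (semiDec_hasOrder (by fun_prop) (by fun_prop) (by fun_prop))
    (semiDec_not_hasOrder (by fun_prop) (by fun_prop) (by fun_prop))
  exact ⟨f, hf, fun L k x hk => (h (L, k, x)).trans (hasOrder_iff hk)⟩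

theorem exists_computable_orderCosets (n m : ℕ) :
    ∃ f : List (Code n m) × ℕ → List (CosetCode n m), Computable f ∧
      ∀ L k, 1 ≤ k → IsCosetDecomposition (subgroupOf L)
        (ofOrder k (subgroupOf L : Set (FTA n m))) (f (L, k)) := by
  have hs : SemiDec fun x : (List (Code n m) × ℕ) ×
      List (CosetCode n m × List (Code n m) × List (Code n m)) =>
      x.1.2 = 0 ∨ IsOrderSystem x.1.1 x.1.2 x.2 :=
    SemiDec.or (SemiDec.of_primrec (Primrec.eq.comp (by fun_prop) (by fun_prop)))
      (semiDec_isOrderSystem (by fun_prop) (by fun_prop) (by fun_prop))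
  obtain ⟨f, hf, h⟩ := SemiDec.exists_computable
    (p := fun (a : List (Code n m) × ℕ) E => a.2 = 0 ∨ IsOrderSystem a.1 a.2 E) hs fun a => by
      rcases Nat.eq_zero_or_pos a.2 with h0 | hk
      · exact ⟨[], Or.inl h0⟩
      · obtain ⟨E, h⟩ := exists_isOrderSystem a.1 hk
        exact ⟨E, Or.inr h⟩
  refine ⟨fun x => orderCosets (f x), primrec_orderCosets.to_comp.comp hf, fun L k hk => ?_⟩
  exact IsOrderSystem.isCosetDecomposition hk
    ((h (L, k)).resolve_left (Nat.one_le_iff_ne_zero.1 hk))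

theorem primrec_not_isEmpty {β : Type*} [Primcodable β] :
    Primrec fun l : List β => !l.isEmpty :=
  (Primrec.list_casesOn (f := fun l : List β => l) (g := fun _ => false) (h := fun _ _ => true)
    Primrec.id (Primrec.const _) (Primrec.const _).to₂).of_eq fun l => by cases l <;> rfl

/-- Reduces the non-emptiness problem to inspecting the computed list. -/
theorem IsCosetDecomposition.ne_nil_iff {n m : ℕ} {H : Subgroup (FTA n m)} {X : Set (FTA n m)}
    {D : List (CosetCode n m)} (h : IsCosetDecomposition H X D) : D ≠ [] ↔ X.Nonempty := by
  constructor
  · intro hD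
    obtain ⟨c, hc⟩ := List.exists_mem_of_ne_nil D hD
    exact ⟨_, h.rep_mem c hc⟩
  · rintro ⟨x, hx⟩ rfl
    rw [h.eq] at hx
    obtain ⟨_, _, _, ⟨c, hc, _⟩, _⟩ := hx
    exact absurd hc List.not_mem_nil

end Algorithms

end FreeTimesAbelian

theorem mainTheorem11 (n m : ℕ) :
    -- the set of `k`-roots
    (∃ roots : List (FreeTimesAbelian.Code n m) × ℕ → List (FreeTimesAbelian.CosetCode n m),
      Computable roots ∧
      ∀ (L : List (FreeTimesAbelian.Code n m)) (k : ℕ), 1 ≤ k →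
        FreeTimesAbelian.IsCosetDecomposition (FreeTimesAbelian.subgroupOf L)
          (FreeTimesAbelian.kRoots k (FreeTimesAbelian.subgroupOf L : Set (FreeTimesAbelian.FTA n m))) (roots (L, k)) ∧
        -- the free parts of the representatives are distinct
        (roots (L, k)).Pairwise fun c c' =>
          (FreeTimesAbelian.CosetCode.rep c).1 ≠ (FreeTimesAbelian.CosetCode.rep c').1) ∧
    -- membership in the set of elements of order `k` is decidable
    (∃ mem : List (FreeTimesAbelian.Code n m) × ℕ × FreeTimesAbelian.Code n m → Bool,
      Computable mem ∧
      ∀ (L : List (FreeTimesAbelian.Code n m)) (k : ℕ) (x : FreeTimesAbelian.Code n m), 1 ≤ k →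
        (mem (L, k, x) = true ↔ FreeTimesAbelian.Code.elt x ∈
          FreeTimesAbelian.ofOrder k (FreeTimesAbelian.subgroupOf L : Set (FreeTimesAbelian.FTA n m)))) ∧
    -- non-emptiness of the set of elements of order `k` is decidable
    (∃ dec : List (FreeTimesAbelian.Code n m) × ℕ → Bool,
      Computable dec ∧
      ∀ (L : List (FreeTimesAbelian.Code n m)) (k : ℕ), 1 ≤ k →
        (dec (L, k) = true ↔
          (FreeTimesAbelian.ofOrder k (FreeTimesAbelian.subgroupOf L : Set (FreeTimesAbelian.FTA n m))).Nonempty)) ∧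
    -- the set of elements of order `k`
    (∃ elts : List (FreeTimesAbelian.Code n m) × ℕ → List (FreeTimesAbelian.CosetCode n m),
      Computable elts ∧
      ∀ (L : List (FreeTimesAbelian.Code n m)) (k : ℕ), 1 ≤ k →
        FreeTimesAbelian.IsCosetDecomposition (FreeTimesAbelian.subgroupOf L)
          (FreeTimesAbelian.ofOrder k (FreeTimesAbelian.subgroupOf L : Set (FreeTimesAbelian.FTA n m)))
          (elts (L, k))) := by
  refine ⟨?_, ?_, ?_⟩
  · obtain ⟨f, hf, h⟩ := FreeTimesAbelian.exists_computable_rootSystem n m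
    refine ⟨f, hf, fun L k hk => ?_⟩
    obtain ⟨Q, hQ⟩ := h L k hk
    exact ⟨hQ.isCosetDecomposition hk, hQ.rep_fst_ne⟩
  · exact FreeTimesAbelian.exists_computable_hasOrder n m
  · obtain ⟨f, hf, h⟩ := FreeTimesAbelian.exists_computable_orderCosets n m
    refine ⟨⟨fun x => !(f x).isEmpty, ?_, fun L k hk => ?_⟩, f, hf, h⟩
    · exact FreeTimesAbelian.primrec_not_isEmpty.to_comp.comp hf
    · simpa using (h L k hk).ne_nil_iff
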